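/- **Theorem.** Let $\lambda\vdash n$ be a partition whose Young diagram has at most two columns, let $S$ be the set of simple reflections $s_i=(i,i+1)$ of the symmetric group $S_n$, and let $S^\lambda$ be the real Specht module (the span of the polytabloids in the real permutation module on tabloids of shape $\lambda$). Let $\mathcal H$ be the Hecke algebra of $S_n$ over $\mathbb Z[v,v^{-1}]$ with standard basis $\delta_x$, where $\delta_s^2=(v^{-1}-v)\delta_s+1$ for $s\in S$. Let $b_x=\sum_{y\le x}h_{y,x}\delta_y$ be its Kazhdan–Lusztig basis (bar invariant, $h_{x,x}=1$, $h_{y,x}\in v\mathbb Z[v]$ for $y<x$), and put $\tilde b_x=\sum_{y\le x}(-1)^{\ell(x)+\ell(y)}\overline{h_{y,x}}\,\delta_y$. The left preorder $\le_L$ is the reflexive and transitive closure of the relation "$b_y$ appears with non-zero coefficient in $b_sb_x$ for some $s\in S$", and left cells are the classes of the associated equivalence relation. A left cell $X$ gives the left cell representation $\langle\tilde b_y\mid y\le_L x\rangle/\langle\tilde b_y\mid y<_Lx\rangle$ ($x\in X$) with basis the classes of $\tilde b_y$, $y\in X$; setting $v=1$ makes it a representation of $S_n$. A *Kazhdan–Lusztig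 left cell basis* of $S^\lambda$ is a basis of $S^\lambda$ in which every $s\in S$ acts by the same matrix as in such a left cell representation at $v=1$, for some left cell $X$ and some indexing of the basis by $X$. An *invariant cone* in $S^\lambda$ is a closed set $C\subseteq S^\lambda$ that is closed under non-negative linear combinations and satisfies $(1+s)C\subseteq C$ for all $s\in S$; it is *proper* if $C\cap(-C)=\{0\}$ and $C$ has non-empty interior. Then $S^\lambda$ has a Kazhdan–Lusztig left cell basis, and every such basis spans (by non-negative linear combinations) the maximal invariant cone of $S^\lambda$, which is unique up to sign: the cone $C$ that it spans is a proper invariant cone, and every invariant cone $D\neq S^\lambda$ satisfies $D\subseteq C$ or $D\subseteq -C$. -/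

import Mathlib

open scoped LaurentPolynomial Polynomial

noncomputable section

namespace KLCone

/-! ### The symmetric group as a Coxeter group -/

/-- `S_n`, acting on `{0, …, n-1}`. -/
abbrev Sym (n : ℕ) : Type := Equiv.Perm (Fin n)

/-- `s` is a simple reflection, i.e. an adjacent transposition `(i, i+1)`. -/
def IsSimple {n : ℕ} (s : Sym n) : Prop :=
  ∃ (i : ℕ) (h : i + 1 < n), s = Equiv.swap ⟨i, Nat.lt_of_succ_lt h⟩ ⟨i + 1, h⟩

/-- `l` is an expression of `w` as a product of simple reflections. -/
def IsExpr {n : ℕ} (w : Sym n) (l : List (Sym n)) : Prop :=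
  (∀ s ∈ l, IsSimple s) ∧ l.prod = w

/-- The Coxeter length: the least number of simple reflections in an expression of `w`. -/
def len {n : ℕ} (w : Sym n) : ℕ :=
  sInf {k | ∃ l : List (Sym n), IsExpr w l ∧ l.length = k}

theorem exists_isExpr {n : ℕ} (w : Sym n) : ∃ l : List (Sym n), IsExpr w l := by
  cases n with
  | zero => exact ⟨[], by simp, Subsingleton.elim _ _⟩
  | succ m =>
    have hw : w ∈ Submonoid.closure
        (Set.range fun i : Fin m => Equiv.swap i.castSucc i.succ) := by
      rw [Equiv.Perm.mclosure_swap_castSucc_succ]; trivial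
    obtain ⟨l, hl, rfl⟩ := Submonoid.exists_list_of_mem_closure hw
    refine ⟨l, fun s hs => ?_, rfl⟩
    obtain ⟨i, rfl⟩ := hl s hs
    exact ⟨i, Nat.succ_lt_succ i.2, rfl⟩

theorem exists_reduced {n : ℕ} (w : Sym n) :
    ∃ l : List (Sym n), IsExpr w l ∧ l.length = len w := by
  obtain ⟨l, hl⟩ := exists_isExpr w
  exact Nat.sInf_mem (s := {k | ∃ l : List (Sym n), IsExpr w l ∧ l.length = k}) ⟨_, l, hl, rfl⟩

/-- A reduced expression of `w`. -/
def reducedWord {n : ℕ} (w : Sym n) : List (Sym n) := (exists_reduced w).choose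

/-- The Bruhat order: the reflexive transitive closure of `x → x t` for reflections `t` (conjugates
of simple reflections) with `ℓ(x) ≤ ℓ(x t)`. -/
def Bruhat {n : ℕ} : Sym n → Sym n → Prop :=
  Relation.ReflTransGen fun x y =>
    len x ≤ len y ∧ ∃ s w : Sym n, IsSimple s ∧ x * (w⁻¹ * s * w) = y

/-! ### The Hecke algebra and its Kazhdan–Lusztig basis -/

/-- The Hecke algebra of `S_n` over `ℤ[v, v⁻¹]`, as the free module on the standard basis
`δ_x`, `x ∈ S_n`: the function `f` stands for `∑ x, f x • δ_x`. The variable `v` is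
`LaurentPolynomial.T 1`. -/
abbrev Hecke (n : ℕ) : Type := Sym n → ℤ[T;T⁻¹]

/-- The standard basis element `δ_x`. -/
def stdElt {n : ℕ} (x : Sym n) : Hecke n := Pi.single x 1

/-- Left multiplication by `δ_s` for a simple reflection `s`: one has `δ_s δ_x = δ_{sx}` if
`ℓ(sx) > ℓ(x)` and `δ_s δ_x = δ_{sx} + (v⁻¹ - v) δ_x` if `ℓ(sx) < ℓ(x)`. -/
def mulStd {n : ℕ} (s : Sym n) (f : Hecke n) : Hecke n := fun y =>
  f (s * y) +
    if len (s * y) < len y then (LaurentPolynomial.T (-1) - LaurentPolynomial.T 1) * f y else 0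

/-- Left multiplication by `δ_s⁻¹ = δ_s + (v - v⁻¹)`. -/
def mulStdInv {n : ℕ} (s : Sym n) (f : Hecke n) : Hecke n :=
  mulStd s f +
    ((LaurentPolynomial.T 1 - LaurentPolynomial.T (-1) : ℤ[T;T⁻¹])) • f

/-- `(δ_{x⁻¹})⁻¹ = δ_{s₁}⁻¹ ⋯ δ_{s_k}⁻¹` for a reduced expression `x = s₁ ⋯ s_k`. -/
def barStd {n : ℕ} (x : Sym n) : Hecke n := (reducedWord x).foldr mulStdInv (stdElt 1)

/-- The bar involution: `v ↦ v⁻¹`, `δ_x ↦ (δ_{x⁻¹})⁻¹`. -/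
def bar {n : ℕ} (f : Hecke n) : Hecke n := ∑ x, LaurentPolynomial.invert (f x) • barStd x

/-- `b` is the Kazhdan–Lusztig basis: `b_x` is bar invariant and `b_x = δ_x + ∑_{y < x} h_{y,x} δ_y`
with `h_{y,x} ∈ v ℤ[v]`. -/
def IsKLBasis {n : ℕ} (b : Sym n → Hecke n) : Prop :=
  ∀ x, bar (b x) = b x ∧ b x x = 1 ∧
    ∀ y, y ≠ x →
      (∃ q : ℤ[X], b x y = LaurentPolynomial.T 1 * Polynomial.toLaurent q) ∧
      (¬ Bruhat y x → b x y = 0)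

/-- The signed variant `b̃_x = ∑_{y ≤ x} (-1)^{ℓ(x) + ℓ(y)} \overline{h_{y,x}} δ_y` of `b_x`. -/
def tildeKL {n : ℕ} (b : Sym n → Hecke n) (x : Sym n) : Hecke n := fun y =>
  (-1) ^ (len x + len y) * LaurentPolynomial.invert (b x y)

/-! ### Left cells -/

/-- `b_y` appears with non-zero coefficient in `b_s b_x = δ_s b_x + v b_x` for some simple
reflection `s`. -/
def LeftStep {n : ℕ} (b : Sym n → Hecke n) (y x : Sym n) : Prop :=
  ∃ s : Sym n, IsSimple s ∧ ∃ c : Sym n → ℤ[T;T⁻¹],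
    mulStd s (b x) + (LaurentPolynomial.T 1 : ℤ[T;T⁻¹]) • b x = ∑ z, c z • b z ∧ c y ≠ 0

/-- The left preorder `y ≤_L x`. -/
def LeftLE {n : ℕ} (b : Sym n → Hecke n) : Sym n → Sym n → Prop :=
  Relation.ReflTransGen (LeftStep b)

/-- The left cell of `x`. -/
def leftCell {n : ℕ} (b : Sym n → Hecke n) (x : Sym n) : Set (Sym n) :=
  {y | LeftLE b y x ∧ LeftLE b x y}

/-- `M` is the matrix by which the simple reflection `s` acts, at `v = 1`, on the left cell
representation `H_{≤_L x} / H_{<_L x}` of the left cell of `x`, in the basis formed by the classes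
of the `b̃_y`, `y` in the left cell. (The `b̃_y` with `y <_L x` vanish in the quotient.) -/
def IsCellMatrix {n : ℕ} (b : Sym n → Hecke n) (x s : Sym n)
    (M : Matrix (leftCell b x) (leftCell b x) ℝ) : Prop :=
  ∃ c : Sym n → Sym n → ℤ[T;T⁻¹],
    (∀ z, mulStd s (tildeKL b z) = ∑ y, c y z • tildeKL b y) ∧
    ∀ y z : leftCell b x, M y z = LaurentPolynomial.eval₂ (Int.castRingHom ℝ) 1 (c y z)

/-! ### Specht modules -/

/-- Young tableaux of shape `μ`: bijective fillings of the boxes of `μ` by `{0, …, n-1}`. (There are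
none unless `μ` has `n` boxes.) -/
abbrev Tableau (μ : YoungDiagram) (n : ℕ) : Type := {c // c ∈ μ.cells} ≃ Fin n

/-- The row of the entry `k` of `T`. -/
def rowOf {μ : YoungDiagram} {n : ℕ} (T : Tableau μ n) (k : Fin n) : ℕ := (T.symm k).1.1

/-- The column of the entry `k` of `T`. -/
def colOf {μ : YoungDiagram} {n : ℕ} (T : Tableau μ n) (k : Fin n) : ℕ := (T.symm k).1.2

/-- Tabloids: tableaux up to permutations of the entries within the rows. -/
def Tabloid (μ : YoungDiagram) (n : ℕ) : Type :=
  Quotient (Setoid.ker (rowOf : Tableau μ n → Fin n → ℕ))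

/-- The tabloid `{T}`. -/
def toTabloid {μ : YoungDiagram} {n : ℕ} (T : Tableau μ n) : Tabloid μ n := Quotient.mk _ T

/-- `σ {T} = {σ T}`, where `σ T` is `T` with `σ` applied to all entries. -/
def Tabloid.act {μ : YoungDiagram} {n : ℕ} (σ : Sym n) : Tabloid μ n → Tabloid μ n :=
  Quotient.map (fun T => T.trans σ) fun T T' h => by
    have h' : rowOf T = rowOf T' := h
    change rowOf (T.trans σ) = rowOf (T'.trans σ)
    funext k
    exact congrFun h' (σ.symm k)

theorem Tabloid.act_one {μ : YoungDiagram} {n : ℕ} (t : Tabloid μ n) : Tabloid.act 1 t = t := by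
  induction t using Quotient.inductionOn; rfl

theorem Tabloid.act_mul {μ : YoungDiagram} {n : ℕ} (σ τ : Sym n) (t : Tabloid μ n) :
    Tabloid.act (σ * τ) t = Tabloid.act σ (Tabloid.act τ t) := by
  induction t using Quotient.inductionOn; rfl

/-- The real permutation module `M^μ` on tabloids; `f` stands for `∑ t, f t • t`, so that
`(σ f) t = f (σ⁻¹ t)`. -/
def permRep (μ : YoungDiagram) (n : ℕ) : Representation ℝ (Sym n) (Tabloid μ n → ℝ) where
  toFun σ := LinearMap.funLeft ℝ ℝ (Tabloid.act σ⁻¹)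
  map_one' := by
    ext f t
    simp [LinearMap.funLeft_apply, Tabloid.act_one]
  map_mul' σ τ := by
    ext f t
    simp [LinearMap.funLeft_apply, Tabloid.act_mul]

open Classical in
/-- The polytabloid `v_T = ∑_{σ ∈ C(T)} sgn(σ) σ {T}`, where `C(T)` is the column stabilizer. -/
def polytabloid {μ : YoungDiagram} {n : ℕ} (T : Tableau μ n) : Tabloid μ n → ℝ :=
  ∑ σ : Sym n, if ∀ k, colOf T (σ k) = colOf T k then
    ((Equiv.Perm.sign σ : ℤ) : ℝ) • permRep μ n σ (Pi.single (toTabloid T) 1) else 0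

/-- The real Specht module `S^μ`, spanned by the polytabloids. It carries the topology induced
from the product topology of `M^μ`, i.e. the Euclidean topology. -/
def specht (μ : YoungDiagram) (n : ℕ) : Submodule ℝ (Tabloid μ n → ℝ) :=
  Submodule.span ℝ (Set.range (polytabloid : Tableau μ n → Tabloid μ n → ℝ))

theorem permRep_single {μ : YoungDiagram} {n : ℕ} (σ : Sym n) (T : Tableau μ n) :
    (open Classical in permRep μ n σ (Pi.single (toTabloid T) 1)) =
      (open Classical in Pi.single (toTabloid (T.trans σ)) 1) := by
  classical
  funext t
  have h : Tabloid.act σ⁻¹ t = toTabloid T ↔ t = toTabloid (T.trans σ) := by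
    constructor
    · intro h
      have := congrArg (Tabloid.act σ) h
      rw [← Tabloid.act_mul, mul_inv_cancel, Tabloid.act_one] at this
      exact this
    · rintro rfl
      change Tabloid.act σ⁻¹ (Tabloid.act σ (toTabloid T)) = _
      rw [← Tabloid.act_mul, inv_mul_cancel, Tabloid.act_one]
  change (Pi.single (toTabloid T) (1 : ℝ) : Tabloid μ n → ℝ) (Tabloid.act σ⁻¹ t) = _
  simp only [Pi.single_apply, h]

theorem permRep_polytabloid {μ : YoungDiagram} {n : ℕ} (τ : Sym n) (T : Tableau μ n) :
    permRep μ n τ (polytabloid T) = polytabloid (T.trans τ) := by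
  classical
  unfold polytabloid
  rw [map_sum]
  refine Fintype.sum_equiv (MulAut.conj τ).toEquiv _ _ fun σ => ?_
  have hc : (∀ k, colOf (T.trans τ) ((MulAut.conj τ).toEquiv σ k) = colOf (T.trans τ) k) ↔
      ∀ k, colOf T (σ k) = colOf T k := by
    constructor
    · intro h k
      have := h (τ k)
      simpa [colOf, Equiv.symm_trans_apply] using this
    · intro h k
      have := h (τ⁻¹ k)
      simpa [colOf, Equiv.symm_trans_apply] using this
  by_cases h : ∀ k, colOf T (σ k) = colOf T k
  · rw [if_pos h, if_pos (hc.2 h), map_smul, ← permRep_single, ← Module.End.mul_apply,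
      ← Module.End.mul_apply, ← map_mul, ← map_mul]
    have hs : Equiv.Perm.sign ((MulAut.conj τ).toEquiv σ) = Equiv.Perm.sign σ := by
      rcases Int.units_eq_one_or (Equiv.Perm.sign τ) with h | h <;> simp [h]
    rw [hs]
    simp
  · rw [if_neg h, if_neg (fun h' => h (hc.1 h')), map_zero]

theorem permRep_mem_specht {μ : YoungDiagram} {n : ℕ} (σ : Sym n) :
    ∀ f ∈ specht μ n, permRep μ n σ f ∈ specht μ n := by
  intro f hf
  have h : specht μ n ≤ (specht μ n).comap (permRep μ n σ) := by
    refine Submodule.span_le.2 ?_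
    rintro _ ⟨T, rfl⟩
    change permRep μ n σ (polytabloid T) ∈ specht μ n
    rw [permRep_polytabloid]
    exact Submodule.subset_span ⟨_, rfl⟩
  exact h hf

/-- The action of `σ ∈ S_n` on the Specht module. -/
def spechtAct (μ : YoungDiagram) {n : ℕ} (σ : Sym n) : specht μ n →ₗ[ℝ] specht μ n :=
  (permRep μ n σ).restrict (permRep_mem_specht σ)

/-- `B` is a Kazhdan–Lusztig left cell basis of `S^μ`: for some left cell, and some bijection of the
index set of `B` with that cell, every simple reflection has the same matrix in the basis `B` as in
the Kazhdan–Lusztig basis of the left cell representation at `v = 1`. -/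
def IsKLLeftCellBasis {μ : YoungDiagram} {n : ℕ} {ι : Type} [Fintype ι]
    (B : Module.Basis ι ℝ (specht μ n)) : Prop :=
  ∃ b : Sym n → Hecke n, IsKLBasis b ∧ ∃ (x : Sym n) (e : ι ≃ leftCell b x),
    ∀ s : Sym n, IsSimple s → ∃ M : Matrix (leftCell b x) (leftCell b x) ℝ, IsCellMatrix b x s M ∧
      ∀ j, spechtAct μ s (B j) = ∑ i, M (e i) (e j) • B i

/-! ### Invariant cones -/

/-- A closed convex cone in `S^μ` that is mapped into itself by `1 + s` for all simple
reflections `s`. -/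
def IsInvariantCone {μ : YoungDiagram} {n : ℕ} (C : PointedCone ℝ (specht μ n)) : Prop :=
  IsClosed (C : Set (specht μ n)) ∧
    ∀ s : Sym n, IsSimple s → ∀ u ∈ C, u + spechtAct μ s u ∈ C

/-- `C ∩ (-C) = {0}` and `C` has non-empty interior. -/
def IsProperCone {μ : YoungDiagram} {n : ℕ} (C : PointedCone ℝ (specht μ n)) : Prop :=
  (∀ u ∈ C, -u ∈ C → u = 0) ∧ (interior (C : Set (specht μ n))).Nonempty

/-- `C` is the unique maximal invariant cone, up to sign: it is a proper invariant cone, and every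
invariant cone other than the whole space is contained in `C` or in `-C`. -/
def IsMaximalInvariantCone {μ : YoungDiagram} {n : ℕ} (C : PointedCone ℝ (specht μ n)) : Prop :=
  IsInvariantCone C ∧ IsProperCone C ∧
    ∀ D : PointedCone ℝ (specht μ n), IsInvariantCone D → D ≠ ⊤ →
      D ≤ C ∨ ∀ u ∈ D, -u ∈ C

end KLCone

end

noncomputable section

namespace KLCone

/-! ### Length, descents and the Bruhat order of the symmetric group -/

section Length

variable {n : ℕ}

/-! The Specht module carries an invariant inner product, so each `E i = 1 + s_i` is self-adjoint. A
cone is therefore invariant exactly when its dual cone is preserved by the `E i`, and a maximal cone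
corresponds to a minimal dual cone. The cone spanned by a basis `B` is cut out by the inequalities
`⟨u, F_y⟩ ≥ 0` for the dual basis `F`. It remains to see that the `F_y` lie, up to one common sign,
in the dual of every invariant cone other than the whole space.

For two-column shapes the `E i` satisfy the Temperley–Lieb relations with loop parameter `2`: among
three entries of a tableau, two share a column, so the sum over any parabolic `S_3` acts by zero
(`spechtE_braid`). With `b` the length of the second column, the vectors fixed by `s_0, s_2, …,
s_{2b-2}` form a line (`IsCupped.eq_smul`). Every non-zero invariant set meets this line outside
`0`, because the product of the `E (2k)`, `k < b`, annihilates no non-zero submodule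
(`eq_bot_of_cupProj`). From a generator `f` of the line one builds a vector for each lattice path by
applying one `E k` for each box between the path and the lowest one. Each `E i` sends a path vector
to a non-negative multiple of a path vector, by a rule depending on the path alone
(`exists_apply_pathVec`).

The bridge to Kazhdan–Lusztig theory is that `F` consists exactly of the path vectors
(`IsCellAction.exists_pathVec`). The Temperley–Lieb relations forbid two adjacent non-descents in
the cell. Under this condition `E j`, applied to a dual basis vector with a non-descent adjacent to
`j`, gives another dual basis vector: a star operation, controlled by the symmetric coefficients of
`v` in the Kazhdan–Lusztig polynomials. Path vectors are built so that only such moves occur. Hence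
a dual cone containing `f` contains all of `F`, and one containing `-f` contains `-F`.

For existence, an explicit permutation `cellElt` is chosen. Right descents are inherited downwards
in the left preorder; this forces the Temperley–Lieb relations on the dual of its cell
representation (`isTL_cellE`). Matching path vectors gives an equivariant map from the Specht
module, which is injective by the criterion above and surjective because the cell is generated from
`cellElt`. Dualising the transported basis gives a left cell basis. -/

/-- The adjacent transposition `(i, i+1)`, or `1` if `i + 1` is out of range. -/
def adj (n i : ℕ) : Sym n :=
  if h : i + 1 < n then Equiv.swap ⟨i, Nat.lt_of_succ_lt h⟩ ⟨i + 1, h⟩ else 1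

theorem adj_eq {i : ℕ} (h : i + 1 < n) :
    adj n i = Equiv.swap ⟨i, Nat.lt_of_succ_lt h⟩ ⟨i + 1, h⟩ := dif_pos h

theorem isSimple_adj {i : ℕ} (h : i + 1 < n) : IsSimple (adj n i) := ⟨i, h, adj_eq h⟩

theorem isSimple_iff {s : Sym n} : IsSimple s ↔ ∃ i, i + 1 < n ∧ s = adj n i :=
  ⟨fun ⟨i, h, e⟩ => ⟨i, h, e.trans (adj_eq h).symm⟩, fun ⟨i, h, e⟩ => ⟨i, h, e.trans (adj_eq h)⟩⟩

theorem adj_mul_self (i : ℕ) : adj n i * adj n i = 1 := by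
  unfold adj; split_ifs <;> simp

theorem adj_mul_cancel (i : ℕ) (w : Sym n) : adj n i * (adj n i * w) = w := by
  rw [← mul_assoc, adj_mul_self, one_mul]

theorem adj_inv (i : ℕ) : (adj n i)⁻¹ = adj n i := inv_eq_of_mul_eq_one_left (adj_mul_self i)

theorem IsSimple.mul_self {s : Sym n} (hs : IsSimple s) : s * s = 1 := by
  obtain ⟨i, _, rfl⟩ := isSimple_iff.1 hs; exact adj_mul_self i

theorem IsSimple.mul_cancel {s : Sym n} (hs : IsSimple s) (w : Sym n) : s * (s * w) = w := by
  rw [← mul_assoc, hs.mul_self, one_mul]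

theorem adj_val {i : ℕ} (h : i + 1 < n) (k : Fin n) :
    (adj n i k).val = if k.val = i then i + 1 else if k.val = i + 1 then i else k.val := by
  rw [adj_eq h, Equiv.swap_apply_def]
  simp only [Fin.ext_iff]
  split_ifs <;> rfl

/-- An adjacent transposition reverses the order of one pair only. -/
theorem IsSimple.eq_swap_of_lt {s : Sym n} (hs : IsSimple s) {a b : Fin n} (hab : a < b)
    (h : s b < s a) : s = Equiv.swap a b := by
  obtain ⟨i, hi, rfl⟩ := isSimple_iff.1 hs
  rw [Fin.lt_def] at hab h
  rw [adj_val hi, adj_val hi] at h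
  have : a.val = i ∧ b.val = i + 1 := by split_ifs at h <;> omega
  rw [adj_eq hi]
  congr 1 <;> exact Fin.ext (by simp [this])

theorem IsExpr.len_le {w : Sym n} {l : List (Sym n)} (h : IsExpr w l) : len w ≤ l.length :=
  Nat.sInf_le ⟨l, h, rfl⟩

/-- The strong exchange condition. Reading the word from the right, the images of `a` and `b` must
cross at some letter. That letter is the transposition of the two images, and deleting it amounts to
multiplying by `swap a b` on the right. -/
theorem exists_shorter_expr {a b : Fin n} (hab : a < b) :
    ∀ {l : List (Sym n)} {w : Sym n}, IsExpr w l → w b < w a →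
      ∃ l', IsExpr (w * Equiv.swap a b) l' ∧ l'.length + 1 = l.length := by
  intro l
  induction l with
  | nil =>
    rintro w ⟨_, rfl⟩ hw
    exact absurd hw (not_lt_of_gt (by simpa using hab))
  | cons s l ih =>
    rintro w ⟨hl, rfl⟩ hw
    have hl' : ∀ s ∈ l, IsSimple s := fun t ht => hl t (List.mem_cons_of_mem _ ht)
    have hs : IsSimple s := hl s List.mem_cons_self
    rw [List.prod_cons] at hw ⊢
    rcases lt_trichotomy (l.prod a) (l.prod b) with h | h | h
    · refine ⟨l, ⟨hl', ?_⟩, rfl⟩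
      rw [mul_assoc, Equiv.mul_swap_eq_swap_mul, ← hs.eq_swap_of_lt h hw, hs.mul_cancel]
    · exact absurd (l.prod.injective h) hab.ne
    · obtain ⟨l', ⟨h1, h2⟩, h3⟩ := ih ⟨hl', rfl⟩ h
      refine ⟨s :: l', ⟨?_, by rw [List.prod_cons, h2, mul_assoc]⟩, by simp [h3]⟩
      intro t ht
      rcases List.mem_cons.1 ht with rfl | ht
      exacts [hs, h1 t ht]

theorem len_mul_swap_lt {a b : Fin n} (hab : a < b) {w : Sym n} (h : w b < w a) :
    len (w * Equiv.swap a b) < len w := by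
  obtain ⟨l, hl, hlen⟩ := exists_reduced w
  obtain ⟨l', hl', h'⟩ := exists_shorter_expr hab hl h
  have := hl'.len_le
  omega

theorem len_lt_mul_swap {a b : Fin n} (hab : a < b) {w : Sym n} (h : w a < w b) :
    len w < len (w * Equiv.swap a b) := by
  have := len_mul_swap_lt hab (w := w * Equiv.swap a b) (by simpa using h)
  simpa [mul_assoc] using this

theorem len_one : len (1 : Sym n) = 0 :=
  Nat.le_zero.1 (IsExpr.len_le (l := []) ⟨by simp, rfl⟩)

theorem len_mul_le {s : Sym n} (hs : IsSimple s) (w : Sym n) : len (s * w) ≤ len w + 1 := by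
  obtain ⟨l, hl, hlen⟩ := exists_reduced w
  have : IsExpr (s * w) (s :: l) :=
    ⟨fun t ht => (List.mem_cons.1 ht).elim (fun h => h ▸ hs) (hl.1 t), by simp [hl.2]⟩
  simpa [hlen] using this.len_le

theorem IsSimple.inv {s : Sym n} (hs : IsSimple s) : s⁻¹ = s := by
  obtain ⟨i, _, rfl⟩ := isSimple_iff.1 hs; exact adj_inv i

theorem IsExpr.inv {w : Sym n} {l : List (Sym n)} (h : IsExpr w l) : IsExpr w⁻¹ l.reverse := by
  refine ⟨fun s hs => h.1 s (List.mem_reverse.1 hs), ?_⟩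
  rw [← h.2, List.prod_inv_reverse]
  congr 2
  conv_lhs => rw [← List.map_id l]
  exact List.map_congr_left fun s hs => (h.1 s hs).inv.symm

theorem len_inv_le (w : Sym n) : len w⁻¹ ≤ len w := by
  obtain ⟨l, hl, hlen⟩ := exists_reduced w
  simpa [hlen] using hl.inv.len_le

theorem len_inv (w : Sym n) : len w⁻¹ = len w :=
  le_antisymm (len_inv_le w) (by simpa using len_inv_le w⁻¹)

/-! ### Positions of values and left descents -/

/-- The position of the value `k` in the one-line notation of `w`. -/
def pos (w : Sym n) (k : ℕ) : ℕ := if h : k < n then (w⁻¹ ⟨k, h⟩).val else k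

theorem pos_eq (w : Sym n) {k : ℕ} (h : k < n) : pos w k = (w⁻¹ ⟨k, h⟩).val := dif_pos h

theorem pos_lt (w : Sym n) {k : ℕ} (h : k < n) : pos w k < n := by
  rw [pos_eq w h]; exact Fin.isLt _

theorem pos_injOn (w : Sym n) {k l : ℕ} (hk : k < n) (hl : l < n) (h : pos w k = pos w l) :
    k = l := by
  rw [pos_eq w hk, pos_eq w hl] at h
  simpa using w⁻¹.injective (Fin.ext h)

theorem pos_adj_mul {i : ℕ} (hi : i + 1 < n) (w : Sym n) {k : ℕ} (hk : k < n) :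
    pos (adj n i * w) k = pos w (if k = i then i + 1 else if k = i + 1 then i else k) := by
  have : (if k = i then i + 1 else if k = i + 1 then i else k) < n := by split_ifs <;> omega
  rw [pos_eq _ hk, pos_eq _ this, mul_inv_rev, adj_inv, Equiv.Perm.mul_apply]
  congr 2
  exact Fin.ext (adj_val hi _)

theorem adj_mul_eq_mul_swap {i : ℕ} (hi : i + 1 < n) (w : Sym n) :
    adj n i * w =
      w * Equiv.swap (w⁻¹ ⟨i, Nat.lt_of_succ_lt hi⟩) (w⁻¹ ⟨i + 1, hi⟩) := by
  rw [Equiv.mul_swap_eq_swap_mul, adj_eq hi]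
  simp

theorem len_lt_adj_mul {i : ℕ} (hi : i + 1 < n) {w : Sym n} (h : pos w i < pos w (i + 1)) :
    len w < len (adj n i * w) := by
  rw [pos_eq w hi, pos_eq w (Nat.lt_of_succ_lt hi)] at h
  rw [adj_mul_eq_mul_swap hi]
  exact len_lt_mul_swap (Fin.lt_def.2 h) (by simp)

theorem adj_mul_len_lt {i : ℕ} (hi : i + 1 < n) {w : Sym n} (h : pos w (i + 1) < pos w i) :
    len (adj n i * w) < len w := by
  have := len_lt_adj_mul hi (w := adj n i * w) (by
    rw [pos_adj_mul hi _ hi, pos_adj_mul hi _ (Nat.lt_of_succ_lt hi)]; simpa using h)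
  rwa [adj_mul_cancel] at this

theorem pos_ne {i : ℕ} (hi : i + 1 < n) (w : Sym n) : pos w i ≠ pos w (i + 1) := fun h => by
  have := pos_injOn w (Nat.lt_of_succ_lt hi) hi h
  omega

theorem adj_mul_len_lt_iff {i : ℕ} (hi : i + 1 < n) {w : Sym n} :
    len (adj n i * w) < len w ↔ pos w (i + 1) < pos w i := by
  refine ⟨fun h => ?_, adj_mul_len_lt hi⟩
  by_contra h'
  have := len_lt_adj_mul hi (lt_of_le_of_ne (not_lt.1 h') (pos_ne hi w))
  omega

/-- `s` is a left descent of `w`. -/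
def Desc (s w : Sym n) : Prop := len (s * w) < len w

instance (s w : Sym n) : Decidable (Desc s w) := inferInstanceAs (Decidable (_ < _))

theorem desc_adj {i : ℕ} (hi : i + 1 < n) {w : Sym n} :
    Desc (adj n i) w ↔ pos w (i + 1) < pos w i := adj_mul_len_lt_iff hi

theorem len_of_desc {s w : Sym n} (hs : IsSimple s) (h : Desc s w) : len w = len (s * w) + 1 := by
  have := len_mul_le hs (s * w)
  rw [hs.mul_cancel] at this
  unfold Desc at h
  omega

theorem len_of_not_desc {s w : Sym n} (hs : IsSimple s) (h : ¬ Desc s w) :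
    len (s * w) = len w + 1 := by
  obtain ⟨i, hi, rfl⟩ := isSimple_iff.1 hs
  rw [desc_adj hi, not_lt] at h
  have h1 := len_lt_adj_mul hi (lt_of_le_of_ne h (pos_ne hi w))
  have := len_mul_le hs w
  omega

theorem desc_mul {s w : Sym n} (hs : IsSimple s) : Desc s (s * w) ↔ ¬ Desc s w := by
  constructor
  · intro h h'
    unfold Desc at h h'
    rw [hs.mul_cancel] at h
    omega
  · intro h
    have := len_of_not_desc hs h
    unfold Desc
    rw [hs.mul_cancel]
    omega

theorem neg_one_pow_len_mul {s : Sym n} (hs : IsSimple s) (w : Sym n) {R : Type*} [CommRing R] :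
    (-1 : R) ^ len (s * w) = -(-1) ^ len w := by
  by_cases h : Desc s w
  · rw [len_of_desc hs h, pow_succ]; ring
  · rw [len_of_not_desc hs h, pow_succ]; ring

theorem exists_desc {w : Sym n} (hw : w ≠ 1) : ∃ s, IsSimple s ∧ Desc s w := by
  obtain ⟨l, hl, hlen⟩ := exists_reduced w
  cases l with
  | nil => exact absurd hl.2.symm hw
  | cons s l =>
    have hs := hl.1 s List.mem_cons_self
    refine ⟨s, hs, ?_⟩
    have : IsExpr (s * w) l :=
      ⟨fun t ht => hl.1 t (List.mem_cons_of_mem _ ht), by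
        rw [← hl.2, List.prod_cons, hs.mul_cancel]⟩
    have := this.len_le
    simp only [List.length_cons] at hlen
    unfold Desc
    omega

theorem eq_one_of_len {w : Sym n} (h : len w = 0) : w = 1 := by
  by_contra hw
  obtain ⟨s, _, hd⟩ := exists_desc hw
  unfold Desc at hd
  omega

/-- Multiplication on the right by `t` leaves the left descents by `s` unchanged, unless `sw = wt`. -/
theorem desc_mul_right {s t w : Sym n} (hs : IsSimple s) (ht : IsSimple t) (h : s * w ≠ w * t) :
    Desc s (w * t) ↔ Desc s w := by
  obtain ⟨i, hi, rfl⟩ := isSimple_iff.1 hs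
  have hi' := Nat.lt_of_succ_lt hi
  set a := w⁻¹ ⟨i, hi'⟩ with ha
  set b := w⁻¹ ⟨i + 1, hi⟩ with hb
  have key : t ≠ Equiv.swap a b := by
    rintro rfl
    exact h (adj_mul_eq_mul_swap hi w)
  have hab : a ≠ b := fun h => by
    have := w⁻¹.injective h
    simp at this
  rw [desc_adj hi, desc_adj hi, pos_eq _ hi, pos_eq _ hi', pos_eq _ hi, pos_eq _ hi', mul_inv_rev,
    ht.inv, Equiv.Perm.mul_apply, Equiv.Perm.mul_apply, ← ha, ← hb, ← Fin.lt_def, ← Fin.lt_def]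
  rcases lt_or_gt_of_ne hab with hl | hl
  · refine ⟨fun h => absurd (ht.eq_swap_of_lt hl h) key, fun h => absurd h (not_lt_of_gt hl)⟩
  · refine ⟨fun _ => hl, fun _ => ?_⟩
    by_contra h'
    have h'' := lt_of_le_of_ne (not_lt.1 h') (fun e => hab (t.injective e))
    exact key ((ht.eq_swap_of_lt hl h'').trans (Equiv.swap_comm _ _))

/-! ### The Bruhat order -/

/-- A single step of the Bruhat order. -/
def BruhatStep (x y : Sym n) : Prop :=
  len x ≤ len y ∧ ∃ s w : Sym n, IsSimple s ∧ x * (w⁻¹ * s * w) = y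

theorem isSimple_conj_iff {t : Sym n} :
    (∃ s w : Sym n, IsSimple s ∧ t = w⁻¹ * s * w) ↔ ∃ a b : Fin n, a < b ∧ t = Equiv.swap a b := by
  constructor
  · rintro ⟨s, w, hs, rfl⟩
    obtain ⟨i, hi, rfl⟩ := isSimple_iff.1 hs
    have h := adj_mul_eq_mul_swap hi w
    rw [mul_assoc, h, inv_mul_cancel_left]
    have hne : w⁻¹ ⟨i, Nat.lt_of_succ_lt hi⟩ ≠ w⁻¹ ⟨i + 1, hi⟩ := fun h => by
      have := w⁻¹.injective h
      simp at this
    rcases lt_or_gt_of_ne hne with hl | hl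
    exacts [⟨_, _, hl, rfl⟩, ⟨_, _, hl, Equiv.swap_comm _ _⟩]
  · rintro ⟨a, b, hab, rfl⟩
    have h0 : 0 + 1 < n := by have := b.2; have := Fin.lt_def.1 hab; omega
    have hs := isSimple_adj h0
    obtain ⟨c, hc⟩ := (isConj_iff.1 (Equiv.Perm.isConj_swap (α := Fin n) hab.ne
      (show (⟨0, Nat.lt_of_succ_lt h0⟩ : Fin n) ≠ ⟨0 + 1, h0⟩ by simp)))
    refine ⟨_, c, hs, ?_⟩
    rw [adj_eq h0, ← hc]
    group

theorem bruhatStep_iff {x y : Sym n} :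
    BruhatStep x y ↔ ∃ a b : Fin n, a < b ∧ x a < x b ∧ y = x * Equiv.swap a b := by
  constructor
  · rintro ⟨hl, s, w, hs, rfl⟩
    obtain ⟨a, b, hab, e⟩ := isSimple_conj_iff.1 ⟨s, w, hs, rfl⟩
    rw [e] at hl ⊢
    refine ⟨a, b, hab, ?_, rfl⟩
    rcases lt_trichotomy (x a) (x b) with h | h | h
    · exact h
    · exact absurd (x.injective h) hab.ne
    · have := len_mul_swap_lt hab h
      omega
  · rintro ⟨a, b, hab, h, rfl⟩
    obtain ⟨s, w, hs, e⟩ := isSimple_conj_iff.2 ⟨a, b, hab, rfl⟩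
    exact ⟨(len_lt_mul_swap hab h).le, s, w, hs, by rw [← e]⟩

/-- Left multiplication by `s` preserves an upward step unless `s` reverses the two values being
exchanged, and then the step is multiplication by `s` itself. -/
theorem BruhatStep.mul_left {x y s : Sym n} (hs : IsSimple s) (h : BruhatStep x y) :
    s * x = y ∨ BruhatStep (s * x) (s * y) := by
  obtain ⟨a, b, hab, hx, rfl⟩ := bruhatStep_iff.1 h
  by_cases h' : s (x b) < s (x a)
  · left
    rw [Equiv.mul_swap_eq_swap_mul, ← hs.eq_swap_of_lt hx h']
  · right
    refine bruhatStep_iff.2 ⟨a, b, hab, ?_, by rw [mul_assoc]⟩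
    exact lt_of_le_of_ne (not_lt.1 h') fun e => hab.ne (x.injective (s.injective e))

/-- A form of the lifting property; it bounds the support of `b_s b_w` in the construction of the
Kazhdan–Lusztig basis. -/
theorem Bruhat.mul_left {x y s : Sym n} (hs : IsSimple s) (h : Bruhat y x) :
    Bruhat (s * y) x ∨ Bruhat (s * y) (s * x) := by
  induction h with
  | refl => exact Or.inr .refl
  | tail _ hst ih =>
    rcases ih with ih | ih
    · exact Or.inl (ih.tail hst)
    · rcases BruhatStep.mul_left hs hst with e | h'
      · exact Or.inl (e ▸ ih)
      · exact Or.inr (ih.tail h')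

theorem bruhat_of_not_desc {s x : Sym n} (hs : IsSimple s) (h : ¬ Desc s x) : Bruhat x (s * x) := by
  refine .single ⟨by have := len_of_not_desc hs h; omega, s, x, hs, by group⟩

theorem Bruhat.len_lt {x y : Sym n} (h : Bruhat y x) (hne : y ≠ x) : len y < len x := by
  have key : y = x ∨ len y < len x := by
    clear hne
    induction h with
    | refl => exact Or.inl rfl
    | tail _ hst ih =>
      obtain ⟨a, b, hab, hx, rfl⟩ := bruhatStep_iff.1 hst
      have := len_lt_mul_swap hab hx
      rcases ih with rfl | ih
      · exact Or.inr this
      · exact Or.inr (ih.trans this)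
  exact key.resolve_left hne

end Length

/-! ### Laurent polynomials without terms of degree at most zero -/

section VPos

open LaurentPolynomial

/-- `p ∈ v ℤ[v]`. -/
def VPos (p : ℤ[T;T⁻¹]) : Prop := ∀ k ≤ 0, p.coeff k = 0

theorem coeff_T_mul (m k : ℤ) (p : ℤ[T;T⁻¹]) : (T m * p).coeff k = p.coeff (k - m) := by
  rw [T, AddMonoidAlgebra.coeff_single_mul_apply, one_mul]
  congr 1
  ring

theorem vPos_iff {p : ℤ[T;T⁻¹]} : VPos p ↔ ∃ q : ℤ[X], p = T 1 * Polynomial.toLaurent q := by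
  constructor
  · intro hp
    refine ⟨∑ k ∈ p.coeff.support, Polynomial.monomial (k - 1).toNat (p.coeff k), ?_⟩
    rw [map_sum, Finset.mul_sum]
    conv_lhs => rw [← AddMonoidAlgebra.sum_coeff_single p]
    refine Finset.sum_congr rfl fun k hk => ?_
    have hk0 : 0 < k := by
      by_contra h
      exact Finsupp.mem_support_iff.1 hk (hp k (not_lt.1 h))
    rw [← Polynomial.C_mul_X_pow_eq_monomial, Polynomial.toLaurent_C_mul_X_pow, single_eq_C_mul_T,
      mul_left_comm, ← T_add]
    congr 2
    rw [Int.toNat_of_nonneg (by omega)]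
    ring
  · rintro ⟨q, rfl⟩ k hk
    rw [coeff_T_mul]
    by_contra h
    have h1 := Finsupp.mem_support_iff.2 h
    rw [support_coeff_toLaurent, Finset.mem_map] at h1
    obtain ⟨m, _, hm⟩ := h1
    have : (m : ℤ) = k - 1 := hm
    omega

theorem VPos.add {p q : ℤ[T;T⁻¹]} (hp : VPos p) (hq : VPos q) : VPos (p + q) := fun k hk => by
  rw [AddMonoidAlgebra.coeff_add, Finsupp.add_apply, hp k hk, hq k hk, add_zero]

theorem VPos.sub {p q : ℤ[T;T⁻¹]} (hp : VPos p) (hq : VPos q) : VPos (p - q) := fun k hk => by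
  rw [AddMonoidAlgebra.coeff_sub, Finsupp.sub_apply, hp k hk, hq k hk, sub_zero]

theorem VPos.zero : VPos 0 := fun _ _ => rfl

theorem VPos.T_one_mul {p : ℤ[T;T⁻¹]} (hp : VPos p) : VPos (T 1 * p) := fun k hk => by
  rw [coeff_T_mul]; exact hp _ (by omega)

theorem vPos_T_one : VPos (T 1) := fun k hk => by
  rw [T_apply, if_neg (by omega)]

theorem VPos.sum {ι : Type*} {s : Finset ι} {p : ι → ℤ[T;T⁻¹]} (h : ∀ i ∈ s, VPos (p i)) :
    VPos (∑ i ∈ s, p i) := fun k hk => by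
  rw [AddMonoidAlgebra.coeff_sum, Finsupp.finsetSum_apply]
  exact Finset.sum_eq_zero fun i hi => h i hi k hk

theorem VPos.C_mul {p : ℤ[T;T⁻¹]} (hp : VPos p) (a : ℤ) : VPos (C a * p) := fun k hk => by
  rw [← smul_eq_C_mul, AddMonoidAlgebra.coeff_smul, Finsupp.smul_apply, hp k hk, smul_zero]

/-- Dividing by `v` leaves `v ℤ[v]` only through the coefficient of `v`. This is how these
coefficients become the structure constants of multiplication by `b_s`. -/
theorem VPos.T_neg_one_mul_sub {p : ℤ[T;T⁻¹]} (hp : VPos p) :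
    VPos (T (-1) * p - C (p.coeff 1)) := fun k hk => by
  rw [AddMonoidAlgebra.coeff_sub, Finsupp.sub_apply, coeff_T_mul, C_apply]
  rcases hk.lt_or_eq with h | rfl
  · rw [if_neg h.ne, hp _ (by omega), sub_zero]
  · simp

theorem VPos.eq_zero_of_invert {p : ℤ[T;T⁻¹]} (hp : VPos p) (h : invert p = p) : p = 0 := by
  ext k
  rcases le_or_gt k 0 with hk | hk
  · exact hp k hk
  · rw [← h, invert_apply]
    exact hp _ (by omega)

end VPos

/-! ### The regular representation of the Hecke algebra and the bar involution -/

section Hecke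

open LaurentPolynomial

variable {n : ℕ}

/-- `v⁻¹ - v`. -/
def qq : ℤ[T;T⁻¹] := T (-1) - T 1

theorem mulStd_apply (s : Sym n) (f : Hecke n) (y : Sym n) :
    mulStd s f y = f (s * y) + if Desc s y then qq * f y else 0 := rfl

theorem mulStdInv_eq (s : Sym n) (f : Hecke n) : mulStdInv s f = mulStd s f - qq • f := by
  rw [mulStdInv, qq, sub_eq_add_neg (mulStd s f), ← neg_smul, neg_sub]

theorem mulStd_add (s : Sym n) (f g : Hecke n) : mulStd s (f + g) = mulStd s f + mulStd s g := by
  funext y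
  simp only [mulStd_apply, Pi.add_apply]
  split_ifs <;> ring

theorem mulStd_smul (s : Sym n) (c : ℤ[T;T⁻¹]) (f : Hecke n) :
    mulStd s (c • f) = c • mulStd s f := by
  funext y
  simp only [mulStd_apply, Pi.smul_apply, smul_eq_mul]
  split_ifs <;> ring

/-- Left multiplication by `δ_s` as a linear map. -/
def mulStdL (s : Sym n) : Hecke n →ₗ[ℤ[T;T⁻¹]] Hecke n where
  toFun := mulStd s
  map_add' := mulStd_add s
  map_smul' := mulStd_smul s

theorem mulStd_sum (s : Sym n) {ι : Type*} (t : Finset ι) (f : ι → Hecke n) :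
    mulStd s (∑ i ∈ t, f i) = ∑ i ∈ t, mulStd s (f i) := map_sum (mulStdL s) _ _

theorem mulStd_sub (s : Sym n) (f g : Hecke n) : mulStd s (f - g) = mulStd s f - mulStd s g :=
  map_sub (mulStdL s) _ _

theorem mulStd_mulStd {s : Sym n} (hs : IsSimple s) (f : Hecke n) :
    mulStd s (mulStd s f) = qq • mulStd s f + f := by
  funext y
  simp only [mulStd_apply, Pi.add_apply, Pi.smul_apply, smul_eq_mul, hs.mul_cancel, desc_mul hs]
  split_ifs <;> ring

theorem mulStdInv_mulStd {s : Sym n} (hs : IsSimple s) (f : Hecke n) :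
    mulStdInv s (mulStd s f) = f := by
  rw [mulStdInv_eq, mulStd_mulStd hs]; abel

theorem mulStd_mulStdInv {s : Sym n} (hs : IsSimple s) (f : Hecke n) :
    mulStd s (mulStdInv s f) = f := by
  rw [mulStdInv_eq, mulStd_sub, mulStd_mulStd hs, mulStd_smul]; abel

theorem mulStdInv_add (s : Sym n) (f g : Hecke n) :
    mulStdInv s (f + g) = mulStdInv s f + mulStdInv s g := by
  simp only [mulStdInv_eq, mulStd_add, smul_add]; abel

theorem mulStdInv_smul (s : Sym n) (c : ℤ[T;T⁻¹]) (f : Hecke n) :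
    mulStdInv s (c • f) = c • mulStdInv s f := by
  simp only [mulStdInv_eq, mulStd_smul, smul_sub, smul_comm qq c]

/-- Left multiplication by `δ_s⁻¹` as a linear map. -/
def mulStdInvL (s : Sym n) : Hecke n →ₗ[ℤ[T;T⁻¹]] Hecke n where
  toFun := mulStdInv s
  map_add' := mulStdInv_add s
  map_smul' := mulStdInv_smul s

theorem mulStdInv_sum (s : Sym n) {ι : Type*} (t : Finset ι) (f : ι → Hecke n) :
    mulStdInv s (∑ i ∈ t, f i) = ∑ i ∈ t, mulStdInv s (f i) := map_sum (mulStdInvL s) _ _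

/-! ### Right multiplication and well-definedness of the bar involution -/

/-- The anti-involution `δ_x ↦ δ_{x⁻¹}`. -/
def flip (f : Hecke n) : Hecke n := fun y => f y⁻¹

theorem flip_apply (f : Hecke n) (y : Sym n) : flip f y = f y⁻¹ := rfl

theorem flip_flip (f : Hecke n) : flip (flip f) = f := by
  funext y; simp [flip]

theorem flip_sub (f g : Hecke n) : flip (f - g) = flip f - flip g := rfl

theorem flip_smul (c : ℤ[T;T⁻¹]) (f : Hecke n) : flip (c • f) = c • flip f := rfl

/-- Right multiplication by `δ_s`. -/
def mulStdR (s : Sym n) (f : Hecke n) : Hecke n := flip (mulStd s (flip f))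

theorem mulStdR_apply {s : Sym n} (hs : IsSimple s) (f : Hecke n) (y : Sym n) :
    mulStdR s f y = f (y * s) + if Desc s y⁻¹ then qq * f y else 0 := by
  simp only [mulStdR, flip_apply, mulStd_apply, mul_inv_rev, inv_inv, hs.inv]

/-- This plays the role of associativity, since the Hecke algebra is only present as a module with
operators. Left and right descents do not interact except when `s y = y t`, where both
multiplications change the same pair of coefficients. -/
theorem mulStd_mulStdR {s t : Sym n} (hs : IsSimple s) (ht : IsSimple t) (f : Hecke n) :
    mulStd s (mulStdR t f) = mulStdR t (mulStd s f) := by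
  funext y
  rw [mulStd_apply, mulStdR_apply ht, mulStdR_apply ht, mulStdR_apply ht, mulStd_apply,
    mulStd_apply, mul_assoc]
  by_cases h : s * y = y * t
  · have h1 : Desc t (y * t)⁻¹ ↔ ¬ Desc t y⁻¹ := by rw [mul_inv_rev, ht.inv, desc_mul ht]
    have h2 : Desc s (y * t) ↔ ¬ Desc s y := by rw [← h, desc_mul hs]
    have h3 : Desc t y⁻¹ ↔ Desc s y := by
      unfold Desc
      rw [h, ← len_inv (t * y⁻¹), mul_inv_rev, inv_inv, ht.inv, len_inv]
    simp only [h, h1, h2, h3]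
  · have h1 : Desc s (y * t) ↔ Desc s y := desc_mul_right hs ht h
    have h2 : Desc t (s * y)⁻¹ ↔ Desc t y⁻¹ := by
      rw [mul_inv_rev, hs.inv]
      refine desc_mul_right ht hs fun e => h ?_
      have := congrArg (·⁻¹) e
      simpa [mul_inv_rev, hs.inv, ht.inv] using this.symm
    simp only [h1, h2]
    split_ifs <;> ring

theorem mulStd_stdElt {s : Sym n} (hs : IsSimple s) (x : Sym n) :
    mulStd s (stdElt x) = stdElt (s * x) + if Desc s x then qq • stdElt x else 0 := by
  funext y
  have h : s * y = x ↔ y = s * x :=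
    ⟨fun h => by rw [← h, hs.mul_cancel], fun h => by rw [h, hs.mul_cancel]⟩
  rw [mulStd_apply]
  simp only [stdElt, Pi.single_apply, Pi.add_apply, h]
  congr 1
  by_cases hyx : y = x
  · subst hyx
    by_cases hd : Desc s y <;> simp [hd]
  · by_cases hd : Desc s x <;> simp [hd, hyx]

theorem flip_stdElt (x : Sym n) : flip (stdElt x) = stdElt x⁻¹ := by
  funext y
  simp [flip, stdElt, Pi.single_apply, inv_eq_iff_eq_inv]

theorem mulStdR_stdElt {s : Sym n} (hs : IsSimple s) {x : Sym n} (h : ¬ Desc s x⁻¹) :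
    mulStdR s (stdElt x) = stdElt (x * s) := by
  rw [mulStdR, flip_stdElt, mulStd_stdElt hs, if_neg h, add_zero, flip_stdElt, mul_inv_rev, inv_inv,
    hs.inv]

theorem eq_sum_stdElt (f : Hecke n) : f = ∑ x, f x • stdElt x := by
  funext y
  simp [stdElt, Finset.sum_apply, Pi.single_apply]

/-- An endomorphism of the right regular module is determined by its value at `1`. -/
theorem eq_of_commute_mulStdR {A A' : Hecke n →ₗ[ℤ[T;T⁻¹]] Hecke n}
    (hA : ∀ s, IsSimple s → ∀ f, A (mulStdR s f) = mulStdR s (A f))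
    (hA' : ∀ s, IsSimple s → ∀ f, A' (mulStdR s f) = mulStdR s (A' f))
    (h1 : A (stdElt 1) = A' (stdElt 1)) : A = A' := by
  have key : ∀ k, ∀ x : Sym n, len x⁻¹ = k → A (stdElt x) = A' (stdElt x) := by
    intro k
    induction k with
    | zero =>
      intro x hx
      rw [show x = 1 by simpa using eq_one_of_len hx, h1]
    | succ k ih =>
      intro x hx
      have hx1 : x⁻¹ ≠ 1 := fun e => by rw [e, len_one] at hx; omega
      obtain ⟨s, hs, hd⟩ := exists_desc hx1
      have e : (x * s)⁻¹ = s * x⁻¹ := by rw [mul_inv_rev, hs.inv]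
      have hl := len_of_desc hs hd
      have hxs : stdElt x = mulStdR s (stdElt (x * s)) := by
        rw [mulStdR_stdElt hs, mul_assoc, hs.mul_self, mul_one]
        rw [e, desc_mul hs]
        exact not_not.2 hd
      rw [hxs, hA s hs, hA' s hs, ih (x * s) (by rw [e]; omega)]
  refine LinearMap.ext fun f => ?_
  rw [eq_sum_stdElt f, map_sum, map_sum]
  exact Finset.sum_congr rfl fun x _ => by rw [map_smul, map_smul, key _ x rfl]

/-- `δ_{s₁} ⋯ δ_{s_k}` for a word `s₁ ⋯ s_k`, as a linear map. -/
def wordL (l : List (Sym n)) : Hecke n →ₗ[ℤ[T;T⁻¹]] Hecke n := (l.map mulStdL).prod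

theorem wordL_apply (l : List (Sym n)) (f : Hecke n) : wordL l f = l.foldr mulStd f := by
  induction l with
  | nil => rfl
  | cons s l ih =>
    rw [List.foldr_cons, ← ih]
    rfl

theorem foldr_mulStd_mulStdR {l : List (Sym n)} (hl : ∀ s ∈ l, IsSimple s) {t : Sym n}
    (ht : IsSimple t) (f : Hecke n) :
    l.foldr mulStd (mulStdR t f) = mulStdR t (l.foldr mulStd f) := by
  induction l with
  | nil => rfl
  | cons s l ih =>
    rw [List.foldr_cons, List.foldr_cons, ih fun t ht => hl t (List.mem_cons_of_mem _ ht),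
      mulStd_mulStdR (hl s List.mem_cons_self) ht]

theorem foldr_mulStd_stdElt {l : List (Sym n)} {w : Sym n} (hl : IsExpr w l)
    (hlen : l.length = len w) : l.foldr mulStd (stdElt 1) = stdElt w := by
  induction l generalizing w with
  | nil => rw [← hl.2]; rfl
  | cons s l ih =>
    have hs := hl.1 s List.mem_cons_self
    have hl' : IsExpr l.prod l := ⟨fun t ht => hl.1 t (List.mem_cons_of_mem _ ht), rfl⟩
    have hw : w = s * l.prod := by rw [← hl.2, List.prod_cons]
    have h1 := hl'.len_le
    have h2 := len_mul_le hs l.prod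
    rw [← hw] at h2
    simp only [List.length_cons] at hlen
    rw [List.foldr_cons, ih hl' (by omega), mulStd_stdElt hs, if_neg, add_zero, hw]
    intro hd
    unfold Desc at hd
    rw [← hw] at hd
    omega

theorem foldr_mulStdInv_foldr {l : List (Sym n)} (hl : ∀ s ∈ l, IsSimple s) (f : Hecke n) :
    l.foldr mulStdInv (l.reverse.foldr mulStd f) = f := by
  induction l generalizing f with
  | nil => rfl
  | cons s l ih =>
    rw [List.reverse_cons, List.foldr_append, List.foldr_cons, List.foldr_cons, List.foldr_nil,
      ih fun t ht => hl t (List.mem_cons_of_mem _ ht), mulStdInv_mulStd (hl s List.mem_cons_self)]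

theorem foldr_foldr_mulStdInv {l : List (Sym n)} (hl : ∀ s ∈ l, IsSimple s) (f : Hecke n) :
    l.reverse.foldr mulStd (l.foldr mulStdInv f) = f := by
  induction l generalizing f with
  | nil => rfl
  | cons s l ih =>
    rw [List.reverse_cons, List.foldr_append, List.foldr_cons, List.foldr_cons, List.foldr_nil,
      mulStd_mulStdInv (hl s List.mem_cons_self), ih fun t ht => hl t (List.mem_cons_of_mem _ ht)]

/-- Independence of the reduced word. Two reversed reduced words give operators that commute with
right multiplication and both send `δ_1` to `δ_{x⁻¹}`, so the operators agree, and hence so do their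
inverses. -/
theorem barStd_eq {l : List (Sym n)} {x : Sym n} (hl : IsExpr x l) (hlen : l.length = len x) :
    barStd x = l.foldr mulStdInv (stdElt 1) := by
  obtain ⟨hm, hmlen⟩ := (exists_reduced x).choose_spec
  set m := (exists_reduced x).choose
  change m.foldr mulStdInv (stdElt 1) = _
  have key : wordL m.reverse = wordL l.reverse := by
    refine eq_of_commute_mulStdR (fun s hs f => ?_) (fun s hs f => ?_) ?_
    · simp only [wordL_apply]; exact foldr_mulStd_mulStdR hm.inv.1 hs f
    · simp only [wordL_apply]; exact foldr_mulStd_mulStdR hl.inv.1 hs f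
    · simp only [wordL_apply]
      rw [foldr_mulStd_stdElt hm.inv (by rw [List.length_reverse, len_inv, hmlen]),
        foldr_mulStd_stdElt hl.inv (by rw [List.length_reverse, len_inv, hlen])]
  have h := foldr_mulStdInv_foldr hm.1 (l.foldr mulStdInv (stdElt 1))
  rw [← wordL_apply, key, wordL_apply, foldr_foldr_mulStdInv hl.1] at h
  exact h

theorem barStd_one : barStd (1 : Sym n) = stdElt 1 :=
  barStd_eq (l := []) ⟨by simp, rfl⟩ len_one.symm

theorem barStd_mul {s x : Sym n} (hs : IsSimple s) (h : ¬ Desc s x) :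
    barStd (s * x) = mulStdInv s (barStd x) := by
  obtain ⟨l, hl, hlen⟩ := exists_reduced x
  rw [barStd_eq hl hlen, barStd_eq (l := s :: l) _ _]
  · rfl
  · exact ⟨fun t ht => (List.mem_cons.1 ht).elim (fun h => h ▸ hs) (hl.1 t), by simp [hl.2]⟩
  · rw [List.length_cons, hlen, len_of_not_desc hs h]

theorem bar_stdElt (x : Sym n) : bar (stdElt x) = barStd x := by
  rw [bar, Finset.sum_eq_single x]
  · simp [stdElt]
  · intro y _ hy
    simp [stdElt, hy]
  · simp

theorem bar_add (f g : Hecke n) : bar (f + g) = bar f + bar g := by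
  simp only [bar, Pi.add_apply, map_add, add_smul, Finset.sum_add_distrib]

theorem bar_smul (c : ℤ[T;T⁻¹]) (f : Hecke n) : bar (c • f) = invert c • bar f := by
  simp only [bar, Pi.smul_apply, smul_eq_mul, map_mul, mul_smul, Finset.smul_sum]

theorem bar_zero : bar (0 : Hecke n) = 0 := by simp [bar]

theorem bar_sum {ι : Type*} (t : Finset ι) (f : ι → Hecke n) :
    bar (∑ i ∈ t, f i) = ∑ i ∈ t, bar (f i) :=
  map_sum (⟨⟨bar, bar_zero⟩, bar_add⟩ : Hecke n →+ Hecke n) _ _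

theorem bar_sub (f g : Hecke n) : bar (f - g) = bar f - bar g :=
  map_sub (⟨⟨bar, bar_zero⟩, bar_add⟩ : Hecke n →+ Hecke n) _ _

theorem invert_qq : invert qq = -qq := by simp [qq]

theorem bar_mulStd {s : Sym n} (hs : IsSimple s) (f : Hecke n) :
    bar (mulStd s f) = mulStdInv s (bar f) := by
  have key : ∀ x : Sym n, bar (mulStd s (stdElt x)) = mulStdInv s (barStd x) := by
    intro x
    rw [mulStd_stdElt hs, bar_add, bar_stdElt]
    by_cases h : Desc s x
    · have h1 := barStd_mul (x := s * x) hs (by rw [desc_mul hs]; exact not_not.2 h)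
      rw [hs.mul_cancel] at h1
      rw [if_pos h, bar_smul, invert_qq, bar_stdElt, mulStdInv_eq]
      have h2 : mulStd s (barStd x) = barStd (s * x) := by rw [h1, mulStd_mulStdInv hs]
      rw [h2, neg_smul, sub_eq_add_neg]
    · rw [if_neg h, bar_zero, add_zero, barStd_mul hs h]
  conv_lhs => rw [eq_sum_stdElt f]
  rw [mulStd_sum, bar_sum, bar, mulStdInv_sum]
  exact Finset.sum_congr rfl fun x _ => by rw [mulStd_smul, bar_smul, key, mulStdInv_smul]

/-- Left multiplication by `b_s = δ_s + v`. -/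
def mulB (s : Sym n) (f : Hecke n) : Hecke n := mulStd s f + (T 1 : ℤ[T;T⁻¹]) • f

theorem bar_mulB {s : Sym n} (hs : IsSimple s) {f : Hecke n} (hf : bar f = f) :
    bar (mulB s f) = mulB s f := by
  rw [mulB, bar_add, bar_mulStd hs, bar_smul, hf, mulStdInv_eq, qq, invert_T, sub_smul]
  abel

theorem mulB_apply (s : Sym n) (f : Hecke n) (y : Sym n) :
    mulB s f y = f (s * y) + if Desc s y then T (-1) * f y else T 1 * f y := by
  rw [mulB, Pi.add_apply, mulStd_apply, Pi.smul_apply, smul_eq_mul, qq]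
  split_ifs <;> ring

theorem mulB_sub (s : Sym n) (f g : Hecke n) : mulB s (f - g) = mulB s f - mulB s g := by
  rw [mulB, mulB, mulB, mulStd_sub, smul_sub]; abel

theorem mulB_smul (s : Sym n) (c : ℤ[T;T⁻¹]) (f : Hecke n) : mulB s (c • f) = c • mulB s f := by
  rw [mulB, mulB, mulStd_smul, smul_add, smul_comm]

theorem mulB_sum (s : Sym n) {ι : Type*} (t : Finset ι) (f : ι → Hecke n) :
    mulB s (∑ i ∈ t, f i) = ∑ i ∈ t, mulB s (f i) := by
  simp only [mulB, mulStd_sum, Finset.smul_sum, Finset.sum_add_distrib]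

theorem mulB_mulB {s : Sym n} (hs : IsSimple s) (f : Hecke n) :
    mulB s (mulB s f) = (T 1 + T (-1) : ℤ[T;T⁻¹]) • mulB s f := by
  rw [mulB, mulB, mulStd_add, mulStd_mulStd hs, mulStd_smul, qq]
  have : (T 1 * T (-1) : ℤ[T;T⁻¹]) = 1 := by rw [← T_add]; rfl
  simp only [smul_add, add_smul, sub_smul, smul_smul, add_mul, mul_comm (T (-1)) (T 1), this,
    one_smul]
  abel

/-- Triangularity with respect to length rather than the Bruhat order; this already suffices for the
uniqueness argument in `eq_zero_of_bar`. -/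
theorem barStd_triangular : ∀ (k : ℕ) (x : Sym n), len x = k →
    barStd x x = 1 ∧ ∀ y, y ≠ x → len x ≤ len y → barStd x y = 0 := by
  intro k
  induction k with
  | zero =>
    intro x hx
    rw [eq_one_of_len hx, barStd_one]
    exact ⟨by simp [stdElt], fun y hy _ => by simp [stdElt, hy]⟩
  | succ k ih =>
    intro x hx
    have hx1 : x ≠ 1 := fun e => by rw [e, len_one] at hx; omega
    obtain ⟨s, hs, hd⟩ := exists_desc hx1
    have hl := len_of_desc hs hd
    obtain ⟨ih1, ih2⟩ := ih (s * x) (by omega)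
    have h1 := barStd_mul (x := s * x) hs (by rw [desc_mul hs]; exact not_not.2 hd)
    rw [hs.mul_cancel] at h1
    have hval : ∀ y, y ≠ s * x → len x ≤ len y → barStd x y = barStd (s * x) (s * y) := by
      intro y hy hyl
      rw [h1, mulStdInv_eq, Pi.sub_apply, mulStd_apply, Pi.smul_apply, ih2 y hy (by omega)]
      simp
    refine ⟨?_, fun y hy hyl => ?_⟩
    · rw [hval x (fun e => by rw [← e] at hl; omega) le_rfl, ih1]
    · rw [hval y (fun e => by rw [e] at hyl; omega) hyl]
      refine ih2 _ (fun e => hy (mul_left_cancel e)) ?_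
      by_cases hdy : Desc s y
      · have := len_of_desc hs hdy; omega
      · have := len_of_not_desc hs hdy; omega

/-- A bar invariant element with all coefficients in `v ℤ[v]` vanishes. -/
theorem eq_zero_of_bar {f : Hecke n} (hbar : bar f = f) (hf : ∀ y, VPos (f y)) : f = 0 := by
  by_contra hne
  obtain ⟨y0, hy0⟩ := Function.ne_iff.1 hne
  -- At an element of maximal length in the support, triangularity makes the coefficient itself
  -- symmetric under `v ↦ v⁻¹`.
  obtain ⟨y, hy, hmax⟩ := Finset.exists_max_image (Finset.univ.filter fun y => f y ≠ 0) len
    ⟨y0, by simpa using hy0⟩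
  rw [Finset.mem_filter] at hy
  refine hy.2 ((hf y).eq_zero_of_invert ?_)
  have h := congrFun hbar y
  rw [bar, Finset.sum_apply, Finset.sum_eq_single y] at h
  · rwa [Pi.smul_apply, (barStd_triangular _ y rfl).1, smul_eq_mul, mul_one] at h
  · intro x _ hx
    by_cases hfx : f x = 0
    · simp [hfx]
    · rw [Pi.smul_apply, (barStd_triangular _ x rfl).2 y hx.symm
        (hmax x (by simpa using hfx)), smul_zero]
  · simp

/-- Right multiplication by `δ_s⁻¹`. -/
def mulStdInvR (s : Sym n) (f : Hecke n) : Hecke n := flip (mulStdInv s (flip f))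

theorem mulStdInvR_eq (s : Sym n) (f : Hecke n) : mulStdInvR s f = mulStdR s f - qq • f := by
  rw [mulStdInvR, mulStdInv_eq, flip_sub, flip_smul, flip_flip, mulStdR]

theorem mulStdR_smul (s : Sym n) (c : ℤ[T;T⁻¹]) (f : Hecke n) :
    mulStdR s (c • f) = c • mulStdR s f := by
  rw [mulStdR, flip_smul, mulStd_smul, flip_smul, mulStdR]

theorem mulStdR_sub (s : Sym n) (f g : Hecke n) : mulStdR s (f - g) = mulStdR s f - mulStdR s g := by
  rw [mulStdR, flip_sub, mulStd_sub, flip_sub, mulStdR, mulStdR]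

theorem mulStdInv_mulStdInvR {s t : Sym n} (hs : IsSimple s) (ht : IsSimple t) (f : Hecke n) :
    mulStdInv s (mulStdInvR t f) = mulStdInvR t (mulStdInv s f) := by
  simp only [mulStdInv_eq, mulStdInvR_eq, mulStd_sub, mulStdR_sub, mulStd_smul, mulStdR_smul,
    mulStd_mulStdR hs ht, smul_sub]
  abel

theorem flip_mulStdInv (s : Sym n) (f : Hecke n) : flip (mulStdInv s f) = mulStdInvR s (flip f) := by
  rw [mulStdInvR, flip_flip]

/-- Appending a letter on the right of a word is right multiplication by an inverse generator. This
makes `bar` commute with `flip`, from which `b_{x⁻¹}` is the flip of `b_x`. -/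
theorem mulStdInv_flip_foldr {s : Sym n} (hs : IsSimple s) {m : List (Sym n)}
    (hm : ∀ t ∈ m, IsSimple t) :
    mulStdInv s (flip (m.foldr mulStdInv (stdElt 1))) =
      flip (m.foldr mulStdInv (mulStdInv s (stdElt 1))) := by
  induction m with
  | nil =>
    have h : ¬ Desc s (1 : Sym n) := by unfold Desc; rw [len_one]; omega
    simp only [List.foldr_nil, mulStdInv_eq, flip_sub, flip_smul, mulStd_stdElt hs, if_neg h,
      flip_stdElt, inv_one, mul_one, add_zero, hs.inv]
  | cons t m ih =>
    rw [List.foldr_cons, List.foldr_cons, flip_mulStdInv, flip_mulStdInv,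
      mulStdInv_mulStdInvR hs (hm t List.mem_cons_self),
      ih fun t ht => hm t (List.mem_cons_of_mem _ ht)]

theorem foldr_mulStdInv_reverse {l : List (Sym n)} (hl : ∀ s ∈ l, IsSimple s) :
    l.foldr mulStdInv (stdElt 1) = flip (l.reverse.foldr mulStdInv (stdElt 1)) := by
  induction l with
  | nil => rw [List.reverse_nil, List.foldr_nil, flip_stdElt, inv_one]
  | cons s l ih =>
    have hl' : ∀ t ∈ l, IsSimple t := fun t ht => hl t (List.mem_cons_of_mem _ ht)
    rw [List.reverse_cons, List.foldr_append, List.foldr_cons, ih hl',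
      mulStdInv_flip_foldr (hl s List.mem_cons_self) fun t ht => hl' t (List.mem_reverse.1 ht)]
    rfl

theorem barStd_inv (x : Sym n) : barStd x⁻¹ = flip (barStd x) := by
  obtain ⟨l, hl, hlen⟩ := exists_reduced x
  rw [barStd_eq hl hlen, barStd_eq hl.inv (by rw [List.length_reverse, hlen, len_inv]),
    foldr_mulStdInv_reverse hl.inv.1, List.reverse_reverse]

theorem bar_flip (f : Hecke n) : bar (flip f) = flip (bar f) := by
  funext y
  rw [flip_apply, bar, bar, Finset.sum_apply, Finset.sum_apply]
  refine Fintype.sum_equiv (Equiv.inv (Sym n)) _ _ fun x => ?_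
  rw [Pi.smul_apply, Pi.smul_apply, Equiv.inv_apply, barStd_inv, flip_apply, flip_apply, inv_inv]

end Hecke

/-! ### The Kazhdan–Lusztig basis -/

section KL

open LaurentPolynomial

variable {n : ℕ}

/-- `g` has the defining properties of the Kazhdan–Lusztig basis element `b_x`. -/
def IsKLElt (x : Sym n) (g : Hecke n) : Prop :=
  bar g = g ∧ g x = 1 ∧ ∀ y, y ≠ x → VPos (g y) ∧ (¬ Bruhat y x → g y = 0)

theorem isKLBasis_iff {b : Sym n → Hecke n} : IsKLBasis b ↔ ∀ x, IsKLElt x (b x) := by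
  simp only [IsKLBasis, IsKLElt, vPos_iff]

/-- The coefficient of `b_y` in `b_s b_x` when `s` is not a left descent of `x`, read off from the
coefficients `g` of `b_x`. -/
def stepCoeff (s x : Sym n) (g : Hecke n) (y : Sym n) : ℤ :=
  if Desc s y then (if y = s * x then 1 else 0) + (g y).coeff 1 else 0

/-- `stepCoeff` collects the constant terms of `b_s g`, so subtracting them leaves coefficients in
`v ℤ[v]`. -/
theorem vPos_mulB_sub {s x : Sym n} (hs : IsSimple s) (hx : ¬ Desc s x) {g : Hecke n} (h1 : g x = 1)
    (hg : ∀ y, y ≠ x → VPos (g y)) (y : Sym n) :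
    VPos (mulB s g y - C (stepCoeff s x g y)) := by
  rw [mulB_apply, stepCoeff]
  by_cases hy : Desc s y
  · have hyx : y ≠ x := fun e => hx (e ▸ hy)
    rw [if_pos hy, if_pos hy, map_add, add_sub_add_comm]
    refine VPos.add ?_ (hg y hyx).T_neg_one_mul_sub
    split_ifs with h
    · rw [h, hs.mul_cancel, h1, map_one, sub_self]; exact VPos.zero
    · rw [map_zero, sub_zero]
      exact hg _ fun e => h (by rw [← e, hs.mul_cancel])
  · rw [if_neg hy, if_neg hy, map_zero, sub_zero]
    refine VPos.add (hg _ ?_) ?_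
    · rintro rfl
      exact hx ((desc_mul hs).2 hy)
    · by_cases hyx : y = x
      · rw [hyx, h1, mul_one]; exact vPos_T_one
      · exact (hg y hyx).T_one_mul

/-- The hypothesis is limited to `m z ≠ 0` because, during the construction, `b z` is only known for
shorter `z`. -/
theorem vPos_sum_sub {b : Sym n → Hecke n} {m : Sym n → ℤ}
    (hb : ∀ z, m z ≠ 0 → b z z = 1 ∧ ∀ y, y ≠ z → VPos (b z y)) (y : Sym n) :
    VPos ((∑ z, C (m z) • b z) y - C (m y)) := by
  rw [Finset.sum_apply, ← Finset.add_sum_erase _ _ (Finset.mem_univ y), add_sub_right_comm]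
  refine VPos.add ?_ (VPos.sum fun z hz => ?_)
  · by_cases h : m y = 0
    · rw [h]; simpa using VPos.zero
    · rw [Pi.smul_apply, (hb y h).1]; simpa using VPos.zero
  · by_cases h : m z = 0
    · rw [h]; simpa using VPos.zero
    · exact ((hb z h).2 y (Finset.ne_of_mem_erase hz).symm).C_mul _

theorem bar_sum_C_smul {b : Sym n → Hecke n} {m : Sym n → ℤ}
    (hb : ∀ z, m z ≠ 0 → bar (b z) = b z) : bar (∑ z, C (m z) • b z) = ∑ z, C (m z) • b z := by
  rw [bar_sum]
  refine Finset.sum_congr rfl fun z _ => ?_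
  by_cases h : m z = 0
  · rw [h, map_zero, zero_smul, bar_zero]
  · rw [bar_smul, invert_C, hb z h]

theorem IsKLElt.eq_zero_of_len {x y : Sym n} {g : Hecke n} (hg : IsKLElt x g) (hne : y ≠ x)
    (h : len x ≤ len y) : g y = 0 :=
  (hg.2.2 y hne).2 fun h' => absurd (h'.len_lt hne) (not_lt.2 h)

theorem IsKLElt.eq_zero {x y : Sym n} {g : Hecke n} (hg : IsKLElt x g) (h : ¬ Bruhat y x) :
    g y = 0 :=
  (hg.2.2 y fun e => h (e ▸ .refl)).2 h

theorem exists_isKLElt (x : Sym n) : ∃ g, IsKLElt x g := by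
  induction hk : len x using Nat.strong_induction_on generalizing x with
  | _ k ih =>
    by_cases hx1 : x = 1
    · refine ⟨stdElt 1, ?_⟩
      subst hx1
      refine ⟨by rw [bar_stdElt, barStd_one], by simp [stdElt], fun y hy => ?_⟩
      have : stdElt 1 y = 0 := by simp [stdElt, hy]
      rw [this]
      exact ⟨VPos.zero, fun _ => rfl⟩
    obtain ⟨s, hs, hd⟩ := exists_desc hx1
    have hl := len_of_desc hs hd
    set w := s * x with hw
    have hxw : x = s * w := by rw [hw, hs.mul_cancel]
    have hdw : ¬ Desc s w := by rw [hw, desc_mul hs]; exact not_not.2 hd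
    have ih' : ∀ y : Sym n, len y < k → ∃ g, IsKLElt y g := fun y hy => ih _ hy y rfl
    choose! b hb using ih'
    have hbw := hb w (by omega)
    set g := b w
    have hgx : g x = 0 := hbw.eq_zero_of_len (fun e => by rw [← e] at hl; omega) (by omega)
    -- These are the unwanted constant terms of `b_s b_w`: everything in `stepCoeff` except the
    -- leading `1` at `x = s w`. They occur only at elements below `w`.
    set m : Sym n → ℤ := fun z => if Desc s z then (g z).coeff 1 else 0 with hm
    have hmz : ∀ z, m z ≠ 0 → Bruhat z w ∧ z ≠ w := by
      intro z hz
      have hdz : Desc s z := by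
        by_contra h
        exact hz (if_neg h)
      refine ⟨?_, fun e => hdw (e ▸ hdz)⟩
      by_contra h
      exact hz (by simp only [hm, if_pos hdz, hbw.eq_zero h]; rfl)
    have hbz : ∀ z, m z ≠ 0 → IsKLElt z (b z) := fun z hz =>
      hb z (((hmz z hz).1.len_lt (hmz z hz).2).trans (by omega))
    have hxle : Bruhat w x := by rw [hxw]; exact bruhat_of_not_desc hs hdw
    refine ⟨mulB s g - ∑ z, C (m z) • b z, ?_, ?_, ?_⟩
    · rw [bar_sub, bar_mulB hs hbw.1, bar_sum_C_smul fun z hz => (hbz z hz).1]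
    · rw [Pi.sub_apply, Finset.sum_apply, Finset.sum_eq_zero, mulB_apply, if_pos hd, hgx, mul_zero,
        add_zero, sub_zero]
      · exact hbw.2.1
      · intro z _
        by_cases h : m z = 0
        · rw [h]; simp
        · have h1 := (hmz z h).1.len_lt (hmz z h).2
          rw [Pi.smul_apply, (hbz z h).eq_zero_of_len (fun e => by rw [← e] at h1; omega) (by omega),
            smul_zero]
    · intro y hy
      refine ⟨?_, fun hyx => ?_⟩
      · have h1 := vPos_mulB_sub hs hdw hbw.2.1 (fun y hy => (hbw.2.2 y hy).1) y
        have h2 := vPos_sum_sub (fun z hz => ⟨(hbz z hz).2.1, fun y hy => ((hbz z hz).2.2 y hy).1⟩) y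
        have h3 : stepCoeff s w g y = m y := by
          rw [stepCoeff, ← hxw, if_neg hy, zero_add]
        rw [h3] at h1
        rw [Pi.sub_apply, ← sub_sub_sub_cancel_right _ _ (C (m y))]
        exact h1.sub h2
      · have hyw : ¬ Bruhat y w := fun h => hyx (h.trans hxle)
        have hsyw : ¬ Bruhat (s * y) w := fun h => by
          rcases Bruhat.mul_left hs h with h | h
          · rw [hs.mul_cancel] at h; exact hyw h
          · rw [hs.mul_cancel, ← hxw] at h; exact hyx h
        rw [Pi.sub_apply, Finset.sum_apply, Finset.sum_eq_zero, mulB_apply, hbw.eq_zero hyw,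
          hbw.eq_zero hsyw]
        · simp
        · intro z _
          by_cases h : m z = 0
          · rw [h]; simp
          · rw [Pi.smul_apply, (hbz z h).eq_zero fun h' => hyw (h'.trans (hmz z h).1), smul_zero]

theorem exists_isKLBasis (n : ℕ) : ∃ b : Sym n → Hecke n, IsKLBasis b := by
  choose b hb using exists_isKLElt (n := n)
  exact ⟨b, isKLBasis_iff.2 hb⟩

/-! ### Uniqueness of coefficients and multiplication by `b_s` -/

theorem eq_zero_of_sum_unitriangular {R : Type*} [CommRing R] {f : Sym n → Sym n → R}
    (h1 : ∀ x, f x x = 1) (h0 : ∀ x y, y ≠ x → len x ≤ len y → f x y = 0) {c : Sym n → R}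
    (hc : ∑ z, c z • f z = 0) : c = 0 := by
  classical
  by_contra hne
  obtain ⟨y0, hy0⟩ := Function.ne_iff.1 hne
  obtain ⟨y, hy, hmax⟩ := Finset.exists_max_image (Finset.univ.filter fun y => c y ≠ 0) len
    ⟨y0, by simpa using hy0⟩
  rw [Finset.mem_filter] at hy
  have h := congrFun hc y
  rw [Finset.sum_apply, Finset.sum_eq_single y] at h
  · rw [Pi.smul_apply, h1, smul_eq_mul, mul_one] at h
    exact hy.2 h
  · intro x _ hx
    by_cases hcx : c x = 0
    · simp [hcx]
    · rw [Pi.smul_apply, h0 x y hx.symm (hmax x (by simpa using hcx)), smul_zero]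
  · simp

theorem coeff_unique_of_unitriangular {R : Type*} [CommRing R] {f : Sym n → Sym n → R}
    (h1 : ∀ x, f x x = 1) (h0 : ∀ x y, y ≠ x → len x ≤ len y → f x y = 0) {c d : Sym n → R}
    (h : ∑ z, c z • f z = ∑ z, d z • f z) : c = d := by
  have := eq_zero_of_sum_unitriangular h1 h0 (c := c - d) (by
    simp only [Pi.sub_apply, sub_smul, Finset.sum_sub_distrib, h, sub_self])
  exact sub_eq_zero.1 this

variable {b : Sym n → Hecke n}

theorem IsKLBasis.isKLElt (hb : IsKLBasis b) (x : Sym n) : IsKLElt x (b x) := isKLBasis_iff.1 hb x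

theorem IsKLBasis.vPos (hb : IsKLBasis b) {x y : Sym n} (h : y ≠ x) : VPos (b x y) :=
  ((hb.isKLElt x).2.2 y h).1

theorem IsKLBasis.self (hb : IsKLBasis b) (x : Sym n) : b x x = 1 := (hb.isKLElt x).2.1

theorem IsKLBasis.eq_zero_of_len (hb : IsKLBasis b) (x y : Sym n) (h : y ≠ x)
    (hl : len x ≤ len y) : b x y = 0 := (hb.isKLElt x).eq_zero_of_len h hl

theorem IsKLBasis.coeff_unique (hb : IsKLBasis b) {c d : Sym n → ℤ[T;T⁻¹]}
    (h : ∑ z, c z • b z = ∑ z, d z • b z) : c = d :=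
  coeff_unique_of_unitriangular hb.self hb.eq_zero_of_len h

theorem IsKLBasis.unique (hb : IsKLBasis b) {x : Sym n} {g : Hecke n} (hbar : bar g = g)
    (h1 : g x = 1) (hg : ∀ y, y ≠ x → VPos (g y)) : g = b x := by
  refine sub_eq_zero.1 (eq_zero_of_bar (by rw [bar_sub, hbar, (hb x).1]) fun y => ?_)
  by_cases h : y = x
  · rw [h, Pi.sub_apply, h1, hb.self, sub_self]; exact VPos.zero
  · exact (hg y h).sub (hb.vPos h)

theorem IsKLBasis.mulB_of_not_desc (hb : IsKLBasis b) {s x : Sym n} (hs : IsSimple s)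
    (hx : ¬ Desc s x) : mulB s (b x) = ∑ y, C (stepCoeff s x (b x) y) • b y := by
  refine sub_eq_zero.1 (eq_zero_of_bar ?_ fun y => ?_)
  · rw [bar_sub, bar_mulB hs (hb x).1, bar_sum_C_smul fun z _ => (hb z).1]
  · have h1 := vPos_mulB_sub hs hx (hb.self x) (fun y hy => hb.vPos hy) y
    have h2 := vPos_sum_sub (b := b) (m := stepCoeff s x (b x))
      (fun z _ => ⟨hb.self z, fun y hy => hb.vPos hy⟩) y
    rw [Pi.sub_apply, ← sub_sub_sub_cancel_right _ _ (C (stepCoeff s x (b x) y))]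
    exact h1.sub h2

theorem IsKLBasis.stepCoeff_mul (hb : IsKLBasis b) {s x : Sym n} (hs : IsSimple s)
    (hx : ¬ Desc s x) : stepCoeff s x (b x) (s * x) = 1 := by
  have hl := len_of_not_desc hs hx
  rw [stepCoeff, if_pos ((desc_mul hs).2 hx), if_pos rfl,
    hb.eq_zero_of_len x (s * x) (fun e => by rw [e] at hl; omega) (by omega)]
  rfl

/-- `b_x` equals `b_s b_{sx}` minus a combination of shorter `b_y` having `s` as a descent. The
first term is an eigenvector because `b_s² = (v + v⁻¹) b_s`, the others by induction. -/
theorem IsKLBasis.mulB_of_desc (hb : IsKLBasis b) {s x : Sym n} (hs : IsSimple s)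
    (hx : Desc s x) : mulB s (b x) = (T 1 + T (-1) : ℤ[T;T⁻¹]) • b x := by
  induction hk : len x using Nat.strong_induction_on generalizing x with
  | _ k ih =>
    have hl := len_of_desc hs hx
    have hdw : ¬ Desc s (s * x) := by rw [desc_mul hs]; exact not_not.2 hx
    have h := hb.mulB_of_not_desc hs hdw
    have h1 := hb.stepCoeff_mul hs hdw
    rw [hs.mul_cancel] at h1
    rw [← Finset.add_sum_erase _ _ (Finset.mem_univ x), h1, map_one, one_smul,
      ← sub_eq_iff_eq_add] at h
    rw [← h, mulB_sub, mulB_mulB hs, mulB_sum, smul_sub, Finset.smul_sum]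
    congr 1
    refine Finset.sum_congr rfl fun y hy => ?_
    rw [mulB_smul, smul_comm]
    by_cases h0 : stepCoeff s (s * x) (b (s * x)) y = 0
    · rw [h0, map_zero, zero_smul, zero_smul]
    congr 1
    have hdy : Desc s y := by
      by_contra hd
      exact h0 (if_neg hd)
    refine ih (len y) ?_ hdy rfl
    rw [stepCoeff, if_pos hdy, hs.mul_cancel, if_neg (Finset.ne_of_mem_erase hy), zero_add] at h0
    by_contra hle
    refine h0 ?_
    rw [hb.eq_zero_of_len (s * x) y (fun e => hdw (e ▸ hdy)) (by omega)]
    rfl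

/-- Compare the coefficients of `δ_y` in `b_s b_z = (v + v⁻¹) b_z`. The extra factor `v` kills the
coefficient of `v` in `h_{y,z}` unless `s y = z`. -/
theorem IsKLBasis.eq_T_mul (hb : IsKLBasis b) {s y z : Sym n} (hs : IsSimple s)
    (hz : Desc s z) (hy : ¬ Desc s y) : b z y = T 1 * b z (s * y) := by
  have h := congrFun (hb.mulB_of_desc hs hz) y
  rw [mulB_apply, if_neg hy, Pi.smul_apply, smul_eq_mul, add_mul, add_comm, add_right_inj] at h
  rw [h, ← mul_assoc, ← T_add]
  simp

theorem IsKLBasis.coeff_one_of_eq_T_mul (hb : IsKLBasis b) {y y' z : Sym n}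
    (h : b z y = T 1 * b z y') : (b z y).coeff 1 = if y' = z then 1 else 0 := by
  rw [h, coeff_T_mul, sub_self]
  split_ifs with h'
  · rw [h', hb.self, AddMonoidAlgebra.coeff_one_zero]
  · exact hb.vPos h' 0 le_rfl

/-- The coefficients of `v` across a descent of `z` that is not a descent of `y`. -/
theorem IsKLBasis.coeff_one (hb : IsKLBasis b) {s y z : Sym n} (hs : IsSimple s)
    (hz : Desc s z) (hy : ¬ Desc s y) : (b z y).coeff 1 = if s * y = z then 1 else 0 :=
  hb.coeff_one_of_eq_T_mul (hb.eq_T_mul hs hz hy)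

theorem IsKLBasis.flip_eq (hb : IsKLBasis b) (x : Sym n) : flip (b x) = b x⁻¹ := by
  refine hb.unique (by rw [bar_flip, (hb x).1]) ?_ fun y hy => ?_
  · rw [flip_apply, inv_inv, hb.self]
  · exact hb.vPos fun e => hy (inv_eq_iff_eq_inv.1 e)

/-- The right-handed analogue of `IsKLBasis.coeff_one`. -/
theorem IsKLBasis.coeff_one_right (hb : IsKLBasis b) {s y z : Sym n} (hs : IsSimple s)
    (hz : Desc s z⁻¹) (hy : ¬ Desc s y⁻¹) : (b z y).coeff 1 = if y * s = z then 1 else 0 := by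
  have h : ∀ y, b z⁻¹ y⁻¹ = b z y := fun y => by rw [← hb.flip_eq, flip_apply, inv_inv]
  have h1 := hb.coeff_one hs hz hy
  rw [h] at h1
  rw [h1]
  congr 1
  rw [eq_inv_iff_mul_eq_one, ← inv_eq_iff_mul_eq_one, mul_inv_rev, inv_inv, hs.inv]

end KL

/-! ### Left cells -/

section Cells

open LaurentPolynomial

variable {n : ℕ} {b : Sym n → Hecke n}

theorem IsKLBasis.leftStep_iff (hb : IsKLBasis b) {x y : Sym n} :
    LeftStep b y x ↔ ∃ s, IsSimple s ∧
      (Desc s x ∧ y = x ∨ ¬ Desc s x ∧ stepCoeff s x (b x) y ≠ 0) := by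
  have hne : (T 1 + T (-1) : ℤ[T;T⁻¹]) ≠ 0 := fun h => by
    have := congrArg (fun p : ℤ[T;T⁻¹] => p.coeff 1) h
    simp [T_apply] at this
  constructor
  · rintro ⟨s, hs, c, hc, hy⟩
    change mulB s (b x) = _ at hc
    refine ⟨s, hs, ?_⟩
    by_cases hd : Desc s x
    · left
      refine ⟨hd, ?_⟩
      have h := hb.coeff_unique (c := c) (d := Pi.single x (T 1 + T (-1))) (by
        rw [← hc, hb.mulB_of_desc hs hd, Finset.sum_eq_single x]
        · simp
        · intro z _ hz; simp [hz]
        · simp)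
      by_contra hyx
      exact hy (by rw [h]; simp [hyx])
    · right
      refine ⟨hd, fun h0 => hy ?_⟩
      rw [congrFun (hb.coeff_unique (hc.symm.trans (hb.mulB_of_not_desc hs hd))) y, h0, map_zero]
  · rintro ⟨s, hs, ⟨hd, rfl⟩ | ⟨hd, h⟩⟩
    · refine ⟨s, hs, Pi.single y (T 1 + T (-1)), ?_, by simpa using hne⟩
      change mulB s (b y) = _
      rw [hb.mulB_of_desc hs hd, Finset.sum_eq_single y]
      · simp
      · intro z _ hz; simp [hz]
      · simp
    · refine ⟨s, hs, _, hb.mulB_of_not_desc hs hd, ?_⟩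
      rwa [Ne, map_eq_zero_iff _ (fun a a' h => by
        have := congrArg (fun p : ℤ[T;T⁻¹] => p.coeff 0) h
        simpa only [C_apply, if_true] using this)]

theorem mem_leftCell_of {x y z : Sym n} (hy : y ∈ leftCell b x) (h1 : LeftLE b z y)
    (h2 : LeftLE b y z) : z ∈ leftCell b x :=
  ⟨h1.trans hy.1, hy.2.trans h2⟩

theorem mem_leftCell_of_between {x y z k : Sym n} (hy : y ∈ leftCell b x) (hz : z ∈ leftCell b x)
    (h1 : LeftLE b y k) (h2 : LeftLE b k z) : k ∈ leftCell b x :=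
  ⟨h2.trans hz.1, hy.2.trans h1⟩

/-! ### The signed basis and its structure constants at `v = 1` -/

/-- The semilinear involution `v ↦ v⁻¹`, `δ_x ↦ (-1)^{ℓ(x)} δ_x`. -/
def signInv (f : Hecke n) : Hecke n := fun y => (-1) ^ len y * invert (f y)

theorem signInv_sub (f g : Hecke n) : signInv (f - g) = signInv f - signInv g := by
  funext y; simp only [signInv, Pi.sub_apply, map_sub, mul_sub]

theorem signInv_smul (c : ℤ[T;T⁻¹]) (f : Hecke n) : signInv (c • f) = invert c • signInv f := by
  funext y
  simp only [signInv, Pi.smul_apply, smul_eq_mul, map_mul]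
  ring

theorem signInv_sum {ι : Type*} (t : Finset ι) (f : ι → Hecke n) :
    signInv (∑ i ∈ t, f i) = ∑ i ∈ t, signInv (f i) := by
  funext y
  simp only [signInv, Finset.sum_apply, map_sum, Finset.mul_sum]

/-- The substitution `v ↦ v⁻¹`, `δ_s ↦ -δ_s` respects the quadratic relation because `v⁻¹ - v`
changes sign too. Thus the action on `b̃` can be read off from the action on `b`. -/
theorem mulStd_signInv {s : Sym n} (hs : IsSimple s) (f : Hecke n) :
    mulStd s (signInv f) = -signInv (mulStd s f) := by
  funext y
  simp only [mulStd_apply, signInv, Pi.neg_apply, map_add, neg_one_pow_len_mul hs]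
  split_ifs
  · rw [map_mul, invert_qq]; ring
  · rw [map_zero]; ring

theorem tildeKL_eq (x : Sym n) : tildeKL b x = ((-1) ^ len x : ℤ[T;T⁻¹]) • signInv (b x) := by
  funext y
  simp only [tildeKL, signInv, Pi.smul_apply, smul_eq_mul, pow_add, mul_assoc]

theorem signInv_eq (x : Sym n) : signInv (b x) = ((-1) ^ len x : ℤ[T;T⁻¹]) • tildeKL b x := by
  rw [tildeKL_eq, smul_smul, ← pow_add, ← two_mul, pow_mul]
  simp

/-- The coefficient of `b̃_y` in `δ_s b̃_z`. -/
def tildeCoeff (b : Sym n → Hecke n) (s y z : Sym n) : ℤ[T;T⁻¹] :=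
  if Desc s z then (if y = z then -T 1 else 0)
  else (if y = z then T (-1) else 0) - (-1) ^ (len z + len y) * C (stepCoeff s z (b z) y)

theorem IsKLBasis.mulStd_tildeKL (hb : IsKLBasis b) {s : Sym n} (hs : IsSimple s) (z : Sym n) :
    mulStd s (tildeKL b z) = ∑ y, tildeCoeff b s y z • tildeKL b y := by
  have h0 : mulStd s (b z) = mulB s (b z) - (T 1 : ℤ[T;T⁻¹]) • b z := by rw [mulB]; abel
  have hsingle : ∀ c : ℤ[T;T⁻¹], ∑ y, (if y = z then c else 0) • tildeKL b y = c • tildeKL b z := by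
    intro c
    rw [Finset.sum_eq_single z]
    · simp
    · intro y _ hy; simp [hy]
    · simp
  rw [tildeKL_eq z, mulStd_smul, mulStd_signInv hs, h0, signInv_sub, signInv_smul]
  by_cases hd : Desc s z
  · simp only [tildeCoeff, if_pos hd, hsingle, hb.mulB_of_desc hs hd, signInv_smul, map_add, invert_T,
      neg_neg]
    rw [tildeKL_eq z]
    module
  · simp only [tildeCoeff, if_neg hd, sub_smul, Finset.sum_sub_distrib, hsingle,
      hb.mulB_of_not_desc hs hd, signInv_sum, signInv_smul, invert_T, invert_C]
    rw [neg_sub, smul_sub, Finset.smul_sum]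
    refine congrArg₂ (· - ·) ?_ (Finset.sum_congr rfl fun y _ => ?_)
    · rw [tildeKL_eq z, smul_smul, smul_smul, mul_comm]
    · rw [signInv_eq, smul_smul, smul_smul, pow_add]
      congr 1
      ring

theorem IsKLBasis.tildeKL_coeff_unique (hb : IsKLBasis b) {c d : Sym n → ℤ[T;T⁻¹]}
    (h : ∑ z, c z • tildeKL b z = ∑ z, d z • tildeKL b z) : c = d := by
  refine coeff_unique_of_unitriangular (f := tildeKL b) (fun x => ?_) (fun x y hne hl => ?_) h
  · rw [tildeKL, hb.self, ← two_mul, pow_mul]; simp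
  · rw [tildeKL, hb.eq_zero_of_len x y hne hl, map_zero, mul_zero]

/-- The coefficient of `b̃_y` in `(1 + s) b̃_z` at `v = 1`. -/
def cellCoeff (b : Sym n → Hecke n) (s y z : Sym n) : ℝ :=
  if Desc s z then 0
  else if y = z then 2 else -((-1) ^ (len z + len y) * (stepCoeff s z (b z) y : ℝ))

theorem stepCoeff_of_not_desc {s z y : Sym n} {g : Hecke n} (h : ¬ Desc s y) :
    stepCoeff s z g y = 0 := if_neg h

theorem eval_tildeCoeff (s y z : Sym n) :
    LaurentPolynomial.eval₂ (Int.castRingHom ℝ) 1 (tildeCoeff b s y z) =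
      cellCoeff b s y z - if y = z then 1 else 0 := by
  rw [tildeCoeff, cellCoeff]
  by_cases hd : Desc s z
  · simp only [if_pos hd]
    split_ifs <;> simp [LaurentPolynomial.eval₂_T]
  · simp only [if_neg hd]
    by_cases hyz : y = z
    · subst hyz
      simp [LaurentPolynomial.eval₂_T, stepCoeff_of_not_desc hd]
      norm_num
    · simp [hyz]

theorem IsKLBasis.isCellMatrix_iff (hb : IsKLBasis b) {x s : Sym n} (hs : IsSimple s)
    {M : Matrix (leftCell b x) (leftCell b x) ℝ} :
    IsCellMatrix b x s M ↔ ∀ y z, M y z = cellCoeff b s y z - if y = z then 1 else 0 := by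
  have hval : ∀ y z : leftCell b x,
      LaurentPolynomial.eval₂ (Int.castRingHom ℝ) 1 (tildeCoeff b s y z) =
        cellCoeff b s y z - if y = z then 1 else 0 := fun y z => by
    rw [eval_tildeCoeff]; simp only [Subtype.ext_iff]
  constructor
  · rintro ⟨c, hc, hM⟩ y z
    have : (fun y => c y z) = fun y => tildeCoeff b s y z :=
      hb.tildeKL_coeff_unique ((hc z).symm.trans (hb.mulStd_tildeKL hs z))
    rw [hM, ← hval, ← congrFun this]
  · intro h
    exact ⟨tildeCoeff b s, hb.mulStd_tildeKL hs, fun y z => by rw [h, hval]⟩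

theorem cellCoeff_of_not_desc {s y : Sym n} (h : ¬ Desc s y) (z : Sym n) :
    cellCoeff b s y z = if y = z then 2 else 0 := by
  rw [cellCoeff]
  by_cases hz : Desc s z
  · rw [if_pos hz, if_neg fun e => h (by rwa [e])]
  · rw [if_neg hz, stepCoeff_of_not_desc h]
    simp

theorem cellCoeff_of_desc {s z : Sym n} (h : Desc s z) (y : Sym n) : cellCoeff b s y z = 0 :=
  if_pos h

theorem IsKLBasis.leftLE_of_cellCoeff (hb : IsKLBasis b) {s y z : Sym n} (hs : IsSimple s)
    (h : cellCoeff b s y z ≠ 0) : LeftLE b y z := by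
  by_cases hyz : y = z
  · rw [hyz]; exact .refl
  · refine .single (hb.leftStep_iff.2 ⟨s, hs, Or.inr ?_⟩)
    rw [cellCoeff] at h
    split_ifs at h with hd
    · exact absurd rfl h
    · refine ⟨hd, fun h0 => h ?_⟩
      rw [h0]; simp

theorem IsKLBasis.cellCoeff_ne_zero (hb : IsKLBasis b) {y z : Sym n} (h : LeftStep b y z)
    (hyz : y ≠ z) : ∃ s, IsSimple s ∧ cellCoeff b s y z ≠ 0 := by
  obtain ⟨s, hs, ⟨_, e⟩ | ⟨hd, h⟩⟩ := hb.leftStep_iff.1 h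
  · exact absurd e hyz
  · refine ⟨s, hs, ?_⟩
    rw [cellCoeff, if_neg hd, if_neg hyz]
    simpa using h

theorem adj_comm {i j : ℕ} (h : i + 1 < j) : adj n i * adj n j = adj n j * adj n i := by
  by_cases hj : j + 1 < n
  · have hi : i + 1 < n := by omega
    refine Equiv.ext fun k => Fin.ext ?_
    simp only [Equiv.Perm.mul_apply, adj_val hi, adj_val hj]
    split_ifs <;> omega
  · simp [adj, hj]

theorem desc_adj_mul_of_far {i j : ℕ} (hi : i + 1 < n) (hj : j + 1 < n) (h : i + 1 < j ∨ j + 1 < i)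
    (w : Sym n) : Desc (adj n i) (adj n j * w) ↔ Desc (adj n i) w := by
  rw [desc_adj hi, desc_adj hi, pos_adj_mul hj _ hi, pos_adj_mul hj _ (Nat.lt_of_succ_lt hi)]
  rw [if_neg (by omega), if_neg (by omega), if_neg (by omega), if_neg (by omega)]

theorem mulStd_comm {i j : ℕ} (hj : j + 1 < n) (h : i + 1 < j) (f : Hecke n) :
    mulStd (adj n i) (mulStd (adj n j) f) = mulStd (adj n j) (mulStd (adj n i) f) := by
  have hi : i + 1 < n := by omega
  funext y
  have e : adj n i * (adj n j * y) = adj n j * (adj n i * y) := by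
    rw [← mul_assoc, adj_comm h, mul_assoc]
  simp only [mulStd_apply, e, desc_adj_mul_of_far hi hj (Or.inl h),
    desc_adj_mul_of_far hj hi (Or.inr h)]
  split_ifs <;> ring

theorem IsKLBasis.sum_tildeCoeff_comm (hb : IsKLBasis b) {i j : ℕ} (hj : j + 1 < n) (h : i + 1 < j)
    (y z : Sym n) :
    ∑ k, tildeCoeff b (adj n i) y k * tildeCoeff b (adj n j) k z =
      ∑ k, tildeCoeff b (adj n j) y k * tildeCoeff b (adj n i) k z := by
  have hi : i + 1 < n := by omega
  have key : ∀ {s t : Sym n}, IsSimple s → IsSimple t → mulStd s (mulStd t (tildeKL b z)) =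
      ∑ y, (∑ k, tildeCoeff b s y k * tildeCoeff b t k z) • tildeKL b y := by
    intro s t hs ht
    rw [hb.mulStd_tildeKL ht, mulStd_sum]
    simp only [mulStd_smul, hb.mulStd_tildeKL hs, Finset.smul_sum, Finset.sum_smul, smul_smul]
    rw [Finset.sum_comm]
    simp only [mul_comm]
  have h1 := mulStd_comm hj h (tildeKL b z)
  rw [key (isSimple_adj hi) (isSimple_adj hj), key (isSimple_adj hj) (isSimple_adj hi)] at h1
  exact congrFun (hb.tildeKL_coeff_unique h1) y

theorem IsKLBasis.sum_cellCoeff_comm (hb : IsKLBasis b) {i j : ℕ} (hj : j + 1 < n) (h : i + 1 < j)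
    (y z : Sym n) :
    ∑ k, cellCoeff b (adj n i) y k * cellCoeff b (adj n j) k z =
      ∑ k, cellCoeff b (adj n j) y k * cellCoeff b (adj n i) k z := by
  have h1 := congrArg (LaurentPolynomial.eval₂ (Int.castRingHom ℝ) 1)
    (hb.sum_tildeCoeff_comm hj h y z)
  simp only [map_sum, map_mul, eval_tildeCoeff, sub_mul, mul_sub, Finset.sum_sub_distrib, ite_mul,
    mul_ite, one_mul, mul_one, zero_mul, mul_zero, Finset.sum_ite_eq, Finset.sum_ite_eq',
    Finset.mem_univ, if_true] at h1
  linarith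

/-- The matrix of `1 + s` on a left cell representation at `v = 1`. -/
def cellMatrix (b : Sym n → Hecke n) (x s : Sym n) : Matrix (leftCell b x) (leftCell b x) ℝ :=
  fun y z => cellCoeff b s y z

instance (x : Sym n) : Fintype (leftCell b x) := Fintype.ofFinite _

/-- Cells are convex for the left preorder, so a product of two structure constants between elements
of a cell can only be non-zero if the intermediate element is in the cell. Identities in the full
module therefore pass to cell matrices. -/
theorem IsKLBasis.sum_cell (hb : IsKLBasis b) {s t x : Sym n} (hs : IsSimple s) (ht : IsSimple t)
    (y z : leftCell b x) :
    ∑ k : leftCell b x, cellCoeff b s y k * cellCoeff b t k z =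
      ∑ k, cellCoeff b s y k * cellCoeff b t k z := by
  classical
  rw [← Finset.sum_subtype (Finset.univ.filter fun k => k ∈ leftCell b x) (by simp)
    fun k => cellCoeff b s y k * cellCoeff b t k z, Finset.sum_filter_of_ne]
  intro k _ hk
  exact mem_leftCell_of_between y.2 z.2 (hb.leftLE_of_cellCoeff hs (left_ne_zero_of_mul hk))
    (hb.leftLE_of_cellCoeff ht (right_ne_zero_of_mul hk))

theorem IsKLBasis.cellMatrix_comm (hb : IsKLBasis b) (x : Sym n) {i j : ℕ} (hj : j + 1 < n)
    (h : i + 1 < j) : cellMatrix b x (adj n i) * cellMatrix b x (adj n j) =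
      cellMatrix b x (adj n j) * cellMatrix b x (adj n i) := by
  have hi : i + 1 < n := by omega
  ext y z
  rw [Matrix.mul_apply, Matrix.mul_apply]
  exact (hb.sum_cell (isSimple_adj hi) (isSimple_adj hj) y z).trans
    ((hb.sum_cellCoeff_comm hj h y z).trans
      (hb.sum_cell (isSimple_adj hj) (isSimple_adj hi) y z).symm)

/-- The star operation stays in the left cell: `s` leads from `y` to `s y`, and `t`, which has
stopped being a descent, leads back because `h_{y,sy}` has coefficient `1` at `v`. -/
theorem IsKLBasis.leftLE_mul (hb : IsKLBasis b) {s t y : Sym n} (hs : IsSimple s) (ht : IsSimple t)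
    (hsy : ¬ Desc s y) (hty : Desc t y) (h : ¬ Desc t (s * y)) :
    LeftLE b (s * y) y ∧ LeftLE b y (s * y) := by
  refine ⟨.single (hb.leftStep_iff.2 ⟨s, hs, Or.inr ⟨hsy, ?_⟩⟩),
    .single (hb.leftStep_iff.2 ⟨t, ht, Or.inr ⟨h, ?_⟩⟩)⟩
  · rw [hb.stepCoeff_mul hs hsy]; exact one_ne_zero
  · rw [stepCoeff, if_pos hty, hb.coeff_one hs ((desc_mul hs).2 hsy) hsy, if_pos rfl]
    split_ifs <;> norm_num

/-- Both sides compare the positions of the outer two of the three consecutive values involved. -/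
theorem desc_mul_iff_of_adjacent {i j : ℕ} (hi : i + 1 < n) (hj : j + 1 < n)
    (hij : i + 1 = j ∨ j + 1 = i) {y : Sym n} (hsy : ¬ Desc (adj n i) y) (hty : Desc (adj n j) y) :
    Desc (adj n j) (adj n i * y) ↔ Desc (adj n i) (adj n j * y) := by
  have hi' := Nat.lt_of_succ_lt hi
  have hj' := Nat.lt_of_succ_lt hj
  rw [desc_adj hi] at hsy
  rw [desc_adj hj] at hty
  rw [desc_adj hi, desc_adj hj, pos_adj_mul hi _ hj, pos_adj_mul hi _ hj', pos_adj_mul hj _ hi,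
    pos_adj_mul hj _ hi']
  rcases hij with rfl | rfl
  · simp [show i + 1 + 1 ≠ i by omega, show i ≠ i + 1 + 1 by omega]
  · simp [show j + 1 + 1 ≠ j by omega, show j ≠ j + 1 + 1 by omega]

/-- Since `s` is a descent of `z` but not of `y`, `IsKLBasis.coeff_one` leaves only the neighbours
`t y` and `s y`. In both cases the lengths differ in parity, which cancels the minus sign in
`cellCoeff`. -/
theorem IsKLBasis.cellCoeff_of_desc_of_not_desc (hb : IsKLBasis b) {s t y z : Sym n}
    (hs : IsSimple s) (ht : IsSimple t) (hsy : ¬ Desc s y) (hty : Desc t y) (hsz : Desc s z)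
    (htz : ¬ Desc t z) :
    cellCoeff b t y z = if z = t * y ∨ z = s * y then 1 else 0 := by
  have hst : t * y ≠ s * y := fun e => by
    have := mul_right_cancel e
    rw [this] at hty
    exact hsy hty
  have hyz : y ≠ z := fun e => htz (e ▸ hty)
  rw [cellCoeff, if_neg htz, if_neg hyz, stepCoeff, if_pos hty, hb.coeff_one hs hsz hsy]
  have e1 : y = t * z ↔ z = t * y :=
    ⟨fun e => by rw [e, ht.mul_cancel], fun e => by rw [e, ht.mul_cancel]⟩
  have e2 : s * y = z ↔ z = s * y := eq_comm
  simp only [e1, e2]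
  by_cases h1 : z = t * y
  · have h2 : z ≠ s * y := fun e => hst (h1.symm.trans e)
    rw [if_pos h1, if_neg h2, if_pos (Or.inl h1), pow_add, h1, neg_one_pow_len_mul ht]
    have : ((-1 : ℝ) ^ len y) * (-1) ^ len y = 1 := by rw [← mul_pow]; simp
    push_cast
    linarith
  · by_cases h2 : z = s * y
    · rw [if_neg h1, if_pos h2, if_pos (Or.inr h2), pow_add, h2, neg_one_pow_len_mul hs]
      have : ((-1 : ℝ) ^ len y) * (-1) ^ len y = 1 := by rw [← mul_pow]; simp
      push_cast
      linarith
    · rw [if_neg h1, if_neg h2, if_neg (by tauto)]; simp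

theorem IsKLBasis.cellCoeff_symm (hb : IsKLBasis b) {s t y z : Sym n}
    (hs : IsSimple s) (ht : IsSimple t) (hsy : ¬ Desc s y) (hty : Desc t y) (hsz : Desc s z)
    (htz : ¬ Desc t z) : cellCoeff b s z y = cellCoeff b t y z := by
  rw [hb.cellCoeff_of_desc_of_not_desc hs ht hsy hty hsz htz,
    hb.cellCoeff_of_desc_of_not_desc ht hs htz hsz hty hsy]
  have e : ∀ {r : Sym n}, IsSimple r → (y = r * z ↔ z = r * y) := fun hr =>
    ⟨fun e => by rw [e, hr.mul_cancel], fun e => by rw [e, hr.mul_cancel]⟩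
  simp only [e hs, e ht, or_comm]

/-- On a left cell whose elements never have two adjacent non-descents, `1 + t` acts on a dual basis
vector with a non-descent adjacent to `t` by moving it to another basis vector. -/
theorem IsKLBasis.exists_star (hb : IsKLBasis b) {x : Sym n} {i j : ℕ} (hi : i + 1 < n)
    (hj : j + 1 < n) (hij : i + 1 = j ∨ j + 1 = i)
    (hX : ∀ z ∈ leftCell b x, Desc (adj n i) z ∨ Desc (adj n j) z) {y : Sym n}
    (hy : y ∈ leftCell b x) (hsy : ¬ Desc (adj n i) y) :
    ∃ y' ∈ leftCell b x, ¬ Desc (adj n j) y' ∧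
      ∀ z ∈ leftCell b x, cellCoeff b (adj n j) y z = if z = y' then 1 else 0 := by
  have hs := isSimple_adj hi
  have ht := isSimple_adj hj
  have hty : Desc (adj n j) y := (hX y hy).resolve_left hsy
  have hval : ∀ z ∈ leftCell b x, ¬ Desc (adj n j) z →
      cellCoeff b (adj n j) y z = if z = adj n j * y ∨ z = adj n i * y then 1 else 0 :=
    fun z hz hd => hb.cellCoeff_of_desc_of_not_desc hs ht hsy hty ((hX z hz).resolve_right hd) hd
  -- This equivalence decides which of `t y` and `s y` is the target: the other one has the wrong
  -- descents to contribute, or violates `hX`.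
  have hcomm := desc_mul_iff_of_adjacent hi hj hij hsy hty
  by_cases hP : Desc (adj n j) (adj n i * y)
  · refine ⟨adj n j * y, ?_, by rw [desc_mul ht]; exact not_not.2 hty, fun z hz => ?_⟩
    · have h := hb.leftLE_mul (y := adj n j * y) ht hs (by rw [desc_mul ht]; exact not_not.2 hty)
        (hcomm.1 hP) (by rw [adj_mul_cancel]; exact hsy)
      rw [adj_mul_cancel] at h
      exact mem_leftCell_of hy h.2 h.1
    · by_cases hd : Desc (adj n j) z
      · rw [cellCoeff_of_desc hd, if_neg]
        rintro rfl
        exact (desc_mul ht).1 hd hty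
      · rw [hval z hz hd]
        have : z ≠ adj n i * y := fun e => hd (e ▸ hP)
        simp [this]
  · refine ⟨adj n i * y, ?_, hP, fun z hz => ?_⟩
    · have h := hb.leftLE_mul hs ht hsy hty hP
      exact mem_leftCell_of hy h.1 h.2
    · by_cases hd : Desc (adj n j) z
      · rw [cellCoeff_of_desc hd, if_neg]
        rintro rfl
        exact hP hd
      · rw [hval z hz hd]
        have : z ≠ adj n j * y := by
          rintro rfl
          rcases hX _ hz with h | h
          · exact hP (hcomm.2 h)
          · exact hd h
        simp [this]

theorem len_mul_right_le {s : Sym n} (hs : IsSimple s) (w : Sym n) : len (w * s) ≤ len w + 1 := by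
  rw [← len_inv, mul_inv_rev, hs.inv, ← len_inv w]
  exact len_mul_le hs _

/-- Right descents can only grow when going down in the left preorder. -/
theorem IsKLBasis.right_desc_of_leftLE (hb : IsKLBasis b) {r x y : Sym n} (hr : IsSimple r)
    (h : LeftLE b y x) (hx : Desc r x⁻¹) : Desc r y⁻¹ := by
  induction h using Relation.ReflTransGen.head_induction_on with
  | refl => exact hx
  | @head y z hstep _ ih =>
    by_contra hy
    obtain ⟨s, hs, ⟨_, rfl⟩ | ⟨hd, hc⟩⟩ := hb.leftStep_iff.1 hstep
    · exact hy ih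
    have hdy : Desc s y := by
      by_contra h
      exact hc (if_neg h)
    have l1 := len_of_desc hr ih
    have l2 := len_of_not_desc hr hy
    have e1 : len (r * z⁻¹) = len (z * r) := by rw [← len_inv, mul_inv_rev, inv_inv, hr.inv]
    have e2 : len (r * y⁻¹) = len (y * r) := by rw [← len_inv, mul_inv_rev, inv_inv, hr.inv]
    rw [e1, len_inv] at l1
    rw [e2, len_inv] at l2
    have l3 := len_of_desc hs hdy
    have l4 := len_of_not_desc hs hd
    rw [stepCoeff, if_pos hdy, hb.coeff_one_right hr ih hy] at hc
    -- A non-zero step coefficient leaves only `y = s z` or `y r = z`; in either case multiplying by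
    -- one further simple reflection would change the length by more than one.
    by_cases h1 : y = s * z
    · have := len_mul_le hs (z * r)
      rw [← mul_assoc, ← h1] at this
      rw [← h1] at l4
      omega
    · have h2 : y * r = z := by
        by_contra h2
        rw [if_neg h1, if_neg h2] at hc
        exact hc rfl
      have := len_mul_right_le hr (s * y)
      rw [mul_assoc, h2] at this
      rw [h2] at l2
      omega

end Cells

/-! ### Lattice paths and cell modules of the Temperley–Lieb algebra -/

section Paths

/-- The lowest path: `b` times up and down, then always up. -/
def lowPath (b j : ℕ) : ℤ := if j ≤ 2 * b then ((j % 2 : ℕ) : ℤ) else (j : ℤ) - 2 * b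

theorem lowPath_zero (b : ℕ) : lowPath b 0 = 0 := by simp [lowPath]

theorem lowPath_succ (b j : ℕ) : lowPath b (j + 1) = lowPath b j + 1 ∨
    j + 1 ≤ 2 * b ∧ j % 2 = 1 ∧ lowPath b j = 1 ∧ lowPath b (j + 1) = 0 := by
  unfold lowPath
  split_ifs <;> omega

theorem lowPath_add_two (b j : ℕ) : lowPath b j ≤ lowPath b (j + 2) := by
  unfold lowPath
  split_ifs <;> omega

theorem lowPath_nonneg (b j : ℕ) : 0 ≤ lowPath b j := by
  unfold lowPath
  split_ifs <;> omega

theorem lowPath_emod (b j : ℕ) : lowPath b j % 2 = (j : ℤ) % 2 := by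
  unfold lowPath
  split_ifs <;> omega

/-- Lattice paths of length `n` (continued by the lowest path) above the lowest path, given by their
heights. -/
structure IsPath (n b : ℕ) (h : ℕ → ℤ) : Prop where
  zero : h 0 = 0
  step : ∀ j, h (j + 1) = h j + 1 ∨ h (j + 1) = h j - 1
  le : ∀ j, lowPath b j ≤ h j
  eq : ∀ j, n ≤ j → h j = lowPath b j

/-- The path `h` has a peak at `i + 1`. -/
def IsPeak (h : ℕ → ℤ) (i : ℕ) : Prop := h i = h (i + 1) - 1 ∧ h (i + 2) = h (i + 1) - 1

/-- The path `h` has a valley at `i + 1`. -/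
def IsValley (h : ℕ → ℤ) (i : ℕ) : Prop := h i = h (i + 1) + 1 ∧ h (i + 2) = h (i + 1) + 1

/-- Flip a peak at `i + 1`. -/
def pathDown (h : ℕ → ℤ) (i : ℕ) : ℕ → ℤ := Function.update h (i + 1) (h (i + 1) - 2)

/-- Flip a valley at `i + 1`. -/
def pathUp (h : ℕ → ℤ) (i : ℕ) : ℕ → ℤ := Function.update h (i + 1) (h (i + 1) + 2)

variable {n b : ℕ} {h : ℕ → ℤ}

theorem pathDown_self (h : ℕ → ℤ) (i : ℕ) : pathDown h i (i + 1) = h (i + 1) - 2 :=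
  Function.update_self ..

theorem pathDown_of_ne (h : ℕ → ℤ) {i j : ℕ} (hj : j ≠ i + 1) : pathDown h i j = h j :=
  Function.update_of_ne hj ..

theorem pathUp_self (h : ℕ → ℤ) (i : ℕ) : pathUp h i (i + 1) = h (i + 1) + 2 :=
  Function.update_self ..

theorem pathUp_of_ne (h : ℕ → ℤ) {i j : ℕ} (hj : j ≠ i + 1) : pathUp h i j = h j :=
  Function.update_of_ne hj ..

theorem IsPath.emod (hh : IsPath n b h) (j : ℕ) : h j % 2 = (j : ℤ) % 2 := by
  induction j with
  | zero => rw [hh.zero]; rfl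
  | succ j ih =>
    have := hh.step j
    push_cast
    omega

theorem IsPath.lt_of_lt (hh : IsPath n b h) {i : ℕ} (hi : lowPath b i < h i) : i < n := by
  by_contra h'
  rw [hh.eq i (not_lt.1 h')] at hi
  exact lt_irrefl _ hi

theorem IsPath.add_two_le (hh : IsPath n b h) {i : ℕ} (hi : lowPath b i < h i) :
    lowPath b i + 2 ≤ h i := by
  have := hh.emod i
  have := lowPath_emod b i
  omega

theorem IsPath.down (hh : IsPath n b h) {i : ℕ} (hp : IsPeak h i)
    (hi : lowPath b (i + 1) < h (i + 1)) : IsPath n b (pathDown h i) := by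
  have h2 := hh.add_two_le hi
  have h3 := hh.lt_of_lt hi
  obtain ⟨hp1, hp2⟩ := hp
  refine ⟨?_, fun j => ?_, fun j => ?_, fun j hj => ?_⟩
  · rw [pathDown_of_ne h (by omega), hh.zero]
  · by_cases hj : j = i
    · subst hj
      rw [pathDown_self, pathDown_of_ne h (by omega)]
      omega
    · by_cases hj' : j = i + 1
      · subst hj'
        rw [pathDown_self, pathDown_of_ne h (by omega)]
        have : h (i + 1 + 1) = h (i + 2) := rfl
        omega
      · rw [pathDown_of_ne h (by omega), pathDown_of_ne h (by omega)]
        exact hh.step j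
  · by_cases hj : j = i + 1
    · subst hj
      rw [pathDown_self]
      omega
    · rw [pathDown_of_ne h hj]
      exact hh.le j
  · rw [pathDown_of_ne h (by omega)]
    exact hh.eq j hj

theorem IsPath.up (hh : IsPath n b h) {i : ℕ} (hi : i + 1 < n) (hp : IsValley h i) :
    IsPath n b (pathUp h i) := by
  obtain ⟨hp1, hp2⟩ := hp
  refine ⟨?_, fun j => ?_, fun j => ?_, fun j hj => ?_⟩
  · rw [pathUp_of_ne h (by omega), hh.zero]
  · by_cases hj : j = i
    · subst hj
      rw [pathUp_self, pathUp_of_ne h (by omega)]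
      omega
    · by_cases hj' : j = i + 1
      · subst hj'
        rw [pathUp_self, pathUp_of_ne h (by omega)]
        have : h (i + 1 + 1) = h (i + 2) := rfl
        omega
      · rw [pathUp_of_ne h (by omega), pathUp_of_ne h (by omega)]
        exact hh.step j
  · by_cases hj : j = i + 1
    · subst hj
      rw [pathUp_self]
      have := hh.le (i + 1)
      omega
    · rw [pathUp_of_ne h hj]
      exact hh.le j
  · rw [pathUp_of_ne h (by omega)]
    exact hh.eq j hj

theorem isPeak_pathUp {i : ℕ} (hp : IsValley h i) : IsPeak (pathUp h i) i := by
  obtain ⟨hp1, hp2⟩ := hp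
  unfold IsPeak
  rw [pathUp_self, pathUp_of_ne h (by omega), pathUp_of_ne h (by omega)]
  omega

theorem pathDown_pathUp (h : ℕ → ℤ) (i : ℕ) : pathDown (pathUp h i) i = h := by
  funext j
  by_cases hj : j = i + 1
  · subst hj
    rw [pathDown_self, pathUp_self]
    omega
  · rw [pathDown_of_ne _ hj, pathUp_of_ne _ hj]

/-- (Twice) the area between a path and the lowest one. -/
def pathArea (n b : ℕ) (h : ℕ → ℤ) : ℕ := ∑ j ∈ Finset.range n, (h j - lowPath b j).toNat

theorem IsPath.pathArea_down (hh : IsPath n b h) {i : ℕ} (hi : lowPath b (i + 1) < h (i + 1)) :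
    pathArea n b (pathDown h i) + 2 = pathArea n b h := by
  have h2 := hh.add_two_le hi
  have hmem : i + 1 ∈ Finset.range n := Finset.mem_range.2 (hh.lt_of_lt hi)
  have he : ∑ j ∈ (Finset.range n).erase (i + 1), (pathDown h i j - lowPath b j).toNat =
      ∑ j ∈ (Finset.range n).erase (i + 1), (h j - lowPath b j).toNat :=
    Finset.sum_congr rfl fun j hj => by rw [pathDown_of_ne h (Finset.ne_of_mem_erase hj)]
  unfold pathArea
  rw [← Finset.add_sum_erase _ _ hmem, ← Finset.add_sum_erase _ _ hmem, he, pathDown_self]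
  omega

theorem IsPath.pathArea_up (hh : IsPath n b h) {i : ℕ} (hi : i + 1 < n) (hp : IsValley h i) :
    pathArea n b (pathUp h i) = pathArea n b h + 2 := by
  have := (hh.up hi hp).pathArea_down (i := i) (by
    rw [pathUp_self]
    have := hh.le (i + 1)
    omega)
  rw [pathDown_pathUp] at this
  exact this.symm

/-- A peak at `k + 1` above the lowest path, which is preceded by two steps up. -/
def IsGood (b : ℕ) (h : ℕ → ℤ) (k : ℕ) : Prop :=
  IsPeak h k ∧ lowPath b (k + 1) < h (k + 1) ∧ 0 < k ∧ h k = h (k - 1) + 1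

/-- Where the path first leaves the lowest one it has just made two steps up. Without a good peak it
would keep rising forever, although it has to rejoin the lowest path. -/
theorem IsPath.exists_good (hh : IsPath n b h) (hne : ∃ j, lowPath b j < h j) :
    ∃ k, IsGood b h k := by
  classical
  by_contra hno
  set j := Nat.find hne with hj
  have hj1 : lowPath b j < h j := Nat.find_spec hne
  have hmin : ∀ i < j, h i = lowPath b i := fun i hi =>
    le_antisymm (not_lt.1 (Nat.find_min hne hi)) (hh.le i)
  have hj0 : j ≠ 0 := fun e => by rw [e, hh.zero, lowPath_zero] at hj1; exact lt_irrefl _ hj1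
  obtain ⟨p, hp⟩ := Nat.exists_eq_succ_of_ne_zero hj0
  rw [Nat.succ_eq_add_one] at hp
  have e1 := hmin p (by omega)
  have e2 := hh.step p
  have e3 := lowPath_succ b p
  rw [hp] at hj1
  obtain ⟨q, hq⟩ : ∃ q, p = q + 1 := ⟨p - 1, by omega⟩
  have e4 := hmin q (by omega)
  have e5 := lowPath_succ b q
  have e6 := hh.le (q + 2)
  subst hq
  have r1 : h (q + 1 + 1) = h (q + 2) := rfl
  have hb : q + 2 ≤ 2 * b := by omega
  have hS : ∀ m, h (q + m) = m ∧ h (q + m + 1) = m + 1 ∧ h (q + m + 2) = m + 2 := by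
    intro m
    induction m with
    | zero => simp only [add_zero, Nat.cast_zero]; omega
    | succ m ih =>
      rw [show q + (m + 1) = q + m + 1 by ring]
      have := hh.step (q + m + 2)
      rw [show q + m + 2 + 1 = q + m + 1 + 2 by ring] at this
      push_cast
      have r2 : h (q + m + 1 + 1) = h (q + m + 2) := rfl
      by_contra h'
      refine hno ⟨q + m + 1, ⟨?_, ?_⟩, ?_, by omega, ?_⟩
      · rw [show q + m + 1 + 1 = q + m + 2 by ring]; omega
      · rw [show q + m + 1 + 1 = q + m + 2 by ring]; omega
      · rw [show q + m + 1 + 1 = q + m + 2 by ring, ih.2.2]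
        unfold lowPath
        split_ifs <;> omega
      · rw [show q + m + 1 - 1 = q + m by omega]; omega
  have h1 := (hS n).1
  rw [hh.eq (q + n) (by omega)] at h1
  have h2 := (hS (n + 1)).2.1
  rw [hh.eq (q + (n + 1) + 1) (by omega)] at h2
  unfold lowPath at h2
  split_ifs at h2 <;> omega

/-! ### Path vectors -/

variable {V : Type*} [AddCommGroup V] [Module ℝ V]

open Classical in
/-- The vector obtained from `f` by applying `E k` for the boxes between the lowest path and `h`. -/
def pathVec (n b : ℕ) (E : ℕ → V →ₗ[ℝ] V) (f : V) (h : ℕ → ℤ) : V :=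
  if H : IsPath n b h ∧ ∃ k, IsGood b h k then
    -- The choice of good peak is immaterial by `IsTL.pathVec_peak`. The two preceding up steps
    -- ensure that the lower path has a peak at `k`, so that its vector is fixed up to the factor
    -- `2` by `E (k - 1)`; `IsTL.pathVec_mem` depends on this.
    E H.2.choose (pathVec n b E f (pathDown h H.2.choose))
  else f
termination_by pathArea n b h
decreasing_by
  have := H.1.pathArea_down H.2.choose_spec.2.1
  omega

/-- The operators `E i`, `i + 1 < n`, satisfy the Temperley–Lieb relations with loop parameter `2`,
and `f` is a vector of the form `∪∪⋯∪||⋯|` with `b` cups. -/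
structure IsTL (n b : ℕ) (E : ℕ → V →ₗ[ℝ] V) (f : V) : Prop where
  sq : ∀ i, i + 1 < n → ∀ v, E i (E i v) = (2 : ℝ) • E i v
  comm : ∀ i j, i + 1 < j → j + 1 < n → ∀ v, E i (E j v) = E j (E i v)
  braid : ∀ i j, i + 1 < n → j + 1 < n → (i + 1 = j ∨ j + 1 = i) → ∀ v, E i (E j (E i v)) = E i v
  cup : ∀ k < b, E (2 * k) f = (2 : ℝ) • f
  cap : ∀ i, 2 * b ≤ i → i + 1 < n → E i f = 0

variable {E : ℕ → V →ₗ[ℝ] V} {f : V}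

theorem IsTL.comm_of_far (hT : IsTL n b E f) {i j : ℕ} (hi : i + 1 < n) (hj : j + 1 < n)
    (hij : i + 1 < j ∨ j + 1 < i) (v : V) : E i (E j v) = E j (E i v) := by
  rcases hij with h | h
  · exact hT.comm i j h hj v
  · exact (hT.comm j i h hi v).symm

theorem pathVec_eq (E : ℕ → V →ₗ[ℝ] V) (f : V) (hh : IsPath n b h) :
    (∃ k, IsGood b h k ∧ pathVec n b E f h = E k (pathVec n b E f (pathDown h k))) ∨
      (∀ j, h j = lowPath b j) ∧ pathVec n b E f h = f := by
  by_cases H : ∃ k, IsGood b h k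
  · left
    refine ⟨H.choose, H.choose_spec, ?_⟩
    rw [pathVec, dif_pos ⟨hh, H⟩]
  · right
    constructor
    · intro j
      by_contra hj
      exact H (hh.exists_good ⟨j, lt_of_le_of_ne (hh.le j) (Ne.symm hj)⟩)
    · rw [pathVec, dif_neg fun h' => H h'.2]

theorem isPeak_far {i k : ℕ} (hi : IsPeak h i) (hk : IsPeak h k) (hne : i ≠ k) :
    i + 1 < k ∨ k + 1 < i := by
  by_contra h'
  rcases (show k = i + 1 ∨ i = k + 1 by omega) with rfl | rfl
  · have := hi.2; have := hk.1; rw [show i + 1 + 1 = i + 2 by ring] at *; omega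
  · have := hi.1; have := hk.2; rw [show k + 1 + 1 = k + 2 by ring] at *; omega

theorem isPeak_pathDown {i k : ℕ} (hi : IsPeak h i) (hik : i + 1 < k ∨ k + 1 < i) :
    IsPeak (pathDown h k) i := by
  unfold IsPeak
  rw [pathDown_of_ne h (by omega), pathDown_of_ne h (by omega), pathDown_of_ne h (by omega)]
  exact hi

theorem pathDown_comm (h : ℕ → ℤ) {i k : ℕ} (hik : i ≠ k) :
    pathDown (pathDown h i) k = pathDown (pathDown h k) i := by
  unfold pathDown
  rw [Function.update_comm (by omega), Function.update_of_ne (by omega),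
    Function.update_of_ne (by omega)]

/-- Two distinct peaks are never adjacent, so their operators commute, and any removable peak may be
taken as the outermost box. -/
theorem IsTL.pathVec_peak (hT : IsTL n b E f) (hh : IsPath n b h) {i : ℕ} (hp : IsPeak h i)
    (hi : lowPath b (i + 1) < h (i + 1)) :
    pathVec n b E f h = E i (pathVec n b E f (pathDown h i)) := by
  induction hk : pathArea n b h using Nat.strong_induction_on generalizing h i with
  | _ N ih =>
    rcases pathVec_eq E f hh with ⟨k, hg, e⟩ | ⟨hlow, _⟩
    · by_cases hik : i = k
      · rw [hik, e]
      have hfar := isPeak_far hp hg.1 hik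
      have a1 := hh.pathArea_down hg.2.1
      have a2 := hh.pathArea_down hi
      have hdk := hh.down hg.1 hg.2.1
      have hdi := hh.down hp hi
      have e1 := ih _ (by omega) hdk (isPeak_pathDown hp hfar)
        (by rw [pathDown_of_ne h (by omega)]; exact hi) rfl
      have e2 := ih _ (by omega) hdi (isPeak_pathDown hg.1 hfar.symm)
        (by rw [pathDown_of_ne h (by omega)]; exact hg.2.1) rfl
      rw [e, e1, e2, pathDown_comm h hik]
      exact hT.comm_of_far (hh.lt_of_lt hg.2.1) (hh.lt_of_lt hi) hfar.symm _
    · rw [hlow (i + 1)] at hi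
      exact absurd hi (lt_irrefl _)

/-- A peak above the lowest path has `E i` outermost, and `E i` squares to twice itself. A peak on
the lowest path is one of the cups of `f`, and `E i` commutes past all other boxes to reach it. -/
theorem IsTL.apply_pathVec_peak (hT : IsTL n b E f) (hh : IsPath n b h) {i : ℕ} (hin : i + 1 < n)
    (hp : IsPeak h i) : E i (pathVec n b E f h) = (2 : ℝ) • pathVec n b E f h := by
  by_cases hi : lowPath b (i + 1) < h (i + 1)
  · rw [hT.pathVec_peak hh hp hi, hT.sq i hin]
  have hi' : h (i + 1) = lowPath b (i + 1) := le_antisymm (not_lt.1 hi) (hh.le _)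
  obtain ⟨c, hcb, rfl⟩ : ∃ c < b, i = 2 * c := by
    have h1 := hh.le i
    have h2 := hh.le (i + 2)
    have h3 := lowPath_succ b i
    have h4 := lowPath_succ b (i + 1)
    rw [show i + 1 + 1 = i + 2 by ring] at h4
    obtain ⟨h5, h6⟩ := hp
    exact ⟨i / 2, by omega, by omega⟩
  clear hi
  induction hk : pathArea n b h using Nat.strong_induction_on generalizing h with
  | _ N ih =>
    rcases pathVec_eq E f hh with ⟨k, hg, e⟩ | ⟨_, e⟩
    · have hne : 2 * c ≠ k := fun e => by
        have := hg.2.1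
        rw [← e, hi'] at this
        exact lt_irrefl _ this
      have hfar := isPeak_far hp hg.1 hne
      have a1 := hh.pathArea_down hg.2.1
      have := ih _ (by omega) (hh.down hg.1 hg.2.1) (isPeak_pathDown hp hfar)
        (by rw [pathDown_of_ne h (by omega)]; exact hi') rfl
      rw [e, hT.comm_of_far hin (hh.lt_of_lt hg.2.1) hfar, this, map_smul]
    · rw [e, hT.cup c hcb]

theorem IsTL.apply_pathVec_valley (hT : IsTL n b E f) (hh : IsPath n b h) {i : ℕ} (hin : i + 1 < n)
    (hp : IsValley h i) : E i (pathVec n b E f h) = pathVec n b E f (pathUp h i) := by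
  have h1 := hT.pathVec_peak (hh.up hin hp) (isPeak_pathUp hp) (by
    rw [pathUp_self]
    have := hh.le (i + 1)
    omega)
  rw [h1, pathDown_pathUp]

/-- If `i` has a peak after flipping the adjacent peak `j`, then `E i` undoes the flip. -/
theorem IsTL.apply_pathVec_adjacent (hT : IsTL n b E f) (hh : IsPath n b h) {i j : ℕ}
    (hin : i + 1 < n) (hij : i + 1 = j ∨ j + 1 = i) (hp : IsPeak h j)
    (hj : lowPath b (j + 1) < h (j + 1)) (hp' : IsPeak (pathDown h j) i) :
    E i (pathVec n b E f h) = pathVec n b E f (pathDown h j) := by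
  have h1 := hT.apply_pathVec_peak (hh.down hp hj) hin hp'
  have h2 := hT.braid i j hin (hh.lt_of_lt hj) hij (pathVec n b E f (pathDown h j))
  rw [h1, map_smul, map_smul, ← hT.pathVec_peak hh hp hj] at h2
  exact (smul_right_injective V (two_ne_zero (α := ℝ))) h2

/-- `E i` maps path vectors to non-negative multiples of path vectors, in a way that only depends
on the path. -/
theorem exists_apply_pathVec_of_not_valley (hh : IsPath n b h) {i : ℕ} (hin : i + 1 < n)
    (hv : ¬ IsValley h i) :
    ∃ (c : ℝ) (h' : ℕ → ℤ), 0 ≤ c ∧ IsPath n b h' ∧ pathArea n b h' ≤ pathArea n b h ∧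
      ∀ (V : Type) [AddCommGroup V] [Module ℝ V] (E : ℕ → V →ₗ[ℝ] V) (f : V), IsTL n b E f →
        E i (pathVec n b E f h) = c • pathVec n b E f h' := by
  induction hk : pathArea n b h using Nat.strong_induction_on generalizing h i with
  | _ N ih =>
    have s1 := hh.step i
    have s2 := hh.step (i + 1)
    rw [show i + 1 + 1 = i + 2 by ring] at s2
    by_cases hp : IsPeak h i
    · exact ⟨2, h, by norm_num, hh, hk.le, fun V _ _ E f hT => hT.apply_pathVec_peak hh hin hp⟩
    -- Next to a peak `j`, in the absence of a valley at `i`, both steps around `i` go the same way.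
    -- Flipping `j` then creates a peak at `i`, and the braid relation applies.
    by_cases hadj : ∃ j, (i + 1 = j ∨ j + 1 = i) ∧ IsPeak h j
    · obtain ⟨j, hij, hpj⟩ := hadj
      obtain ⟨hj, hp'⟩ : lowPath b (j + 1) < h (j + 1) ∧ IsPeak (pathDown h j) i := by
        rcases hij with rfl | rfl
        · have hl1 := hh.le i
          have hl2 := hh.le (i + 1 + 2)
          have l0 := lowPath_nonneg b i
          have l1 := lowPath_succ b i
          have l2 := lowPath_succ b (i + 1)
          have l3 := lowPath_succ b (i + 1 + 1)
          obtain ⟨q1, q2⟩ := hpj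
          rw [show i + 1 + 1 + 1 = i + 1 + 2 by ring] at l3
          rw [show i + 2 = i + 1 + 1 by ring] at s2
          have hup : h (i + 1) = h i + 1 := by
            by_contra h'
            refine hv ⟨by omega, ?_⟩
            rw [show i + 2 = i + 1 + 1 by ring]
            omega
          refine ⟨by omega, ?_, ?_⟩
          · rw [pathDown_of_ne h (by omega), pathDown_of_ne h (by omega)]
            omega
          · rw [show i + 2 = i + 1 + 1 by ring, pathDown_self, pathDown_of_ne h (by omega)]
            omega
        · obtain ⟨q1, q2⟩ := hpj
          rw [show j + 1 + 1 = j + 2 by ring] at s1 s2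
          have hdn : h (j + 3) = h (j + 2) - 1 := by
            by_contra h'
            refine hv ⟨?_, ?_⟩
            · rw [show j + 1 + 1 = j + 2 by ring]; omega
            · rw [show j + 1 + 1 = j + 2 by ring, show j + 1 + 2 = j + 3 by ring] at *; omega
          have hl := hh.le (j + 1 + 2)
          have l1 := lowPath_add_two b (j + 1)
          refine ⟨?_, ?_, ?_⟩
          · rw [show j + 1 + 2 = j + 3 by ring] at *; omega
          · rw [pathDown_self, pathDown_of_ne h (by omega), show j + 1 + 1 = j + 2 by ring]
            omega
          · rw [pathDown_of_ne h (by omega), pathDown_of_ne h (by omega),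
              show j + 1 + 1 = j + 2 by ring, show j + 1 + 2 = j + 3 by ring]
            omega
      have ha := hh.pathArea_down hj
      exact ⟨1, pathDown h j, zero_le_one, hh.down hpj hj, by omega, fun V _ _ E f hT => by
        rw [one_smul]; exact hT.apply_pathVec_adjacent hh hin hij hpj hj hp'⟩
    · by_cases hgood : ∃ k, IsGood b h k
      · obtain ⟨k, hg⟩ := hgood
        have hik : i ≠ k := fun e => hp (e ▸ hg.1)
        have hfar : i + 1 < k ∨ k + 1 < i := by
          by_contra h'
          exact hadj ⟨k, by omega, hg.1⟩
        have hkn := hh.lt_of_lt hg.2.1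
        have hd := hh.down hg.1 hg.2.1
        have ha := hh.pathArea_down hg.2.1
        -- `E i` commutes past the outermost `E k` and acts on a path of smaller area. The area
        -- bound in the statement then lets `E k` be reapplied, either by filling a valley or by a
        -- second use of induction.
        obtain ⟨c, h1, hc, hh1, ha1, hE1⟩ := ih _ (by omega) hd hin (by
          unfold IsValley
          rw [pathDown_of_ne h (by omega), pathDown_of_ne h (by omega),
            pathDown_of_ne h (by omega)]
          exact hv) rfl
        have key : ∀ (V : Type) [AddCommGroup V] [Module ℝ V] (E : ℕ → V →ₗ[ℝ] V) (f : V),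
            IsTL n b E f → E i (pathVec n b E f h) = c • E k (pathVec n b E f h1) := by
          intro V _ _ E f hT
          rw [hT.pathVec_peak hh hg.1 hg.2.1, hT.comm_of_far hin hkn hfar, hE1 V E f hT, map_smul]
        by_cases hv1 : IsValley h1 k
        · have ha2 := hh1.pathArea_up hkn hv1
          exact ⟨c, pathUp h1 k, hc, hh1.up hkn hv1, by omega, fun V _ _ E f hT => by
            rw [key V E f hT, hT.apply_pathVec_valley hh1 hkn hv1]⟩
        · obtain ⟨c', h2, hc', hh2, ha2, hE2⟩ := ih _ (by omega) hh1 hkn hv1 rfl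
          exact ⟨c * c', h2, mul_nonneg hc hc', hh2, by omega, fun V _ _ E f hT => by
            rw [key V E f hT, hE2 V E f hT, smul_smul]⟩
      -- Now `h` is the lowest path and no peak is at or next to `i`, so `i` lies in the final
      -- rising part, where `E i` kills `f`.
      · refine ⟨0, h, le_rfl, hh, hk.le, fun V _ _ E f hT => ?_⟩
        rw [zero_smul]
        rcases pathVec_eq E f hh with ⟨k, hg, _⟩ | ⟨hlow, e⟩
        · exact absurd ⟨k, hg⟩ hgood
        · rw [e]
          refine hT.cap i ?_ hin
          have l1 := lowPath_succ b i
          have l2 := lowPath_succ b (i + 1)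
          rw [show i + 1 + 1 = i + 2 by ring] at l2
          simp only [IsPeak, IsValley, hlow] at hp hv s1 s2
          by_contra hb
          unfold lowPath at *
          split_ifs at * <;> omega

theorem exists_apply_pathVec (hh : IsPath n b h) {i : ℕ} (hin : i + 1 < n) :
    ∃ (c : ℝ) (h' : ℕ → ℤ), 0 ≤ c ∧ IsPath n b h' ∧
      ∀ (V : Type) [AddCommGroup V] [Module ℝ V] (E : ℕ → V →ₗ[ℝ] V) (f : V), IsTL n b E f →
        E i (pathVec n b E f h) = c • pathVec n b E f h' := by
  by_cases hv : IsValley h i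
  · exact ⟨1, pathUp h i, zero_le_one, hh.up hin hv, fun V _ _ E f hT => by
      rw [one_smul]; exact hT.apply_pathVec_valley hh hin hv⟩
  · obtain ⟨c, h', hc, hh', _, hE⟩ := exists_apply_pathVec_of_not_valley hh hin hv
    exact ⟨c, h', hc, hh', hE⟩

/-- A set of vectors containing `f` and closed under `E j` on the image of `E i` for adjacent `i, j`
contains all path vectors. -/
theorem IsTL.pathVec_mem (hT : IsTL n b E f) {S : Set V} (hf : f ∈ S)
    (hS : ∀ i, i + 2 < n → ∀ v ∈ S, E i v = (2 : ℝ) • v → E (i + 1) v ∈ S) (hh : IsPath n b h) :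
    pathVec n b E f h ∈ S := by
  induction hk : pathArea n b h using Nat.strong_induction_on generalizing h with
  | _ N ih =>
    rcases pathVec_eq E f hh with ⟨k, hg, e⟩ | ⟨_, e⟩
    · rw [e]
      obtain ⟨hp, hlow, hk0, hstep⟩ := hg
      obtain ⟨k, rfl⟩ : ∃ k', k = k' + 1 := ⟨k - 1, by omega⟩
      have ha := hh.pathArea_down hlow
      have hkn := hh.lt_of_lt hlow
      rw [Nat.add_sub_cancel] at hstep
      refine hS k hkn _ (ih _ (by omega) (hh.down hp hlow) rfl)
        (hT.apply_pathVec_peak (hh.down hp hlow) (by omega) ⟨?_, ?_⟩)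
      · rw [pathDown_of_ne h (by omega), pathDown_of_ne h (by omega)]
        omega
      · rw [show k + 2 = k + 1 + 1 by ring, pathDown_self, pathDown_of_ne h (by omega)]
        have := hp.1
        omega
    · rw [e]; exact hf

theorem isPath_lowPath (n b : ℕ) : IsPath n b (lowPath b) where
  zero := lowPath_zero b
  step j := by have := lowPath_succ b j; omega
  le _ := le_rfl
  eq _ _ := rfl

theorem pathVec_lowPath (n b : ℕ) (E : ℕ → V →ₗ[ℝ] V) (f : V) :
    pathVec n b E f (lowPath b) = f := by
  rcases pathVec_eq E f (isPath_lowPath n b) with ⟨k, hg, _⟩ | ⟨_, e⟩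
  · exact absurd hg.2.1 (lt_irrefl _)
  · exact e

end Paths

/-! ### Specht modules: the invariant form and polytabloids -/

section SpechtForm

variable {μ : YoungDiagram} {n : ℕ}

instance : Finite (Tabloid μ n) := inferInstanceAs (Finite (Quotient _))

instance : Fintype (Tabloid μ n) := Fintype.ofFinite _

/-- The invariant inner product of the Specht module. -/
def spechtForm (μ : YoungDiagram) (n : ℕ) : LinearMap.BilinForm ℝ (specht μ n) :=
  LinearMap.mk₂ ℝ (fun f g => ∑ t, f.1 t * g.1 t)
    (fun f f' g => by simp [add_mul, Finset.sum_add_distrib])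
    (fun c f g => by simp [mul_assoc, Finset.mul_sum])
    (fun f g g' => by simp [mul_add, Finset.sum_add_distrib])
    (fun c f g => by simp [mul_left_comm, Finset.mul_sum])

theorem spechtForm_apply (f g : specht μ n) : spechtForm μ n f g = ∑ t, f.1 t * g.1 t := rfl

theorem spechtForm_comm (f g : specht μ n) : spechtForm μ n f g = spechtForm μ n g f := by
  simp only [spechtForm_apply, mul_comm]

theorem eq_zero_of_spechtForm_self {f : specht μ n} (h : spechtForm μ n f f = 0) : f = 0 := by
  rw [spechtForm_apply, Finset.sum_eq_zero_iff_of_nonneg fun t _ => mul_self_nonneg _] at h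
  refine Subtype.ext (funext fun t => ?_)
  exact mul_self_eq_zero.1 (h t (Finset.mem_univ t))

theorem spechtAct_val (σ : Sym n) (f : specht μ n) (t : Tabloid μ n) :
    (spechtAct μ σ f).1 t = f.1 (Tabloid.act σ⁻¹ t) := rfl

theorem spechtAct_one (f : specht μ n) : spechtAct μ 1 f = f :=
  Subtype.ext (funext fun t => by rw [spechtAct_val, inv_one, Tabloid.act_one])

theorem spechtAct_mul (σ τ : Sym n) (f : specht μ n) :
    spechtAct μ (σ * τ) f = spechtAct μ σ (spechtAct μ τ f) :=
  Subtype.ext (funext fun t => by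
    rw [spechtAct_val, spechtAct_val, spechtAct_val, mul_inv_rev, Tabloid.act_mul])

/-- The permutation of the tabloids induced by `σ`. -/
def tabloidEquiv (σ : Sym n) : Tabloid μ n ≃ Tabloid μ n where
  toFun := Tabloid.act σ
  invFun := Tabloid.act σ⁻¹
  left_inv t := by rw [← Tabloid.act_mul, inv_mul_cancel, Tabloid.act_one]
  right_inv t := by rw [← Tabloid.act_mul, mul_inv_cancel, Tabloid.act_one]

theorem spechtForm_act (σ : Sym n) (f g : specht μ n) :
    spechtForm μ n (spechtAct μ σ f) (spechtAct μ σ g) = spechtForm μ n f g := by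
  rw [spechtForm_apply, spechtForm_apply]
  exact Fintype.sum_equiv (tabloidEquiv σ⁻¹) _ _ fun t => rfl

theorem spechtAct_adj_self (i : ℕ) (f : specht μ n) :
    spechtAct μ (adj n i) (spechtAct μ (adj n i) f) = f := by
  rw [← spechtAct_mul, adj_mul_self, spechtAct_one]

theorem spechtForm_adj (i : ℕ) (f g : specht μ n) :
    spechtForm μ n (spechtAct μ (adj n i) f) g = spechtForm μ n f (spechtAct μ (adj n i) g) := by
  rw [← spechtForm_act (adj n i) f, spechtAct_adj_self]

/-- The operator `1 + s_i` on the Specht module. -/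
def spechtE (μ : YoungDiagram) (n i : ℕ) : specht μ n →ₗ[ℝ] specht μ n :=
  LinearMap.id + spechtAct μ (adj n i)

theorem spechtE_apply (i : ℕ) (f : specht μ n) :
    spechtE μ n i f = f + spechtAct μ (adj n i) f := rfl

theorem spechtForm_spechtE (i : ℕ) (f g : specht μ n) :
    spechtForm μ n (spechtE μ n i f) g = spechtForm μ n f (spechtE μ n i g) := by
  rw [spechtE_apply, spechtE_apply, map_add, map_add, LinearMap.add_apply, spechtForm_adj]

theorem spechtE_eq_two_smul_iff {i : ℕ} {f : specht μ n} :
    spechtE μ n i f = (2 : ℝ) • f ↔ spechtAct μ (adj n i) f = f := by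
  rw [spechtE_apply, two_smul, add_right_inj]

theorem spechtE_sq (i : ℕ) (f : specht μ n) :
    spechtE μ n i (spechtE μ n i f) = (2 : ℝ) • spechtE μ n i f := by
  rw [spechtE_eq_two_smul_iff, spechtE_apply, map_add, spechtAct_adj_self, add_comm]

theorem spechtAct_comm {i j : ℕ} (h : i + 1 < j) (f : specht μ n) :
    spechtAct μ (adj n i) (spechtAct μ (adj n j) f) =
      spechtAct μ (adj n j) (spechtAct μ (adj n i) f) := by
  rw [← spechtAct_mul, adj_comm h, spechtAct_mul]

theorem spechtE_comm {i j : ℕ} (h : i + 1 < j) (f : specht μ n) :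
    spechtE μ n i (spechtE μ n j f) = spechtE μ n j (spechtE μ n i f) := by
  simp only [spechtE_apply, map_add, spechtAct_comm h]
  abel

/-- The polytabloid of `T` as an element of the Specht module. -/
def poly (T : Tableau μ n) : specht μ n := ⟨polytabloid T, Submodule.subset_span ⟨T, rfl⟩⟩

theorem spechtAct_poly (σ : Sym n) (T : Tableau μ n) :
    spechtAct μ σ (poly T) = poly (T.trans σ) := Subtype.ext (permRep_polytabloid σ T)

theorem spechtE_poly (i : ℕ) (T : Tableau μ n) :
    spechtE μ n i (poly T) = poly T + poly (T.trans (adj n i)) := by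
  rw [spechtE_apply, spechtAct_poly]

theorem specht_induction {p : specht μ n → Prop} (hp : ∀ T, p (poly T)) (h0 : p 0)
    (hadd : ∀ f g, p f → p g → p (f + g)) (hsmul : ∀ (c : ℝ) f, p f → p (c • f)) (f : specht μ n) :
    p f := by
  obtain ⟨f, hf⟩ := f
  induction hf using Submodule.span_induction with
  | mem x hx => obtain ⟨T, rfl⟩ := hx; exact hp T
  | zero => exact h0
  | add x y hx hy h1 h2 => exact hadd ⟨x, hx⟩ ⟨y, hy⟩ h1 h2
  | smul c x hx h => exact hsmul c ⟨x, hx⟩ h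

theorem eq_zero_of_spechtForm_poly {f : specht μ n} (h : ∀ T, spechtForm μ n f (poly T) = 0) :
    f = 0 := by
  refine eq_zero_of_spechtForm_self (specht_induction (p := fun g => spechtForm μ n f g = 0)
    h (map_zero _) (fun g g' hg hg' => ?_) (fun c g hg => ?_) f)
  · rw [map_add, hg, hg', add_zero]
  · rw [map_smul, hg, smul_zero]

theorem colOf_trans (T : Tableau μ n) (σ : Sym n) (k : Fin n) :
    colOf (T.trans σ) k = colOf T (σ⁻¹ k) := rfl

theorem rowOf_trans (T : Tableau μ n) (σ : Sym n) (k : Fin n) :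
    rowOf (T.trans σ) k = rowOf T (σ⁻¹ k) := rfl

theorem poly_trans_of_col {T : Tableau μ n} {τ : Sym n} (hτ : ∀ k, colOf T (τ k) = colOf T k) :
    poly (T.trans τ) = ((Equiv.Perm.sign τ : ℤ) : ℝ) • poly T := by
  classical
  refine Subtype.ext ?_
  change polytabloid (T.trans τ) = ((Equiv.Perm.sign τ : ℤ) : ℝ) • polytabloid T
  rw [← permRep_polytabloid]
  unfold polytabloid
  rw [map_sum, Finset.smul_sum]
  refine Fintype.sum_equiv (Equiv.mulLeft τ) _ _ fun σ => ?_
  simp only [Equiv.coe_mulLeft, Equiv.Perm.mul_apply, hτ]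
  split_ifs
  · rw [map_smul, ← Module.End.mul_apply, ← map_mul, smul_smul, Equiv.Perm.sign_mul]
    congr 1
    rcases Int.units_eq_one_or (Equiv.Perm.sign τ) with h | h <;> simp [h]
  · rw [map_zero, smul_zero]

theorem poly_trans_swap {T : Tableau μ n} {k l : Fin n} (hkl : k ≠ l) (h : colOf T k = colOf T l) :
    poly (T.trans (Equiv.swap k l)) = -poly T := by
  rw [poly_trans_of_col, Equiv.Perm.sign_swap hkl]
  · have h1 : (((-1 : ℤˣ) : ℤ) : ℝ) = -1 := by simp
    rw [h1]
    exact neg_one_smul ℝ (poly T)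
  · intro j
    rw [Equiv.swap_apply_def]
    split_ifs with h1 h2
    · rw [h1, h]
    · rw [h2, h]
    · rfl

theorem poly_trans_adj {T : Tableau μ n} {i : ℕ} (hi : i + 1 < n)
    (h : colOf T ⟨i, Nat.lt_of_succ_lt hi⟩ = colOf T ⟨i + 1, hi⟩) :
    poly (T.trans (adj n i)) = -poly T := by
  rw [adj_eq hi]
  exact poly_trans_swap (by simp) h

/-- A vector fixed by `s_i` is orthogonal to the polytabloids with `i, i+1` in the same column. -/
theorem spechtForm_poly_eq_zero {f : specht μ n} {i : ℕ} (hf : spechtAct μ (adj n i) f = f)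
    {T : Tableau μ n} (hi : i + 1 < n)
    (h : colOf T ⟨i, Nat.lt_of_succ_lt hi⟩ = colOf T ⟨i + 1, hi⟩) :
    spechtForm μ n f (poly T) = 0 := by
  have h1 := spechtForm_adj i f (poly T)
  rw [hf, spechtAct_poly, poly_trans_adj hi h, map_neg] at h1
  linarith

theorem spechtForm_trans_adj {f : specht μ n} {i : ℕ} (hf : spechtAct μ (adj n i) f = f)
    (T : Tableau μ n) :
    spechtForm μ n f (poly (T.trans (adj n i))) = spechtForm μ n f (poly T) := by
  rw [← spechtAct_poly, ← spechtForm_adj, hf]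

end SpechtForm

/-! ### Specht modules of two-column shape -/

section TwoColumn

variable {μ : YoungDiagram} {n : ℕ}

theorem colOf_lt_two (hμ : μ.rowLen 0 ≤ 2) (T : Tableau μ n) (k : Fin n) : colOf T k < 2 := by
  have h := (T.symm k).2
  rw [YoungDiagram.mem_cells] at h
  have h1 := YoungDiagram.mem_iff_lt_rowLen.1 (show ((T.symm k).1.1, (T.symm k).1.2) ∈ μ from h)
  exact h1.trans_le ((μ.rowLen_anti 0 _ (Nat.zero_le _)).trans hμ)

theorem colLen_add_colLen (hμ : μ.rowLen 0 ≤ 2) : μ.colLen 0 + μ.colLen 1 = μ.card := by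
  rw [YoungDiagram.colLen_eq_card, YoungDiagram.colLen_eq_card, YoungDiagram.card,
    ← Finset.card_union_of_disjoint]
  · congr 1
    ext ⟨i, j⟩
    simp only [Finset.mem_union, YoungDiagram.mem_col_iff, YoungDiagram.mem_cells]
    constructor
    · rintro (h | h) <;> exact h.1
    · intro h
      have h1 := YoungDiagram.mem_iff_lt_rowLen.1 h
      have := (μ.rowLen_anti 0 i (Nat.zero_le _)).trans hμ
      rcases (show j = 0 ∨ j = 1 by omega) with rfl | rfl
      · exact Or.inl ⟨h, rfl⟩
      · exact Or.inr ⟨h, rfl⟩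
  · rw [Finset.disjoint_left]
    rintro ⟨i, j⟩ h1 h2
    rw [YoungDiagram.mem_col_iff] at h1 h2
    have := h1.2
    have := h2.2
    simp_all

theorem two_mul_colLen_le (hn : μ.card = n) (hμ : μ.rowLen 0 ≤ 2) : 2 * μ.colLen 1 ≤ n := by
  have := colLen_add_colLen hμ
  have := μ.colLen_anti 0 1 (by omega)
  omega

/-- The sum over the `S_3` permuting `i, i+1, i+2` equals `E i E (i+1) E i - E i`. Two of these
entries share a column, and their transposition negates the polytabloid, so the six terms cancel in
pairs. -/
theorem spechtE_braid_aux (hμ : μ.rowLen 0 ≤ 2) {i : ℕ} (hi : i + 2 < n) (f : specht μ n) :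
    f + spechtAct μ (adj n i) f + spechtAct μ (adj n (i + 1)) f +
      spechtAct μ (adj n i) (spechtAct μ (adj n (i + 1)) f) +
      spechtAct μ (adj n (i + 1)) (spechtAct μ (adj n i) f) +
      spechtAct μ (adj n i) (spechtAct μ (adj n (i + 1)) (spechtAct μ (adj n i) f)) = 0 := by
  refine specht_induction (p := fun f => f + spechtAct μ (adj n i) f + spechtAct μ (adj n (i + 1)) f +
      spechtAct μ (adj n i) (spechtAct μ (adj n (i + 1)) f) +
      spechtAct μ (adj n (i + 1)) (spechtAct μ (adj n i) f) +
      spechtAct μ (adj n i) (spechtAct μ (adj n (i + 1)) (spechtAct μ (adj n i) f)) = 0)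
    (fun T => ?_) ?_ (fun f g hf hg => ?_) (fun c f hf => ?_) f
  · have hi1 : i + 1 < n := by omega
    have hconj : adj n i * adj n (i + 1) * adj n i = Equiv.swap ⟨i, by omega⟩ ⟨i + 2, hi⟩ := by
      refine Equiv.ext fun k => Fin.ext ?_
      simp only [Equiv.Perm.mul_apply, adj_val hi1, adj_val hi, Equiv.swap_apply_def, Fin.ext_iff,
        apply_ite Fin.val]
      split_ifs <;> omega
    have hconj' : adj n (i + 1) * adj n i * adj n (i + 1) = Equiv.swap ⟨i, by omega⟩ ⟨i + 2, hi⟩ := by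
      refine Equiv.ext fun k => Fin.ext ?_
      simp only [Equiv.Perm.mul_apply, adj_val hi1, adj_val hi, Equiv.swap_apply_def, Fin.ext_iff,
        apply_ite Fin.val]
      split_ifs <;> omega
    have e1 : ∀ g : specht μ n, spechtAct μ (adj n i)
        (spechtAct μ (adj n (i + 1)) (spechtAct μ (adj n i) g)) =
        spechtAct μ (Equiv.swap ⟨i, by omega⟩ ⟨i + 2, hi⟩) g := fun g => by
      rw [← hconj, spechtAct_mul, spechtAct_mul]
    have e2 : ∀ g : specht μ n, spechtAct μ (adj n (i + 1))
        (spechtAct μ (adj n i) (spechtAct μ (adj n (i + 1)) g)) =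
        spechtAct μ (Equiv.swap ⟨i, by omega⟩ ⟨i + 2, hi⟩) g := fun g => by
      rw [← hconj', spechtAct_mul, spechtAct_mul]
    have c0 := colOf_lt_two hμ T ⟨i, by omega⟩
    have c1 := colOf_lt_two hμ T ⟨i + 1, hi1⟩
    have c2 := colOf_lt_two hμ T ⟨i + 2, hi⟩
    rcases (show colOf T ⟨i, by omega⟩ = colOf T ⟨i + 1, hi1⟩ ∨
        colOf T ⟨i + 1, hi1⟩ = colOf T ⟨i + 2, hi⟩ ∨
        colOf T ⟨i, by omega⟩ = colOf T ⟨i + 2, hi⟩ by omega) with h | h | h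
    · have h1 : spechtAct μ (adj n i) (poly T) = -poly T := by
        rw [spechtAct_poly, poly_trans_adj hi1 h]
      rw [h1]
      simp only [map_neg]
      abel
    · have h1 : spechtAct μ (adj n (i + 1)) (poly T) = -poly T := by
        rw [spechtAct_poly, poly_trans_adj hi h]
      rw [e1, ← e2, h1]
      simp only [map_neg]
      abel
    · have h1 : spechtAct μ (Equiv.swap ⟨i, by omega⟩ ⟨i + 2, hi⟩) (poly T) = -poly T := by
        rw [spechtAct_poly, poly_trans_swap (by simp) h]
      have h2 : spechtAct μ (adj n (i + 1)) (spechtAct μ (adj n i) (poly T)) =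
          -spechtAct μ (adj n i) (poly T) := by
        rw [← spechtAct_adj_self i (spechtAct μ (adj n (i + 1)) _), e1, h1, map_neg]
      have h3 : spechtAct μ (adj n i) (spechtAct μ (adj n (i + 1)) (poly T)) =
          -spechtAct μ (adj n (i + 1)) (poly T) := by
        rw [← spechtAct_adj_self (i + 1) (spechtAct μ (adj n i) _), e2, h1, map_neg]
      rw [e1, h1, h2, h3]
      abel
  · simp only [map_zero, add_zero]
  · simp only [map_add]
    rw [← add_zero (0 : specht μ n)]
    nth_rewrite 1 [← hf]
    rw [← hg]
    abel
  · simp only [map_smul, ← smul_add, hf, smul_zero]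

theorem spechtAct_adj_braid {i : ℕ} (hi : i + 2 < n) (f : specht μ n) :
    spechtAct μ (adj n (i + 1)) (spechtAct μ (adj n i) (spechtAct μ (adj n (i + 1)) f)) =
      spechtAct μ (adj n i) (spechtAct μ (adj n (i + 1)) (spechtAct μ (adj n i) f)) := by
  have hi1 : i + 1 < n := by omega
  simp only [← spechtAct_mul]
  congr 2
  refine Equiv.ext fun k => Fin.ext ?_
  simp only [Equiv.Perm.mul_apply, adj_val hi1, adj_val hi]
  split_ifs <;> omega

theorem spechtE_braid (hμ : μ.rowLen 0 ≤ 2) {i j : ℕ} (hi : i + 1 < n) (hj : j + 1 < n)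
    (hij : i + 1 = j ∨ j + 1 = i) (f : specht μ n) :
    spechtE μ n i (spechtE μ n j (spechtE μ n i f)) = spechtE μ n i f := by
  rcases hij with rfl | rfl
  · have h := spechtE_braid_aux hμ hj f
    simp only [spechtE_apply, map_add, spechtAct_adj_self]
    rw [← sub_eq_zero, ← h]
    abel
  · have h := spechtE_braid_aux hμ hi f
    simp only [spechtE_apply, map_add, spechtAct_adj_self, spechtAct_adj_braid hi]
    rw [← sub_eq_zero, ← h]
    abel

/-! ### Column paths of tableaux -/

/-- The step at `k` of the lattice path of the columns of `T`. -/
def colStep (T : Tableau μ n) (k : ℕ) : ℤ :=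
  -- The default `1` beyond `n` matches the rising tail of `lowPath`.
  if h : k < n then (if colOf T ⟨k, h⟩ = 0 then 1 else -1) else 1

/-- The lattice path which goes up at the entries of the first column of `T` and down at the
others. -/
def colPath (T : Tableau μ n) (j : ℕ) : ℤ := ∑ k ∈ Finset.range j, colStep T k

theorem colPath_succ (T : Tableau μ n) (j : ℕ) : colPath T (j + 1) = colPath T j + colStep T j :=
  Finset.sum_range_succ ..

theorem colStep_eq_or (T : Tableau μ n) (k : ℕ) : colStep T k = 1 ∨ colStep T k = -1 := by
  unfold colStep
  split_ifs <;> simp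

theorem colPath_sub_le (T : Tableau μ n) {j k : ℕ} (h : j ≤ k) :
    colPath T k ≤ colPath T j + (k - j) := by
  obtain ⟨m, rfl⟩ := Nat.exists_eq_add_of_le h
  induction m with
  | zero => simp
  | succ m ih =>
    have := colStep_eq_or T (j + m)
    have := ih (by omega)
    rw [← add_assoc, colPath_succ]
    push_cast at *
    omega

theorem colOf_eq_of_colStep_eq (hμ : μ.rowLen 0 ≤ 2) {T T' : Tableau μ n} {k l : ℕ} (hk : k < n)
    (hl : l < n) (h : colStep T k = colStep T' l) : colOf T ⟨k, hk⟩ = colOf T' ⟨l, hl⟩ := by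
  have h1 := colOf_lt_two hμ T ⟨k, hk⟩
  have h2 := colOf_lt_two hμ T' ⟨l, hl⟩
  rw [colStep, colStep, dif_pos hk, dif_pos hl] at h
  split_ifs at h <;> omega

theorem card_colOf (T : Tableau μ n) :
    (Finset.univ.filter fun k : Fin n => colOf T k = 1).card = μ.colLen 1 := by
  rw [YoungDiagram.colLen_eq_card]
  refine Finset.card_bij (fun k _ => (T.symm k).1) (fun k hk => ?_) (fun k _ l _ h => ?_)
    (fun c hc => ?_)
  · rw [YoungDiagram.mem_col_iff]
    exact ⟨(T.symm k).2, (Finset.mem_filter.1 hk).2⟩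
  · exact T.symm.injective (Subtype.ext h)
  · rw [YoungDiagram.mem_col_iff] at hc
    refine ⟨T ⟨c, hc.1⟩, ?_, by simp⟩
    refine Finset.mem_filter.2 ⟨Finset.mem_univ _, ?_⟩
    rw [colOf, Equiv.symm_apply_apply]
    exact hc.2

theorem colPath_end (hμ : μ.rowLen 0 ≤ 2) (T : Tableau μ n) :
    colPath T n = n - 2 * μ.colLen 1 := by
  have h : colPath T n = ∑ k : Fin n, if colOf T k = 0 then (1 : ℤ) else -1 := by
    rw [colPath, Finset.sum_range]
    refine Finset.sum_congr rfl fun k _ => ?_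
    rw [colStep, dif_pos k.2]
  have h2 : ∀ k : Fin n, (if colOf T k = 0 then (1 : ℤ) else -1) =
      1 - 2 * (if colOf T k = 1 then 1 else 0) := by
    intro k
    have := colOf_lt_two hμ T k
    split_ifs <;> omega
  simp only [h, h2, Finset.sum_sub_distrib, ← Finset.mul_sum, Finset.sum_boole, card_colOf]
  simp

theorem colStep_trans_adj (T : Tableau μ n) {i : ℕ} (hi : i + 1 < n) (k : ℕ) :
    colStep (T.trans (adj n i)) k =
      colStep T (if k = i then i + 1 else if k = i + 1 then i else k) := by
  unfold colStep
  by_cases hk : k < n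
  · have hk' : (if k = i then i + 1 else if k = i + 1 then i else k) < n := by
      split_ifs <;> omega
    rw [dif_pos hk, dif_pos hk', colOf_trans, adj_inv]
    congr 3
    exact Fin.ext (adj_val hi _)
  · rw [dif_neg hk, if_neg (by omega), if_neg (by omega), dif_neg hk]

theorem colPath_trans_adj (T : Tableau μ n) {i : ℕ} (hi : i + 1 < n) {j : ℕ} (hj : j ≠ i + 1) :
    colPath (T.trans (adj n i)) j = colPath T j := by
  have h1 : ∀ j ≤ i, colPath (T.trans (adj n i)) j = colPath T j := fun j hj =>
    Finset.sum_congr rfl fun k hk => by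
      have := Finset.mem_range.1 hk
      rw [colStep_trans_adj T hi, if_neg (by omega), if_neg (by omega)]
  rcases le_or_gt j i with h | h
  · exact h1 j h
  · obtain ⟨m, rfl⟩ := Nat.exists_eq_add_of_le (show i + 2 ≤ j by omega)
    clear hj h
    induction m with
    | zero =>
      rw [add_zero, colPath_succ, colPath_succ, colPath_succ, colPath_succ, h1 i le_rfl,
        colStep_trans_adj T hi, colStep_trans_adj T hi]
      simp
      ring
    | succ m ih =>
      rw [← add_assoc, colPath_succ, colPath_succ, ih, colStep_trans_adj T hi, if_neg (by omega),
        if_neg (by omega)]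

theorem trans_adj_trans_adj (T : Tableau μ n) (i : ℕ) :
    ((T.trans (adj n i)).trans (adj n i) : Tableau μ n) = T := by
  refine Equiv.ext fun c => ?_
  have := congrArg (fun σ : Sym n => σ (T c)) (adj_mul_self (n := n) i)
  simpa using this

/-! ### Cupped vectors -/

/-- `f` is fixed by `s_0, s_2, …, s_{2b-2}`, where `b` is the length of the second column. -/
def IsCupped (f : specht μ n) : Prop := ∀ k < μ.colLen 1, spechtAct μ (adj n (2 * k)) f = f

theorem IsCupped.colStep_ne (hn : μ.card = n) (hμ : μ.rowLen 0 ≤ 2) {f : specht μ n}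
    (hf : IsCupped f) {T : Tableau μ n} (hT : spechtForm μ n f (poly T) ≠ 0) {k : ℕ}
    (hk : k < μ.colLen 1) : colStep T (2 * k) ≠ colStep T (2 * k + 1) := by
  have := two_mul_colLen_le hn hμ
  intro h
  have hk1 : 2 * k + 1 < n := by omega
  exact hT (spechtForm_poly_eq_zero (hf k hk) hk1 (colOf_eq_of_colStep_eq hμ _ _ h))

theorem IsCupped.colPath_two_mul (hn : μ.card = n) (hμ : μ.rowLen 0 ≤ 2) {f : specht μ n}
    (hf : IsCupped f) {T : Tableau μ n} (hT : spechtForm μ n f (poly T) ≠ 0) {k : ℕ}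
    (hk : k ≤ μ.colLen 1) : colPath T (2 * k) = 0 := by
  induction k with
  | zero => rfl
  | succ k ih =>
    have h1 := hf.colStep_ne hn hμ hT (k := k) (by omega)
    have h2 := colStep_eq_or T (2 * k)
    have h3 := colStep_eq_or T (2 * k + 1)
    rw [show 2 * (k + 1) = 2 * k + 1 + 1 by ring, colPath_succ, colPath_succ, ih (by omega)]
    omega

/-- Each of the `b` pairs `2k, 2k+1` already uses one box of the second column, which is then full.
-/
theorem IsCupped.colStep_eq_one (hn : μ.card = n) (hμ : μ.rowLen 0 ≤ 2) {f : specht μ n}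
    (hf : IsCupped f) {T : Tableau μ n} (hT : spechtForm μ n f (poly T) ≠ 0) {i : ℕ}
    (hi : 2 * μ.colLen 1 ≤ i) : colStep T i = 1 := by
  by_cases hin : i < n
  · have h1 := hf.colPath_two_mul hn hμ hT le_rfl
    have h2 := colPath_end hμ T
    have h3 := colPath_sub_le T hi
    have h4 := colPath_sub_le T (show i + 1 ≤ n by omega)
    rw [colPath_succ] at h4
    have := colStep_eq_or T i
    push_cast at *
    omega
  · rw [colStep, dif_neg hin]

theorem IsCupped.eq_zero_of_fixed (hn : μ.card = n) (hμ : μ.rowLen 0 ≤ 2) {f : specht μ n}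
    (hf : IsCupped f) {i : ℕ} (hi : 2 * μ.colLen 1 ≤ i) (hin : i + 1 < n)
    (h : spechtAct μ (adj n i) f = f) : f = 0 := by
  refine eq_zero_of_spechtForm_poly fun T => ?_
  by_contra hT
  refine hT (spechtForm_poly_eq_zero h hin (colOf_eq_of_colStep_eq hμ _ _ ?_))
  rw [hf.colStep_eq_one hn hμ hT hi, hf.colStep_eq_one hn hμ hT (by omega)]

theorem exists_rowTableau (hn : μ.card = n) (hμ : μ.rowLen 0 ≤ 2) :
    ∃ T : Tableau μ n, (∀ k, k < 2 * μ.colLen 1 → colStep T k = if k % 2 = 0 then 1 else -1) ∧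
      (∀ k, k < μ.colLen 1 → ∀ (hk1 : 2 * k + 1 < n),
        rowOf T ⟨2 * k, by omega⟩ = rowOf T ⟨2 * k + 1, hk1⟩) := by
  have hab := colLen_add_colLen hμ
  have hba := μ.colLen_anti 0 1 (by omega)
  have hcol : ∀ c ∈ μ.cells, c.2 = 0 ∧ c.1 < μ.colLen 0 ∨ c.2 = 1 ∧ c.1 < μ.colLen 1 := by
    rintro ⟨i, j⟩ h
    rw [YoungDiagram.mem_cells] at h
    have h1 := YoungDiagram.mem_iff_lt_rowLen.1 h
    have h2 := YoungDiagram.mem_iff_lt_colLen.1 h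
    have := (μ.rowLen_anti 0 i (Nat.zero_le _)).trans hμ
    rcases (show j = 0 ∨ j = 1 by omega) with rfl | rfl
    · exact Or.inl ⟨rfl, h2⟩
    · exact Or.inr ⟨rfl, h2⟩
  -- Row `r < b` receives `2r, 2r+1`; the single box of a row `r ≥ b` receives `2b + (r - b) = b +
  -- r`.
  let g : ℕ × ℕ → ℕ := fun c =>
    if c.2 = 1 then 2 * c.1 + 1 else if c.1 < μ.colLen 1 then 2 * c.1 else μ.colLen 1 + c.1
  have hg : ∀ c ∈ μ.cells, g c < n := by
    intro c hc
    have := hcol c hc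
    simp only [g]
    split_ifs <;> omega
  let G : {c // c ∈ μ.cells} → Fin n := fun c => ⟨g c.1, hg c.1 c.2⟩
  have hG : Function.Bijective G := by
    rw [Fintype.bijective_iff_injective_and_card]
    constructor
    · intro c d h
      have h' : g c.1 = g d.1 := congrArg Fin.val h
      have h1 := hcol c.1 c.2
      have h2 := hcol d.1 d.2
      refine Subtype.ext (Prod.ext ?_ ?_)
      · simp only [g] at h'
        split_ifs at h' <;> omega
      · simp only [g] at h'
        split_ifs at h' <;> omega
    · rw [Fintype.card_coe, Fintype.card_fin]
      exact hn
  have hsymm : ∀ (c : {c // c ∈ μ.cells}) (k : Fin n), g c.1 = k.1 →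
      (Equiv.ofBijective G hG).symm k = c := by
    intro c k h
    rw [Equiv.symm_apply_eq]
    exact Fin.ext h.symm
  have m0 : ∀ k, k < μ.colLen 1 → (k, 0) ∈ μ.cells := fun k hk =>
    (YoungDiagram.mem_cells _).2 (YoungDiagram.mem_iff_lt_colLen.2 (by omega))
  have m1 : ∀ k, k < μ.colLen 1 → (k, 1) ∈ μ.cells := fun k hk =>
    (YoungDiagram.mem_cells _).2 (YoungDiagram.mem_iff_lt_colLen.2 hk)
  refine ⟨Equiv.ofBijective G hG, fun k hk => ?_, fun k hk hk1 => ?_⟩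
  · have hkn : k < n := by omega
    rw [colStep, dif_pos hkn, colOf]
    by_cases hp : k % 2 = 0
    · rw [hsymm ⟨(k / 2, 0), m0 _ (by omega)⟩ ⟨k, hkn⟩]
      · simp [hp]
      · have hk2 : k / 2 < μ.colLen 1 := by omega
        simp only [g]
        rw [if_neg zero_ne_one, if_pos hk2]
        omega
    · rw [hsymm ⟨(k / 2, 1), m1 _ (by omega)⟩ ⟨k, hkn⟩]
      · simp [hp]
      · simp only [g]
        rw [if_pos trivial]
        omega
  · rw [rowOf, rowOf, hsymm ⟨(k, 0), m0 k hk⟩, hsymm ⟨(k, 1), m1 k hk⟩]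
    · simp [g]
    · simp [g, hk]

/-- The tableau with rows `{0, 1}, {2, 3}, …` and then the remaining entries in order. -/
def rowTableau (hn : μ.card = n) (hμ : μ.rowLen 0 ≤ 2) : Tableau μ n :=
  (exists_rowTableau hn hμ).choose

theorem colStep_rowTableau (hn : μ.card = n) (hμ : μ.rowLen 0 ≤ 2) {k : ℕ}
    (hk : k < 2 * μ.colLen 1) :
    colStep (rowTableau hn hμ) k = if k % 2 = 0 then 1 else -1 :=
  (exists_rowTableau hn hμ).choose_spec.1 k hk

theorem rowOf_rowTableau (hn : μ.card = n) (hμ : μ.rowLen 0 ≤ 2) {k : ℕ} (hk : k < μ.colLen 1)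
    (hk1 : 2 * k + 1 < n) : rowOf (rowTableau hn hμ) ⟨2 * k, by omega⟩ =
      rowOf (rowTableau hn hμ) ⟨2 * k + 1, hk1⟩ :=
  (exists_rowTableau hn hμ).choose_spec.2 k hk hk1

theorem colPath_rowTableau_two_mul (hn : μ.card = n) (hμ : μ.rowLen 0 ≤ 2) {k : ℕ}
    (hk : k ≤ μ.colLen 1) : colPath (rowTableau hn hμ) (2 * k) = 0 := by
  induction k with
  | zero => rfl
  | succ k ih =>
    rw [show 2 * (k + 1) = 2 * k + 1 + 1 by ring, colPath_succ, colPath_succ, ih (by omega),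
      colStep_rowTableau hn hμ (by omega), colStep_rowTableau hn hμ (by omega), if_pos (by omega),
      if_neg (by omega)]
    ring

theorem colStep_rowTableau_of_le (hn : μ.card = n) (hμ : μ.rowLen 0 ≤ 2) {i : ℕ}
    (hi : 2 * μ.colLen 1 ≤ i) : colStep (rowTableau hn hμ) i = 1 := by
  by_cases hin : i < n
  · have h1 := colPath_rowTableau_two_mul hn hμ le_rfl
    have h2 := colPath_end hμ (rowTableau hn hμ)
    have h3 := colPath_sub_le (rowTableau hn hμ) hi
    have h4 := colPath_sub_le (rowTableau hn hμ) (show i + 1 ≤ n by omega)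
    rw [colPath_succ] at h4
    have := colStep_eq_or (rowTableau hn hμ) i
    push_cast at *
    omega
  · rw [colStep, dif_neg hin]

theorem colPath_rowTableau (hn : μ.card = n) (hμ : μ.rowLen 0 ≤ 2) (j : ℕ) :
    colPath (rowTableau hn hμ) j = lowPath (μ.colLen 1) j := by
  induction j with
  | zero => rw [lowPath_zero]; rfl
  | succ j ih =>
    rw [colPath_succ, ih]
    by_cases hj : j < 2 * μ.colLen 1
    · rw [colStep_rowTableau hn hμ hj]
      unfold lowPath
      split_ifs <;> omega
    · rw [colStep_rowTableau_of_le hn hμ (not_lt.1 hj)]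
      unfold lowPath
      split_ifs <;> omega

/-- Exchanging `2k` and `2k+1` does not change the pairing with `f`, so all `2k` may be moved into
the first column. The tableau then differs from `rowTableau` by a column permutation, which only
affects a sign. -/
theorem IsCupped.eq_zero (hn : μ.card = n) (hμ : μ.rowLen 0 ≤ 2) {f : specht μ n}
    (hf : IsCupped f) (h0 : spechtForm μ n f (poly (rowTableau hn hμ)) = 0) : f = 0 := by
  have hbn := two_mul_colLen_le hn hμ
  have key : ∀ j ≤ μ.colLen 1, ∀ T : Tableau μ n,
      (∀ k, j ≤ k → k < μ.colLen 1 → colStep T (2 * k) = 1) → spechtForm μ n f (poly T) = 0 := by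
    intro j
    induction j with
    | zero =>
      intro _ T hT
      by_contra hne
      have hstep : ∀ k, colStep T k = colStep (rowTableau hn hμ) k := by
        intro k
        by_cases hk : k < 2 * μ.colLen 1
        · have h1 := hf.colStep_ne hn hμ hne (k := k / 2) (by omega)
          have h2 := hT (k / 2) (Nat.zero_le _) (by omega)
          have h3 := colStep_eq_or T (2 * (k / 2) + 1)
          rw [colStep_rowTableau hn hμ hk]
          split_ifs with hp
          · rw [show k = 2 * (k / 2) by omega]; exact h2
          · rw [show k = 2 * (k / 2) + 1 by omega]; omega
        · rw [colStep_rowTableau_of_le hn hμ (not_lt.1 hk),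
            hf.colStep_eq_one hn hμ hne (not_lt.1 hk)]
      have hcol : ∀ k, colOf T k = colOf (rowTableau hn hμ) k := fun k =>
        colOf_eq_of_colStep_eq hμ k.2 k.2 (hstep k)
      set σ : Sym n := (rowTableau hn hμ).symm.trans T with hσ
      have hT' : T = (rowTableau hn hμ).trans σ := by
        refine Equiv.ext fun c => ?_
        simp [hσ]
      have hσc : ∀ k, colOf (rowTableau hn hμ) (σ k) = colOf (rowTableau hn hμ) k := by
        intro k
        rw [← hcol]
        simp [hσ, colOf]
      rw [hT', poly_trans_of_col hσc, map_smul, h0, smul_zero] at hne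
      exact hne rfl
    | succ j ih =>
      intro hj T hT
      by_cases hsj : colStep T (2 * j) = 1
      · refine ih (by omega) T fun k hk hkb => ?_
        rcases hk.eq_or_lt with rfl | hk
        exacts [hsj, hT k hk hkb]
      · by_contra hne
        have hj1 : 2 * j + 1 < n := by omega
        have h1 := hf.colStep_ne hn hμ hne (k := j) (by omega)
        have h2 := colStep_eq_or T (2 * j)
        have h3 := colStep_eq_or T (2 * j + 1)
        refine hne ?_
        rw [← spechtForm_trans_adj (hf j (by omega)) T]
        refine ih (by omega) _ fun k hk hkb => ?_
        rw [colStep_trans_adj T hj1]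
        rcases hk.eq_or_lt with rfl | hk
        · rw [if_pos rfl]; omega
        · rw [if_neg (by omega), if_neg (by omega)]
          exact hT k hk hkb
  exact eq_zero_of_spechtForm_poly fun T => key _ le_rfl T fun k hk hkb => absurd hkb (by omega)

/-- Cupped vectors form a space of dimension at most one. -/
theorem IsCupped.eq_smul (hn : μ.card = n) (hμ : μ.rowLen 0 ≤ 2) {f g : specht μ n}
    (hf : IsCupped f) (hf0 : f ≠ 0) (hg : IsCupped g) : ∃ c : ℝ, g = c • f := by
  have h0 : spechtForm μ n f (poly (rowTableau hn hμ)) ≠ 0 := fun h => hf0 (hf.eq_zero hn hμ h)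
  set c := spechtForm μ n g (poly (rowTableau hn hμ)) / spechtForm μ n f (poly (rowTableau hn hμ))
  refine ⟨c, sub_eq_zero.1 (IsCupped.eq_zero hn hμ (fun k hk => ?_) ?_)⟩
  · rw [map_sub, map_smul, hf k hk, hg k hk]
  · rw [map_sub, map_smul, LinearMap.sub_apply, LinearMap.smul_apply, smul_eq_mul,
      div_mul_cancel₀ _ h0, sub_self]

theorem IsCupped.isTL (hn : μ.card = n) (hμ : μ.rowLen 0 ≤ 2) {f : specht μ n}
    (hf : IsCupped f) : IsTL n (μ.colLen 1) (spechtE μ n) f where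
  sq i _ := spechtE_sq i
  comm i j h _ := spechtE_comm h
  braid i j hi hj hij := spechtE_braid hμ hi hj hij
  cup k hk := spechtE_eq_two_smul_iff.2 (hf k hk)
  -- `E i f` is again cupped, and fixed by `s_i` too. Any tableau pairing non-trivially with it has
  -- `i, i+1` both in the first column, which makes the pairing vanish.
  cap i hi hin := by
    refine IsCupped.eq_zero_of_fixed hn hμ (fun k hk => ?_) hi hin ?_
    · rw [← spechtE_eq_two_smul_iff]
      rcases (show 2 * k + 1 < i ∨ 2 * k + 1 = i by omega) with h | h
      · rw [spechtE_comm h, spechtE_eq_two_smul_iff.2 (hf k hk), map_smul]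
      · omega
    · rw [← spechtE_eq_two_smul_iff, spechtE_sq]

/-- The product of the operators `1 + s_{2k}`, `k < m`. -/
def cupProj (μ : YoungDiagram) (n : ℕ) : ℕ → specht μ n →ₗ[ℝ] specht μ n
  | 0 => LinearMap.id
  | m + 1 => spechtE μ n (2 * m) ∘ₗ cupProj μ n m

theorem spechtAct_cupProj (f : specht μ n) (m : ℕ) :
    ∀ k < m, spechtAct μ (adj n (2 * k)) (cupProj μ n m f) = cupProj μ n m f := by
  induction m with
  | zero => intro k hk; omega
  | succ m ih =>
    intro k hk
    change spechtAct μ (adj n (2 * k)) (spechtE μ n (2 * m) (cupProj μ n m f)) =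
      spechtE μ n (2 * m) (cupProj μ n m f)
    rw [← spechtE_eq_two_smul_iff]
    rcases (show k < m ∨ k = m by omega) with h | rfl
    · rw [spechtE_comm (by omega), spechtE_eq_two_smul_iff.2 (ih k h), map_smul]
    · exact spechtE_sq _ _

theorem isCupped_cupProj (f : specht μ n) : IsCupped (cupProj μ n (μ.colLen 1) f) :=
  spechtAct_cupProj f _

theorem cupProj_mem {S : Set (specht μ n)} (hbn : 2 * μ.colLen 1 ≤ n)
    (hS : ∀ i, i + 1 < n → ∀ f ∈ S, spechtE μ n i f ∈ S) {f : specht μ n} (hf : f ∈ S) {m : ℕ}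
    (hm : m ≤ μ.colLen 1) : cupProj μ n m f ∈ S := by
  induction m with
  | zero => exact hf
  | succ m ih => exact hS _ (by omega) _ (ih (by omega))

theorem act_rowTableau (hn : μ.card = n) (hμ : μ.rowLen 0 ≤ 2) {k : ℕ} (hk : k < μ.colLen 1) :
    Tabloid.act (adj n (2 * k)) (toTabloid (rowTableau hn hμ)) = toTabloid (rowTableau hn hμ) := by
  have hbn := two_mul_colLen_le hn hμ
  have hk1 : 2 * k + 1 < n := by omega
  have hrow := rowOf_rowTableau hn hμ hk hk1
  refine Quotient.sound (s := Setoid.ker (rowOf : Tableau μ n → Fin n → ℕ)) ?_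
  change rowOf ((rowTableau hn hμ).trans (adj n (2 * k))) = rowOf (rowTableau hn hμ)
  funext j
  rw [rowOf_trans, adj_inv]
  have hv := adj_val hk1 j
  split_ifs at hv with h1 h2
  · rw [show adj n (2 * k) j = ⟨2 * k + 1, hk1⟩ from Fin.ext hv,
      show j = ⟨2 * k, by omega⟩ from Fin.ext h1, hrow]
  · rw [show adj n (2 * k) j = ⟨2 * k, by omega⟩ from Fin.ext hv,
      show j = ⟨2 * k + 1, hk1⟩ from Fin.ext h2, hrow]
  · rw [show adj n (2 * k) j = j from Fin.ext hv]

/-- The row tabloid is fixed by every `s_{2k}`, so each factor doubles this coefficient. -/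
theorem cupProj_val (hn : μ.card = n) (hμ : μ.rowLen 0 ≤ 2) (f : specht μ n) {m : ℕ}
    (hm : m ≤ μ.colLen 1) : (cupProj μ n m f).1 (toTabloid (rowTableau hn hμ)) =
      2 ^ m * f.1 (toTabloid (rowTableau hn hμ)) := by
  induction m with
  | zero => simp [cupProj]
  | succ m ih =>
    change (cupProj μ n m f).1 _ + (spechtAct μ (adj n (2 * m)) (cupProj μ n m f)).1 _ = _
    rw [spechtAct_val, adj_inv, act_rowTableau hn hμ (by omega), ih (by omega)]
    ring

/-- A submodule annihilated by the product of all `1 + s_{2k}`, `k < b`, is zero. -/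
theorem eq_bot_of_cupProj (hn : μ.card = n) (hμ : μ.rowLen 0 ≤ 2) {N : Submodule ℝ (specht μ n)}
    (hN : ∀ i, i + 1 < n → ∀ f ∈ N, spechtE μ n i f ∈ N)
    (h0 : ∀ f ∈ N, cupProj μ n (μ.colLen 1) f = 0) : N = ⊥ := by
  have hval : ∀ f ∈ N, f.1 (toTabloid (rowTableau hn hμ)) = 0 := by
    intro f hf
    have h1 := cupProj_val hn hμ f le_rfl
    rw [h0 f hf] at h1
    have h2 : (0 : ℝ) = 2 ^ μ.colLen 1 * f.1 (toTabloid (rowTableau hn hμ)) := h1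
    exact (mul_eq_zero.1 h2.symm).resolve_left (by positivity)
  -- As `s = E - 1`, the submodule is stable under all of `S_n`. Transitivity on tabloids carries
  -- the vanishing of one coefficient to all of them.
  have hact : ∀ l : List (Sym n), (∀ s ∈ l, IsSimple s) → ∀ f ∈ N, spechtAct μ l.prod f ∈ N := by
    intro l
    induction l with
    | nil => intro _ f hf; rwa [List.prod_nil, spechtAct_one]
    | cons s l ih =>
      intro hl f hf
      obtain ⟨i, hi, rfl⟩ := isSimple_iff.1 (hl s List.mem_cons_self)
      have h1 := ih (fun t ht => hl t (List.mem_cons_of_mem _ ht)) f hf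
      rw [List.prod_cons, spechtAct_mul]
      have h2 := N.sub_mem (hN i hi _ h1) h1
      rwa [spechtE_apply, add_sub_cancel_left] at h2
  rw [Submodule.eq_bot_iff]
  intro f hf
  refine Subtype.ext (funext fun t => ?_)
  obtain ⟨T, rfl⟩ := Quotient.exists_rep t
  set σ : Sym n := (rowTableau hn hμ).symm.trans T with hσ
  have hT : (Quotient.mk _ T : Tabloid μ n) = Tabloid.act σ (toTabloid (rowTableau hn hμ)) := by
    change toTabloid T = toTabloid ((rowTableau hn hμ).trans σ)
    congr 1
    refine Equiv.ext fun c => ?_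
    simp [hσ]
  obtain ⟨l, hl⟩ := exists_isExpr σ⁻¹
  have h1 := hval _ (hact l hl.1 f hf)
  rw [hl.2, spechtAct_val, inv_inv] at h1
  rw [hT]
  exact h1

/-! ### Path vectors as a basis of the Specht module -/

variable {f : specht μ n}

theorem spechtForm_isRefl : (spechtForm μ n).IsRefl := fun f g h => by rw [spechtForm_comm, h]

theorem spechtForm_nondegenerate : (spechtForm μ n).Nondegenerate :=
  ⟨fun f h => eq_zero_of_spechtForm_self (h f), fun f h => eq_zero_of_spechtForm_self (h f)⟩

/-- The path vectors built on a non-zero cupped vector span the Specht module. -/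
theorem IsCupped.span_pathVec (hn : μ.card = n) (hμ : μ.rowLen 0 ≤ 2) (hf : IsCupped f)
    (hf0 : f ≠ 0) : Submodule.span ℝ (Set.range fun h : {h // IsPath n (μ.colLen 1) h} =>
      pathVec n (μ.colLen 1) (spechtE μ n) f h.1) = ⊤ := by
  have hTL := hf.isTL hn hμ
  have hbn := two_mul_colLen_le hn hμ
  set U := Submodule.span ℝ (Set.range fun h : {h // IsPath n (μ.colLen 1) h} =>
      pathVec n (μ.colLen 1) (spechtE μ n) f h.1) with hU
  have hfU : f ∈ U := Submodule.subset_span ⟨⟨_, isPath_lowPath _ _⟩, pathVec_lowPath _ _ _ _⟩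
  have hUE : ∀ i, i + 1 < n → ∀ u ∈ U, spechtE μ n i u ∈ U := by
    intro i hi u hu
    have : U ≤ U.comap (spechtE μ n i) := by
      refine Submodule.span_le.2 ?_
      rintro _ ⟨⟨h, hh⟩, rfl⟩
      obtain ⟨c, h', _, hh', hE⟩ := exists_apply_pathVec hh hi
      change spechtE μ n i (pathVec _ _ _ _ h) ∈ U
      rw [hE _ _ _ hTL]
      exact U.smul_mem _ (Submodule.subset_span ⟨⟨h', hh'⟩, rfl⟩)
    exact this hu
  set N := (spechtForm μ n).orthogonal U with hN
  have hmem : ∀ g, g ∈ N ↔ ∀ u ∈ U, spechtForm μ n u g = 0 := fun g => Iff.rfl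
  have hNE : ∀ i, i + 1 < n → ∀ g ∈ N, spechtE μ n i g ∈ N := by
    intro i hi g hg
    rw [hmem] at hg ⊢
    intro u hu
    rw [← spechtForm_spechtE]
    exact hg _ (hUE i hi u hu)
  -- The cup projection of an element of `N` stays in `N`, but it is a multiple of `f` and so also
  -- lies in `U`; hence it is orthogonal to itself.
  have hN0 : N = ⊥ := by
    refine eq_bot_of_cupProj hn hμ hNE fun g hg => ?_
    have h1 : cupProj μ n (μ.colLen 1) g ∈ N := cupProj_mem (S := N) hbn hNE hg le_rfl
    obtain ⟨c, hc⟩ := hf.eq_smul hn hμ hf0 (isCupped_cupProj g)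
    refine eq_zero_of_spechtForm_self ((hmem _).1 h1 _ ?_)
    rw [hc]
    exact U.smul_mem _ hfU
  have hcompl : IsCompl U N := by
    refine (LinearMap.BilinForm.restrict_nondegenerate_iff_isCompl_orthogonal
      spechtForm_isRefl).1 ⟨fun u hu => ?_, fun u hu => ?_⟩
    · exact Subtype.ext (eq_zero_of_spechtForm_self (hu u))
    · exact Subtype.ext (eq_zero_of_spechtForm_self (hu u))
  have := hcompl.sup_eq_top
  rwa [hN0, sup_bot_eq] at this

/-- Triangularity of path vectors against polytabloids: applying `E k` can raise the admissible
column paths only at `k + 1`, by at most one box. -/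
theorem IsCupped.colPath_le (hn : μ.card = n) (hμ : μ.rowLen 0 ≤ 2) (hf : IsCupped f)
    {h : ℕ → ℤ} (hh : IsPath n (μ.colLen 1) h) {T : Tableau μ n}
    (hT : spechtForm μ n (pathVec n (μ.colLen 1) (spechtE μ n) f h) (poly T) ≠ 0) (j : ℕ) :
    colPath T j ≤ h j := by
  induction hk : pathArea n (μ.colLen 1) h using Nat.strong_induction_on generalizing h T j with
  | _ N ih =>
    rcases pathVec_eq (spechtE μ n) f hh with ⟨k, hg, e⟩ | ⟨hlow, e⟩
    · have hkn := hh.lt_of_lt hg.2.1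
      have ha := hh.pathArea_down hg.2.1
      have hd := hh.down hg.1 hg.2.1
      have hle : pathDown h k j ≤ h j := by
        by_cases hj : j = k + 1
        · rw [hj, pathDown_self]; omega
        · rw [pathDown_of_ne h hj]
      rw [e, spechtForm_spechtE, spechtE_poly, map_add] at hT
      by_cases h1 : spechtForm μ n (pathVec n (μ.colLen 1) (spechtE μ n) f (pathDown h k))
          (poly T) = 0
      · rw [h1, zero_add] at hT
        have h2 := ih _ (by omega) hd hT j rfl
        by_cases hj : j = k + 1
        · subst hj
          have h3 := ih _ (by omega) hd hT k rfl
          rw [colPath_trans_adj T hkn (by omega), pathDown_of_ne h (by omega)] at h3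
          have h4 := colStep_eq_or T k
          have h5 := hg.1.1
          rw [colPath_succ]
          omega
        · rw [colPath_trans_adj T hkn hj] at h2
          exact h2.trans hle
      · exact (ih _ (by omega) hd h1 j rfl).trans hle
    · rw [e] at hT
      rw [hlow]
      by_cases hj : j ≤ 2 * μ.colLen 1
      · have h1 := hf.colPath_two_mul hn hμ hT (k := j / 2) (by omega)
        have h2 := colStep_eq_or T (2 * (j / 2))
        have h3 := colPath_succ T (2 * (j / 2))
        rw [lowPath, if_pos hj]
        rcases Nat.mod_two_eq_zero_or_one j with h | h
        · rw [show 2 * (j / 2) = j by omega] at h1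
          omega
        · rw [show 2 * (j / 2) + 1 = j by omega] at h3
          omega
      · have h1 := hf.colPath_two_mul hn hμ hT le_rfl
        have h2 := colPath_sub_le T (not_le.1 hj).le
        rw [lowPath, if_neg hj]
        push_cast at h2
        omega

/-- The non-zero diagonal entries. Exchanging `k` and `k+1` in a tableau for the lower path gives
one for `h`; of the two resulting terms, the one whose path is too high vanishes by
`IsCupped.colPath_le`. -/
theorem IsCupped.exists_dual_tableau (hn : μ.card = n) (hμ : μ.rowLen 0 ≤ 2) (hf : IsCupped f)
    (hf0 : f ≠ 0) {h : ℕ → ℤ} (hh : IsPath n (μ.colLen 1) h) :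
    ∃ T : Tableau μ n, (∀ j, colPath T j = h j) ∧
      spechtForm μ n (pathVec n (μ.colLen 1) (spechtE μ n) f h) (poly T) ≠ 0 := by
  induction hk : pathArea n (μ.colLen 1) h using Nat.strong_induction_on generalizing h with
  | _ N ih =>
    rcases pathVec_eq (spechtE μ n) f hh with ⟨k, hg, e⟩ | ⟨hlow, e⟩
    · have hkn := hh.lt_of_lt hg.2.1
      have ha := hh.pathArea_down hg.2.1
      have hd := hh.down hg.1 hg.2.1
      obtain ⟨T', hT', hne⟩ := ih _ (by omega) hd rfl
      have hpath : ∀ j, colPath (T'.trans (adj n k)) j = h j := by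
        intro j
        by_cases hj : j = k + 1
        · subst hj
          have h1 := colPath_succ T' (k + 1)
          rw [hT', hT', pathDown_of_ne h (by omega), pathDown_self] at h1
          rw [colPath_succ, colPath_trans_adj T' hkn (by omega), hT', colStep_trans_adj T' hkn,
            if_pos rfl, pathDown_of_ne h (by omega)]
          obtain ⟨h2, h3⟩ := hg.1
          rw [show k + 1 + 1 = k + 2 by ring] at h1
          omega
        · rw [colPath_trans_adj T' hkn hj, hT', pathDown_of_ne h hj]
      refine ⟨T'.trans (adj n k), hpath, ?_⟩
      rw [e, spechtForm_spechtE, spechtE_poly, map_add, trans_adj_trans_adj]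
      have h0 : spechtForm μ n (pathVec n (μ.colLen 1) (spechtE μ n) f (pathDown h k))
          (poly (T'.trans (adj n k))) = 0 := by
        by_contra h'
        have := hf.colPath_le hn hμ hd h' (k + 1)
        rw [hpath, pathDown_self] at this
        omega
      rw [h0, zero_add]
      exact hne
    · refine ⟨rowTableau hn hμ, fun j => by rw [colPath_rowTableau, hlow], ?_⟩
      rw [e]
      exact fun h' => hf0 (hf.eq_zero hn hμ h')

theorem IsPath.eq_of_le {b : ℕ} {h h' : ℕ → ℤ} (hh : IsPath n b h) (hh' : IsPath n b h')
    (hle : ∀ j, h j ≤ h' j) (ha : pathArea n b h' ≤ pathArea n b h) : h = h' := by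
  have h1 : ∀ j ∈ Finset.range n, (h j - lowPath b j).toNat ≤ (h' j - lowPath b j).toNat :=
    fun j _ => by have := hle j; omega
  have h2 := (Finset.sum_eq_sum_iff_of_le h1).1 (le_antisymm (Finset.sum_le_sum h1) ha)
  funext j
  by_cases hj : j < n
  · have := h2 j (Finset.mem_range.2 hj)
    have := hh.le j
    have := hh'.le j
    omega
  · rw [hh.eq j (not_lt.1 hj), hh'.eq j (not_lt.1 hj)]

theorem IsCupped.linearIndependent_pathVec (hn : μ.card = n) (hμ : μ.rowLen 0 ≤ 2)
    (hf : IsCupped f) (hf0 : f ≠ 0) :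
    LinearIndependent ℝ (fun h : {h // IsPath n (μ.colLen 1) h} =>
      pathVec n (μ.colLen 1) (spechtE μ n) f h.1) := by
  classical
  rw [linearIndependent_iff']
  intro s c hc
  by_contra hne
  push Not at hne
  obtain ⟨h0, hs0, hc0⟩ := hne
  obtain ⟨h, hh, hmax⟩ := Finset.exists_max_image (s.filter fun h => c h ≠ 0)
    (fun h => pathArea n (μ.colLen 1) h.1) ⟨h0, Finset.mem_filter.2 ⟨hs0, hc0⟩⟩
  rw [Finset.mem_filter] at hh
  obtain ⟨T, hT, hTne⟩ := hf.exists_dual_tableau hn hμ hf0 h.2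
  have h1 := congrArg (fun u => spechtForm μ n u (poly T)) hc
  simp only [map_sum, map_smul, LinearMap.sum_apply, LinearMap.smul_apply, map_zero,
    LinearMap.zero_apply, smul_eq_mul] at h1
  rw [Finset.sum_eq_single_of_mem h hh.1] at h1
  · exact (mul_ne_zero hh.2 hTne) h1
  · intro h' hs' hne'
    by_contra h2
    have hle := hf.colPath_le hn hμ h'.2 (right_ne_zero_of_mul h2)
    simp only [hT] at hle
    exact hne' (Subtype.ext (h.2.eq_of_le h'.2 hle
      (hmax h' (Finset.mem_filter.2 ⟨hs', left_ne_zero_of_mul h2⟩))).symm)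

end TwoColumn

/-! ### The dual of a left cell representation -/

section CellModule

variable {n : ℕ} {b : Sym n → Hecke n} {x : Sym n} {V : Type*} [AddCommGroup V] [Module ℝ V]
  {E : ℕ → V →ₗ[ℝ] V} {F : Module.Basis (leftCell b x) ℝ V}

/-- The operators `E i` act on the basis `F` as `1 + s_i` acts on the dual of the basis of the left
cell representation of `x` at `v = 1`. -/
def IsCellAction (E : ℕ → V →ₗ[ℝ] V) (F : Module.Basis (leftCell b x) ℝ V) : Prop :=
  ∀ i, i + 1 < n → ∀ y, E i (F y) = ∑ z : leftCell b x, cellCoeff b (adj n i) y z • F z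

theorem IsCellAction.repr_apply (hE : IsCellAction E F) {i : ℕ} (hi : i + 1 < n) (v : V)
    (z : leftCell b x) :
    F.repr (E i v) z = ∑ y, F.repr v y * cellCoeff b (adj n i) y z := by
  conv_lhs => rw [← F.sum_repr v]
  simp only [map_sum, map_smul, hE i hi, Finsupp.coe_finsetSum, Finset.sum_apply,
    Finsupp.smul_apply, Module.Basis.repr_self, smul_eq_mul]
  refine Finset.sum_congr rfl fun y _ => ?_
  rw [Finset.sum_eq_single z]
  · rw [Finsupp.single_eq_same, mul_one]
  · intro w _ hw
    rw [Finsupp.single_eq_of_ne hw.symm, mul_zero]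
  · exact fun h => absurd (Finset.mem_univ z) h

theorem IsCellAction.repr_apply_of_desc (hE : IsCellAction E F) {i : ℕ} (hi : i + 1 < n) (v : V)
    {z : leftCell b x} (hz : Desc (adj n i) z) : F.repr (E i v) z = 0 := by
  rw [hE.repr_apply hi]
  exact Finset.sum_eq_zero fun y _ => by rw [cellCoeff_of_desc hz, mul_zero]

/-- The image of `E i` has no coordinates at elements with descent `s_i`, and an eigenvector for `2`
lies in this image. -/
theorem IsCellAction.repr_eq_zero (hE : IsCellAction E F) {i : ℕ} (hi : i + 1 < n) {v : V}
    (hv : E i v = (2 : ℝ) • v) {z : leftCell b x} (hz : Desc (adj n i) z) : F.repr v z = 0 := by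
  have h := hE.repr_apply_of_desc hi v hz
  rw [hv, map_smul, Finsupp.smul_apply, smul_eq_mul] at h
  linarith

theorem IsCellAction.of_not_desc (hE : IsCellAction E F) {i : ℕ} (hi : i + 1 < n)
    {y : leftCell b x} (hy : ¬ Desc (adj n i) y) : E i (F y) = (2 : ℝ) • F y := by
  rw [hE i hi, Finset.sum_eq_single y]
  · rw [cellCoeff_of_not_desc hy, if_pos rfl]
  · intro z _ hz
    rw [cellCoeff_of_not_desc hy, if_neg fun e => hz (Subtype.ext e).symm, zero_smul]
  · exact fun h => absurd (Finset.mem_univ y) h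

theorem IsCellAction.not_desc (hE : IsCellAction E F) {i : ℕ} (hi : i + 1 < n)
    {y : leftCell b x} (hy : E i (F y) = (2 : ℝ) • F y) : ¬ Desc (adj n i) y := fun h => by
  have := hE.repr_eq_zero hi hy h
  simp at this

theorem IsCellAction.sq (hE : IsCellAction E F) {i : ℕ} (hi : i + 1 < n) (v : V) :
    E i (E i v) = (2 : ℝ) • E i v := by
  rw [← F.sum_repr (E i v), map_sum, Finset.smul_sum]
  refine Finset.sum_congr rfl fun z _ => ?_
  by_cases hz : Desc (adj n i) z
  · rw [hE.repr_apply_of_desc hi v hz, zero_smul, map_zero, smul_zero]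
  · rw [map_smul, hE.of_not_desc hi hz, smul_comm]

/-- The star operation is inverted by exchanging the roles of `i` and `j`, by the symmetry in
`IsKLBasis.cellCoeff_symm`. -/
theorem IsCellAction.exists_star (hE : IsCellAction E F) (hb : IsKLBasis b) {i j : ℕ}
    (hi : i + 1 < n) (hj : j + 1 < n) (hij : i + 1 = j ∨ j + 1 = i)
    (hX : ∀ z ∈ leftCell b x, Desc (adj n i) z ∨ Desc (adj n j) z) {y : leftCell b x}
    (hy : ¬ Desc (adj n i) y) : ∃ y' : leftCell b x, E j (F y) = F y' ∧ E i (F y') = F y := by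
  have key : ∀ {i j : ℕ} {y y' : leftCell b x}, j + 1 < n →
      (∀ z ∈ leftCell b x, cellCoeff b (adj n j) y z = if z = y'.1 then 1 else 0) →
      E j (F y) = F y' := by
    intro i j y y' hj h
    rw [hE j hj, Finset.sum_eq_single y']
    · rw [h _ y'.2, if_pos rfl, one_smul]
    · intro z _ hz
      rw [h _ z.2, if_neg fun e => hz (Subtype.ext e), zero_smul]
    · exact fun h => absurd (Finset.mem_univ y') h
  obtain ⟨y', hy', hd, h⟩ := hb.exists_star hi hj hij hX y.2 hy
  obtain ⟨y'', hy'', hd', h'⟩ := hb.exists_star hj hi hij.symm (fun z hz => (hX z hz).symm) hy' hd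
  refine ⟨⟨y', hy'⟩, key (i := i) (y' := ⟨y', hy'⟩) hj h, ?_⟩
  have e : y.1 = y'' := by
    have h1 := hb.cellCoeff_symm (isSimple_adj hi) (isSimple_adj hj) hy
      ((hX y y.2).resolve_left hy) ((hX y' hy').resolve_right hd) hd
    rw [h y' hy', if_pos rfl, h' y y.2] at h1
    by_contra hne
    rw [if_neg hne] at h1
    exact zero_ne_one h1
  exact key (i := j) (y := ⟨y', hy'⟩) hi fun z hz => by rw [h' z hz, e]

/-- A basis vector with `E i v = 2 v` has `i` as a non-descent, so `E (i + 1)` moves it to a basis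
vector. Only such moves are needed, because path vectors are built from good peaks. -/
theorem IsCellAction.pathVec_mem (hE : IsCellAction E F) (hb : IsKLBasis b)
    (hX : ∀ i, i + 2 < n → ∀ z ∈ leftCell b x, Desc (adj n i) z ∨ Desc (adj n (i + 1)) z) {m : ℕ}
    {y : leftCell b x} (hT : IsTL n m E (F y)) {h : ℕ → ℤ} (hh : IsPath n m h) :
    pathVec n m E (F y) h ∈ Set.range F := by
  refine hT.pathVec_mem ⟨y, rfl⟩ (fun i hi v hv hv2 => ?_) hh
  obtain ⟨z, rfl⟩ := hv
  obtain ⟨z', hz', _⟩ := hE.exists_star hb (by omega) hi (Or.inl rfl) (hX i hi)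
    (hE.not_desc (by omega) hv2)
  exact ⟨z', hz'.symm⟩

end CellModule

/-! ### The cone spanned by a left cell basis -/

section Cone

variable {n : ℕ} {μ : YoungDiagram}

theorem spechtForm_isSymm : (spechtForm μ n).IsSymm := ⟨fun f g => spechtForm_comm f g⟩

/-- Self-adjointness of `E i` turns the cell matrices into their transposes on the dual basis, and
coordinates in `B` become pairings with `F`. -/
theorem IsKLLeftCellBasis.exists_dual {ι : Type} [Fintype ι]
    {B : Module.Basis ι ℝ (specht μ n)} (hB : IsKLLeftCellBasis B) :
    ∃ b : Sym n → Hecke n, IsKLBasis b ∧ ∃ (x : Sym n) (F : Module.Basis (leftCell b x) ℝ (specht μ n))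
      (e : ι ≃ leftCell b x), IsCellAction (spechtE μ n) F ∧
        ∀ u i, B.repr u i = spechtForm μ n u (F (e i)) := by
  classical
  obtain ⟨b, hb, x, e, hM⟩ := hB
  set F := (LinearMap.BilinForm.dualBasis (spechtForm μ n) spechtForm_nondegenerate B).reindex e
  have hF : ∀ i, F (e i) =
      LinearMap.BilinForm.dualBasis (spechtForm μ n) spechtForm_nondegenerate B i := fun i => by
    simp [F]
  have hrepr : ∀ u z, F.repr u z = spechtForm μ n u (B (e.symm z)) := fun u z => by
    simp [F]
  have hBrepr : ∀ u i, B.repr u i = spechtForm μ n u (F (e i)) := by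
    intro u i
    rw [hF]
    conv_rhs => rw [← B.sum_repr u]
    simp only [map_sum, map_smul, LinearMap.sum_apply, LinearMap.smul_apply,
      LinearMap.BilinForm.apply_dualBasis_right spechtForm_nondegenerate spechtForm_isSymm]
    simp
  refine ⟨b, hb, x, F, e, fun i hi y => F.ext_elem fun z => ?_, hBrepr⟩
  obtain ⟨M, hM1, hM2⟩ := hM _ (isSimple_adj hi)
  rw [hb.isCellMatrix_iff (isSimple_adj hi)] at hM1
  have h1 : B.repr (spechtE μ n i (B (e.symm z))) (e.symm y) = cellCoeff b (adj n i) y z := by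
    rw [spechtE_apply, hM2, map_add, Finsupp.add_apply, B.repr_self]
    simp only [map_sum, map_smul, Finsupp.coe_finsetSum, Finset.sum_apply, Finsupp.smul_apply,
      Module.Basis.repr_self, hM1, Finsupp.single_apply]
    simp [eq_comm]
  rw [hrepr, spechtForm_spechtE, spechtForm_comm]
  have h2 := hBrepr (spechtE μ n i (B (e.symm z))) (e.symm y)
  rw [Equiv.apply_symm_apply] at h2
  rw [← h2, h1]
  simp [Finsupp.single_apply]

variable {b : Sym n → Hecke n} {x : Sym n} {F : Module.Basis (leftCell b x) ℝ (specht μ n)}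

/-- If both were non-descents, `E i` and `E (i + 1)` would double the same vector, and the braid
relation would read `8 = 2`. -/
theorem desc_or_desc_of_specht (hμ : μ.rowLen 0 ≤ 2) (hE : IsCellAction (spechtE μ n) F) (i : ℕ)
    (hi : i + 2 < n) (z : Sym n) (hz : z ∈ leftCell b x) :
    Desc (adj n i) z ∨ Desc (adj n (i + 1)) z := by
  by_contra! h
  have h1 := hE.of_not_desc (y := ⟨z, hz⟩) (show i + 1 < n by omega) h.1
  have h2 := hE.of_not_desc (y := ⟨z, hz⟩) hi h.2
  have h3 := spechtE_braid hμ (show i + 1 < n by omega) hi (Or.inl rfl) (F ⟨z, hz⟩)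
  simp only [h1, h2, map_smul, smul_smul] at h3
  have h4 := congrArg (fun v => F.repr v ⟨z, hz⟩) h3
  simp at h4
  norm_num at h4

/-- A non-zero invariant subspace contains a non-zero cupped vector. -/
theorem exists_cupProj_ne_zero (hn : μ.card = n) (hμ : μ.rowLen 0 ≤ 2) {U : Set (specht μ n)}
    (hU : ∀ i, i + 1 < n → ∀ u ∈ U, spechtE μ n i u ∈ U) {u : specht μ n} (hu : u ∈ U)
    (hu0 : u ≠ 0) : ∃ v ∈ U, cupProj μ n (μ.colLen 1) v ≠ 0 := by
  by_contra! h
  have hbot : Submodule.span ℝ U = ⊥ := by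
    refine eq_bot_of_cupProj hn hμ (fun i hi f hf => ?_) fun f hf => ?_
    · have : Submodule.span ℝ U ≤ (Submodule.span ℝ U).comap (spechtE μ n i) :=
        Submodule.span_le.2 fun v hv => Submodule.subset_span (hU i hi v hv)
      exact this hf
    · have : Submodule.span ℝ U ≤ LinearMap.ker (cupProj μ n (μ.colLen 1)) :=
        Submodule.span_le.2 fun v hv => h v hv
      exact this hf
  have := Submodule.subset_span (R := ℝ) hu
  rw [hbot] at this
  exact hu0 this

/-- The dual basis of a left cell basis consists of the path vectors. -/
theorem IsCellAction.exists_pathVec (hE : IsCellAction (spechtE μ n) F) (hn : μ.card = n)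
    (hμ : μ.rowLen 0 ≤ 2) (hb : IsKLBasis b) :
    ∃ f : specht μ n, IsCupped f ∧ f ≠ 0 ∧
      ∀ v, v ∈ Set.range F ↔
        ∃ h, IsPath n (μ.colLen 1) h ∧ pathVec n (μ.colLen 1) (spechtE μ n) f h = v := by
  have hbn := two_mul_colLen_le hn hμ
  obtain ⟨g, _, hg⟩ := exists_cupProj_ne_zero hn hμ (U := Set.univ) (fun _ _ _ _ => trivial)
    (u := F ⟨x, .refl, .refl⟩) trivial (F.ne_zero _)
  have hgc := isCupped_cupProj g
  set v := cupProj μ n (μ.colLen 1) g with hv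
  -- Any basis vector occurring in a cupped vector is itself cupped: its index cannot have a descent
  -- at any `2k`, by `IsCellAction.repr_eq_zero`.
  obtain ⟨y, hy⟩ : ∃ y, F.repr v y ≠ 0 := by
    by_contra! h
    exact hg (F.repr.map_eq_zero_iff.1 (Finsupp.ext h))
  have hf : IsCupped (F y) := fun k hk => by
    rw [← spechtE_eq_two_smul_iff]
    refine hE.of_not_desc (by omega) fun hd => hy ?_
    exact hE.repr_eq_zero (i := 2 * k) (by omega) (spechtE_eq_two_smul_iff.2 (hgc k hk)) hd
  have hmem : ∀ h, IsPath n (μ.colLen 1) h →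
      pathVec n (μ.colLen 1) (spechtE μ n) (F y) h ∈ Set.range F := fun h hh =>
    hE.pathVec_mem hb (desc_or_desc_of_specht hμ hE) (hf.isTL hn hμ) hh
  refine ⟨F y, hf, F.ne_zero y, fun v => ⟨?_, fun ⟨h, hh, e⟩ => e ▸ hmem h hh⟩⟩
  rintro ⟨z, rfl⟩
  -- The path vectors span, so a basis vector that is not among them would be a combination of the
  -- other basis vectors.
  by_contra! hz
  refine F.linearIndependent.notMem_span_image (s := {z}ᶜ) (x := z) (by simp) ?_
  have hle : Submodule.span ℝ (Set.range fun h : {h // IsPath n (μ.colLen 1) h} =>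
      pathVec n (μ.colLen 1) (spechtE μ n) (F y) h.1) ≤ Submodule.span ℝ (F '' {z}ᶜ) := by
    refine Submodule.span_mono ?_
    rintro _ ⟨⟨h, hh⟩, rfl⟩
    obtain ⟨w, hw⟩ := hmem h hh
    refine ⟨w, ?_, hw⟩
    rintro rfl
    exact hz h hh hw.symm
  rw [hf.span_pathVec hn hμ (F.ne_zero y)] at hle
  exact hle trivial

theorem mem_hull_range_basis {ι V : Type*} [Fintype ι] [AddCommGroup V] [Module ℝ V]
    (B : Module.Basis ι ℝ V) (u : V) :
    u ∈ PointedCone.hull ℝ (Set.range B) ↔ ∀ i, 0 ≤ B.repr u i := by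
  classical
  constructor
  · intro hu
    induction hu using Submodule.span_induction with
    | mem v hv =>
      obtain ⟨j, rfl⟩ := hv
      intro i
      rw [B.repr_self, Finsupp.single_apply]
      split_ifs <;> norm_num
    | zero => intro i; simp
    | add v w _ _ hv hw =>
      intro i
      rw [map_add, Finsupp.add_apply]
      exact add_nonneg (hv i) (hw i)
    | smul c v _ hv =>
      intro i
      rw [show c • v = c.1 • v from rfl, map_smul, Finsupp.smul_apply]
      exact mul_nonneg c.2 (hv i)
  · intro h
    rw [← B.sum_repr u]
    refine Submodule.sum_mem _ fun i _ => ?_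
    exact Submodule.smul_mem _ (⟨B.repr u i, h i⟩ : {c : ℝ // 0 ≤ c})
      (Submodule.subset_span ⟨i, rfl⟩)

theorem isProperCone_hull_range {ι : Type} [Fintype ι] (B : Module.Basis ι ℝ (specht μ n)) :
    IsClosed (PointedCone.hull ℝ (Set.range B) : Set (specht μ n)) ∧
      IsProperCone (PointedCone.hull ℝ (Set.range B)) := by
  have hc : ∀ i, Continuous fun u => B.repr u i := fun i =>
    (B.coord i).continuous_of_finiteDimensional
  have hset : (PointedCone.hull ℝ (Set.range B) : Set (specht μ n)) =
      ⋂ i, {u | 0 ≤ B.repr u i} := by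
    ext u
    rw [SetLike.mem_coe, mem_hull_range_basis, Set.mem_iInter]
    rfl
  refine ⟨?_, fun u h1 h2 => ?_, ?_⟩
  · rw [hset]
    exact isClosed_iInter fun i => isClosed_le continuous_const (hc i)
  · rw [mem_hull_range_basis] at h1 h2
    refine B.ext_elem fun i => ?_
    have := h1 i
    have := h2 i
    rw [map_neg, Finsupp.neg_apply] at this
    rw [map_zero, Finsupp.zero_apply]
    linarith
  · refine ⟨∑ i, B i, mem_interior.2 ⟨⋂ i, {u | 0 < B.repr u i}, ?_, ?_, ?_⟩⟩
    · rw [hset]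
      exact Set.iInter_mono fun i u (hu : 0 < B.repr u i) => hu.le
    · exact isOpen_iInter_of_finite fun i => isOpen_lt continuous_const (hc i)
    · rw [Set.mem_iInter]
      intro i
      simp

/-- A left cell basis spans the maximal invariant cone. -/
theorem IsKLLeftCellBasis.isMaximalInvariantCone (hn : μ.card = n) (hμ : μ.rowLen 0 ≤ 2) {ι : Type}
    [Fintype ι] {B : Module.Basis ι ℝ (specht μ n)} (hB : IsKLLeftCellBasis B) :
    IsMaximalInvariantCone (PointedCone.hull ℝ (Set.range B)) := by
  obtain ⟨b, hb, x, F, e, hE, hrepr⟩ := hB.exists_dual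
  obtain ⟨f, hf, hf0, hF⟩ := hE.exists_pathVec hn hμ hb
  have hTL := hf.isTL hn hμ
  have hbn := two_mul_colLen_le hn hμ
  obtain ⟨hclosed, hproper⟩ := isProperCone_hull_range B
  have hmem : ∀ u, u ∈ PointedCone.hull ℝ (Set.range B) ↔
      ∀ h, IsPath n (μ.colLen 1) h →
        0 ≤ spechtForm μ n u (pathVec n (μ.colLen 1) (spechtE μ n) f h) := by
    intro u
    simp only [mem_hull_range_basis, hrepr]
    constructor
    · intro h p hp
      obtain ⟨y, hy⟩ := (hF _).2 ⟨p, hp, rfl⟩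
      rw [← hy, ← e.apply_symm_apply y]
      exact h _
    · intro h i
      obtain ⟨p, hp, hp'⟩ := (hF (F (e i))).1 ⟨_, rfl⟩
      rw [← hp']
      exact h p hp
  refine ⟨⟨hclosed, fun s hs u hu => ?_⟩, hproper, fun D hD hDtop => ?_⟩
  · obtain ⟨i, hi, rfl⟩ := isSimple_iff.1 hs
    rw [← spechtE_apply]
    rw [hmem] at hu ⊢
    intro h hh
    obtain ⟨c, h', hc, hh', hEh⟩ := exists_apply_pathVec hh hi
    rw [spechtForm_spechtE, hEh _ _ _ hTL, map_smul]
    exact mul_nonneg hc (hu h' hh')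
  obtain ⟨u₀, hu₀⟩ : ∃ u₀, u₀ ∉ D := by
    by_contra! h
    exact hDtop (eq_top_iff.2 fun u _ => h u)
  -- A separating functional, represented by the form, is a non-zero element of the dual cone `S`.
  -- As `S` is preserved by every `E i`, it contains a non-zero multiple of `f`, whose sign decides
  -- between `C` and `-C`.
  obtain ⟨φ, hφ, hφ₀⟩ := ProperCone.hyperplane_separation_point (⟨D, hD.1⟩ : ProperCone ℝ (specht μ n))
    hu₀
  set S : Set (specht μ n) := {g | ∀ u ∈ D, 0 ≤ spechtForm μ n g u} with hS
  have hSE : ∀ i, i + 1 < n → ∀ g ∈ S, spechtE μ n i g ∈ S := by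
    intro i hi g hg u hu
    rw [spechtForm_spechtE]
    exact hg _ (hD.2 _ (isSimple_adj hi) u hu)
  have hSsmul : ∀ c : ℝ, 0 ≤ c → ∀ g ∈ S, c • g ∈ S := by
    intro c hc g hg u hu
    rw [map_smul, LinearMap.smul_apply]
    exact mul_nonneg hc (hg u hu)
  set g := (LinearMap.BilinForm.toDual (spechtForm μ n) spechtForm_nondegenerate).symm
    (φ : specht μ n →ₗ[ℝ] ℝ) with hg
  have hgφ : ∀ u, spechtForm μ n g u = φ u := fun u =>
    LinearMap.BilinForm.apply_toDual_symm_apply _ _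
  have hgS : g ∈ S := fun u hu => by rw [hgφ]; exact hφ u hu
  have hg0 : g ≠ 0 := by
    intro h0
    have := hgφ u₀
    rw [h0, map_zero, LinearMap.zero_apply] at this
    linarith
  obtain ⟨v, hvS, hv⟩ := exists_cupProj_ne_zero hn hμ hSE hgS hg0
  have hcS := cupProj_mem hbn hSE hvS le_rfl
  obtain ⟨c, hc⟩ := hf.eq_smul hn hμ hf0 (isCupped_cupProj v)
  rw [hc] at hv hcS
  have hc0 : c ≠ 0 := fun h => hv (by rw [h, zero_smul])
  rcases lt_or_gt_of_ne hc0 with hneg | hpos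
  · right
    have hfS : -f ∈ S := by
      have := hSsmul (-c⁻¹) (by rw [neg_nonneg]; exact inv_nonpos.2 hneg.le) _ hcS
      rwa [smul_smul, neg_mul, inv_mul_cancel₀ hc0, neg_one_smul] at this
    intro u hu
    rw [hmem]
    intro h hh
    have := hTL.pathVec_mem (S := {v | -v ∈ S}) hfS (fun i hi v hv _ => by
      have := hSE (i + 1) hi _ hv
      rwa [map_neg] at this) hh u hu
    rwa [spechtForm_comm, map_neg, ← LinearMap.neg_apply, ← map_neg]
  · left
    have hfS : f ∈ S := by
      have := hSsmul c⁻¹ (inv_nonneg.2 hpos.le) _ hcS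
      rwa [smul_smul, inv_mul_cancel₀ hc0, one_smul] at this
    intro u hu
    rw [hmem]
    intro h hh
    rw [spechtForm_comm]
    exact hTL.pathVec_mem hfS (fun i hi v hv _ => hSE (i + 1) hi _ hv) hh u hu

end Cone

/-! ### A left cell for every two-column shape -/

section TwoColumnCell

variable {n m : ℕ}

/-- The position of the value `k` in the permutation `cellElt`. -/
def cellPos (n m k : ℕ) : ℕ :=
  if k < 2 * m then (if k % 2 = 1 then n - 1 - k / 2 else n - m - 1 - k / 2) else n - 1 - k

theorem cellPos_lt {k : ℕ} (hk : k < n) : cellPos n m k < n := by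
  unfold cellPos
  split_ifs <;> omega

theorem cellPos_injective (hm : 2 * m ≤ n) :
    Function.Injective fun k : Fin n => (⟨cellPos n m k, cellPos_lt k.2⟩ : Fin n) := by
  intro k l h
  have h' : cellPos n m k = cellPos n m l := congrArg Fin.val h
  have := k.2
  have := l.2
  refine Fin.ext ?_
  unfold cellPos at h'
  split_ifs at h' <;> omega

/-- The permutation which decreases on the first `n - m` and on the last `m` positions, the latter
holding the values `1, 3, …, 2 m - 1`. -/
def cellElt (hm : 2 * m ≤ n) : Sym n :=
  (Equiv.ofBijective _ (Finite.injective_iff_bijective.1 (cellPos_injective hm)))⁻¹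

theorem pos_cellElt (hm : 2 * m ≤ n) {k : ℕ} (hk : k < n) : pos (cellElt hm) k = cellPos n m k := by
  rw [pos_eq _ hk, cellElt, inv_inv]
  rfl

theorem pos_inv_pos (w : Sym n) {k : ℕ} (hk : k < n) : pos w⁻¹ (pos w k) = k := by
  rw [pos_eq _ (pos_lt w hk), inv_inv]
  simp [pos_eq w hk]

theorem pos_pos_inv (w : Sym n) {k : ℕ} (hk : k < n) : pos w (pos w⁻¹ k) = k := by
  have := pos_inv_pos w⁻¹ hk
  rwa [inv_inv] at this

theorem desc_inv_cellElt (hm : 2 * m ≤ n) {r : ℕ} (hr : r + 1 < n) (hrm : r + 1 ≠ n - m) :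
    Desc (adj n r) (cellElt hm)⁻¹ := by
  rw [desc_adj hr]
  have h1 := pos_pos_inv (cellElt hm) (Nat.lt_of_succ_lt hr)
  have h2 := pos_pos_inv (cellElt hm) hr
  have h3 := pos_lt (cellElt hm)⁻¹ (Nat.lt_of_succ_lt hr)
  have h4 := pos_lt (cellElt hm)⁻¹ hr
  rw [pos_cellElt hm h3] at h1
  rw [pos_cellElt hm h4] at h2
  unfold cellPos at h1 h2
  split_ifs at h1 h2 <;> omega

theorem not_desc_cellElt (hm : 2 * m ≤ n) {k : ℕ} (hk : k < m) :
    ¬ Desc (adj n (2 * k)) (cellElt hm) := by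
  have h : 2 * k + 1 < n := by omega
  rw [desc_adj h, pos_cellElt hm h, pos_cellElt hm (by omega)]
  unfold cellPos
  split_ifs <;> omega

variable {b : Sym n → Hecke n}

/-- The right descents of `cellElt` persist in its left cell, so every member decreases on the first
`n - m` and on the last `m` positions. Values `i, i+1` in increasing position must straddle the two
blocks. -/
theorem pos_of_mem_leftCell_cellElt (hb : IsKLBasis b) (hm : 2 * m ≤ n) {y : Sym n}
    (hy : y ∈ leftCell b (cellElt hm)) {i : ℕ} (hi : i + 1 < n) (hd : ¬ Desc (adj n i) y) :
    pos y i < n - m ∧ n - m ≤ pos y (i + 1) := by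
  have hstep : ∀ r, r + 1 < n → r + 1 ≠ n - m → pos y⁻¹ (r + 1) < pos y⁻¹ r := fun r hr hrm =>
    (desc_adj hr).1 (hb.right_desc_of_leftLE (isSimple_adj hr) hy.1 (desc_inv_cellElt hm hr hrm))
  have hanti : ∀ p q, p < q → q < n → (q < n - m ∨ n - m ≤ p) → pos y⁻¹ q < pos y⁻¹ p := by
    intro p q hpq
    induction q, hpq using Nat.le_induction with
    | base => intro hq h; exact hstep p hq (by omega)
    | succ q hpq ih =>
      intro hq h
      exact (hstep q hq (by omega)).trans (ih (by omega) (by omega))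
  rw [desc_adj hi, not_lt] at hd
  have hlt := lt_of_le_of_ne hd (pos_ne hi y)
  by_contra h
  have := hanti _ _ hlt (pos_lt y hi) (by omega)
  rw [pos_inv_pos y hi, pos_inv_pos y (by omega)] at this
  omega

theorem desc_or_desc_of_mem_leftCell_cellElt (hb : IsKLBasis b) (hm : 2 * m ≤ n) (i : ℕ)
    (hi : i + 2 < n) (z : Sym n) (hz : z ∈ leftCell b (cellElt hm)) :
    Desc (adj n i) z ∨ Desc (adj n (i + 1)) z := by
  by_contra! h
  have h1 := pos_of_mem_leftCell_cellElt hb hm hz (by omega) h.1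
  have h2 := pos_of_mem_leftCell_cellElt hb hm hz hi h.2
  omega

/-- Otherwise the `m + 1` distinct values `1, 3, …, 2m - 1` and `i + 1` would all sit in the last
`m` positions. -/
theorem exists_desc_of_mem_leftCell_cellElt (hb : IsKLBasis b) (hm : 2 * m ≤ n) {i : ℕ}
    (hmi : 2 * m ≤ i) (hi : i + 1 < n) {z : Sym n} (hz : z ∈ leftCell b (cellElt hm))
    (hd : ¬ Desc (adj n i) z) : ∃ k < m, Desc (adj n (2 * k)) z := by
  by_contra! h
  have hcard := Finset.card_le_card_of_injOn (s := Finset.range (m + 1)) (t := Finset.range m)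
    (fun j => pos z (if j < m then 2 * j + 1 else i + 1) - (n - m)) ?_ ?_
  · simp at hcard
  · intro j hj
    have hj' := Finset.mem_range.1 hj
    rw [Finset.coe_range, Set.mem_Iio]
    dsimp only
    split_ifs with hjm
    · have := (pos_of_mem_leftCell_cellElt hb hm hz (by omega) (h j hjm)).2
      have := pos_lt z (show 2 * j + 1 < n by omega)
      omega
    · have := (pos_of_mem_leftCell_cellElt hb hm hz hi hd).2
      have := pos_lt z hi
      omega
  · have hle : ∀ j, n - m ≤ pos z (if j < m then 2 * j + 1 else i + 1) := by
      intro j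
      split_ifs with hjm
      · exact (pos_of_mem_leftCell_cellElt hb hm hz (by omega) (h j hjm)).2
      · exact (pos_of_mem_leftCell_cellElt hb hm hz hi hd).2
    intro j hj l hl e
    have hj' := Finset.mem_range.1 hj
    have hl' := Finset.mem_range.1 hl
    dsimp only at e
    have h1 := hle j
    have h2 := hle l
    have h3 := pos_injOn z (k := if j < m then 2 * j + 1 else i + 1)
      (l := if l < m then 2 * l + 1 else i + 1) (by split_ifs <;> omega) (by split_ifs <;> omega)
      (by omega)
    split_ifs at h3 <;> omega

/-- The operators `1 + s_i` on the dual of a left cell representation at `v = 1`. -/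
def cellE (b : Sym n → Hecke n) (x : Sym n) (i : ℕ) :
    (leftCell b x → ℝ) →ₗ[ℝ] (leftCell b x → ℝ) :=
  (cellMatrix b x (adj n i)).vecMulLinear

theorem isCellAction_cellE (x : Sym n) : IsCellAction (cellE b x) (Pi.basisFun ℝ (leftCell b x)) := by
  classical
  intro i _ y
  funext z
  rw [Pi.basisFun_apply, cellE, Matrix.vecMulLinear_apply, Matrix.single_one_vecMul]
  simp [Pi.single_apply, cellMatrix]

theorem isTL_cellE (hb : IsKLBasis b) (hm : 2 * m ≤ n) :
    IsTL n m (cellE b (cellElt hm))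
      (Pi.basisFun ℝ (leftCell b (cellElt hm)) ⟨cellElt hm, .refl, .refl⟩) := by
  have hE := isCellAction_cellE (b := b) (cellElt hm)
  set F := Pi.basisFun ℝ (leftCell b (cellElt hm))
  have hX := desc_or_desc_of_mem_leftCell_cellElt hb hm
  have hcomm : ∀ i j, i + 1 < j → j + 1 < n → ∀ v, cellE b (cellElt hm) i (cellE b (cellElt hm) j v) =
      cellE b (cellElt hm) j (cellE b (cellElt hm) i v) := by
    intro i j hij hj v
    simp only [cellE, Matrix.vecMulLinear_apply, Matrix.vecMul_vecMul]
    rw [hb.cellMatrix_comm _ hj hij]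
  have hcup : ∀ k < m, cellE b (cellElt hm) (2 * k) (F ⟨cellElt hm, .refl, .refl⟩) =
      (2 : ℝ) • F ⟨cellElt hm, .refl, .refl⟩ := fun k hk =>
    hE.of_not_desc (by omega) (not_desc_cellElt hm hk)
  refine ⟨fun i hi => hE.sq hi, hcomm, fun i j hi hj hij v => ?_, hcup, fun i hmi hi => ?_⟩
  · have hXij : ∀ z ∈ leftCell b (cellElt hm), Desc (adj n i) z ∨ Desc (adj n j) z := by
      rcases hij with rfl | rfl
      · exact hX i hj
      · exact fun z hz => (hX j hi z hz).symm
    -- Only indices with non-descent `i` occur in the image of `E i`, and on these `E j` followed by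
    -- `E i` goes along a star operation and back.
    rw [← F.sum_repr (cellE b (cellElt hm) i v), map_sum, map_sum]
    refine Finset.sum_congr rfl fun z _ => ?_
    by_cases hz : Desc (adj n i) z
    · rw [hE.repr_apply_of_desc hi v hz, zero_smul, map_zero, map_zero]
    · obtain ⟨z', h1, h2⟩ := hE.exists_star hb hi hj hij hXij hz
      rw [map_smul, map_smul, h1, h2]
  · refine F.ext_elem fun z => ?_
    rw [map_zero, Finsupp.zero_apply]
    by_cases hz : Desc (adj n i) z
    · exact hE.repr_apply_of_desc hi _ hz
    -- The vector remains an eigenvector of `E (2k)` after applying `E i`, so its coordinate at an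
    -- element with descent `2k` vanishes.
    · obtain ⟨k, hk, hd⟩ := exists_desc_of_mem_leftCell_cellElt hb hm hmi hi z.2 hz
      refine hE.repr_eq_zero (i := 2 * k) (by omega) ?_ hd
      rw [hcomm _ _ (by omega) hi, hcup k hk, map_smul]

/-- Follow a chain in the left preorder from `cellElt` to `y`; dualising reverses its direction. At
each step `E i` turns a path vector into a multiple of one basis vector, and the non-zero structure
constant identifies that vector as the next in the chain. -/
theorem exists_pathVec_cellE (hb : IsKLBasis b) (hm : 2 * m ≤ n) (y : leftCell b (cellElt hm)) :
    ∃ h, IsPath n m h ∧ pathVec n m (cellE b (cellElt hm))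
      (Pi.basisFun ℝ (leftCell b (cellElt hm)) ⟨cellElt hm, .refl, .refl⟩) h =
        Pi.basisFun ℝ (leftCell b (cellElt hm)) y := by
  have hE := isCellAction_cellE (b := b) (cellElt hm)
  have hTL := isTL_cellE hb hm
  set F := Pi.basisFun ℝ (leftCell b (cellElt hm))
  have key : ∀ w, LeftLE b (cellElt hm) w → ∀ hw : w ∈ leftCell b (cellElt hm),
      ∃ h, IsPath n m h ∧ pathVec n m (cellE b (cellElt hm)) (F ⟨cellElt hm, .refl, .refl⟩) h =
        F ⟨w, hw⟩ := by
    intro w hw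
    induction hw with
    | refl => exact fun _ => ⟨_, isPath_lowPath n m, pathVec_lowPath _ _ _ _⟩
    | @tail y z hy hyz ih =>
      intro hz
      have hy' : y ∈ leftCell b (cellElt hm) :=
        mem_leftCell_of_between ⟨.refl, .refl⟩ hz hy (.single hyz)
      obtain ⟨h, hh, e⟩ := ih hy'
      by_cases hne : y = z
      · subst hne
        exact ⟨h, hh, e⟩
      obtain ⟨s, hs, hc⟩ := hb.cellCoeff_ne_zero hyz hne
      obtain ⟨i, hi, rfl⟩ := isSimple_iff.1 hs
      obtain ⟨c, h', _, hh', hE'⟩ := exists_apply_pathVec hh hi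
      refine ⟨h', hh', ?_⟩
      obtain ⟨w, hw⟩ := hE.pathVec_mem hb (desc_or_desc_of_mem_leftCell_cellElt hb hm) hTL hh'
      have h1 := hE' _ _ _ hTL
      rw [e, ← hw] at h1
      have h2 := hE.repr_apply hi (F ⟨y, hy'⟩) ⟨z, hz⟩
      rw [h1, map_smul, F.repr_self, F.repr_self, Finsupp.smul_apply,
        Finset.sum_eq_single ⟨y, hy'⟩ (fun k _ hk => by
          rw [Finsupp.single_eq_of_ne hk, zero_mul])
        (fun h => absurd (Finset.mem_univ _) h), Finsupp.single_eq_same, one_mul] at h2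
      rw [← hw]
      by_contra hne'
      rw [Finsupp.single_eq_of_ne (fun e => hne' (by rw [e])), smul_zero] at h2
      exact hc h2.symm
  exact key y.1 y.2.2 y.2

end TwoColumnCell

/-! ### Existence of left cell bases -/

section Existence

variable {n : ℕ} {μ : YoungDiagram}

/-- Only the identity preserves both the columns and the rows of `T`, so `{T}` has coefficient `1`.
-/
theorem poly_ne_zero (T : Tableau μ n) : poly T ≠ 0 := by
  classical
  intro h
  have h1 : polytabloid T (toTabloid T) = 0 := congrFun (congrArg Subtype.val h) _
  rw [polytabloid, Finset.sum_apply, Finset.sum_eq_single 1] at h1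
  · simp at h1
  · intro σ _ hσ
    split_ifs with hc
    · rw [permRep_single, Pi.smul_apply, Pi.single_apply, if_neg, smul_zero]
      intro e
      have hr : rowOf T = rowOf (T.trans σ) :=
        Quotient.exact (s := Setoid.ker (rowOf : Tableau μ n → Fin n → ℕ)) e
      refine hσ (Equiv.ext fun k => ?_)
      have h2 := congrFun hr (σ k)
      rw [rowOf_trans, ← Equiv.Perm.mul_apply, inv_mul_cancel, Equiv.Perm.one_apply] at h2
      exact T.symm.injective (Subtype.ext (Prod.ext h2 (hc k)))
    · rfl
  · exact fun h => absurd (Finset.mem_univ _) h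

/-- The Specht module is isomorphic to the dual left cell representation. -/
theorem exists_isCellAction (hn : μ.card = n) (hμ : μ.rowLen 0 ≤ 2) {b : Sym n → Hecke n}
    (hb : IsKLBasis b) : ∃ (x : Sym n) (G : Module.Basis (leftCell b x) ℝ (specht μ n)),
      IsCellAction (spechtE μ n) G := by
  have hbn := two_mul_colLen_le hn hμ
  obtain ⟨g, _, hg⟩ := exists_cupProj_ne_zero hn hμ (U := Set.univ) (fun _ _ _ _ => trivial)
    (u := poly (rowTableau hn hμ)) trivial (poly_ne_zero _)
  have hf := isCupped_cupProj g
  set f := cupProj μ n (μ.colLen 1) g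
  have hTL := hf.isTL hn hμ
  have hTL' := isTL_cellE hb hbn
  have hE := isCellAction_cellE (b := b) (cellElt hbn)
  have hpath := exists_pathVec_cellE hb hbn
  set F := Pi.basisFun ℝ (leftCell b (cellElt hbn))
  set E := cellE b (cellElt hbn)
  let P := Module.Basis.mk (hf.linearIndependent_pathVec hn hμ hg)
    (hf.span_pathVec hn hμ hg).ge
  have hP : ∀ h, P h = pathVec n (μ.colLen 1) (spechtE μ n) f h.1 := fun h =>
    Module.Basis.mk_apply ..
  -- Path vectors go to path vectors. Equivariance follows because `exists_apply_pathVec` gives the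
  -- same scalar and the same path in both modules.
  let Ψ : specht μ n →ₗ[ℝ] (leftCell b (cellElt hbn) → ℝ) :=
    P.constr ℝ fun h => pathVec n (μ.colLen 1) E (F ⟨cellElt hbn, .refl, .refl⟩) h.1
  have hΨ : ∀ h, IsPath n (μ.colLen 1) h → Ψ (pathVec n (μ.colLen 1) (spechtE μ n) f h) =
      pathVec n (μ.colLen 1) E (F ⟨cellElt hbn, .refl, .refl⟩) h := fun h hh => by
    rw [← hP ⟨h, hh⟩]
    exact P.constr_basis ..
  have hΨE : ∀ i, i + 1 < n → ∀ u, Ψ (spechtE μ n i u) = E i (Ψ u) := by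
    intro i hi u
    have : Ψ ∘ₗ spechtE μ n i = E i ∘ₗ Ψ := by
      refine P.ext fun h => ?_
      obtain ⟨c, h', _, hh', hc⟩ := exists_apply_pathVec h.2 hi
      rw [LinearMap.comp_apply, LinearMap.comp_apply, hP, hΨ _ h.2, hc _ _ _ hTL, hc _ _ _ hTL',
        map_smul, hΨ _ hh']
    exact congrArg (fun φ => φ u) this
  have hΨf : Ψ f = F ⟨cellElt hbn, .refl, .refl⟩ := by
    have := hΨ _ (isPath_lowPath _ _)
    rwa [pathVec_lowPath, pathVec_lowPath] at this
  -- The kernel is invariant and contains no non-zero cupped vector, since `Ψ f` is a basis vector.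
  have hinj : LinearMap.ker Ψ = ⊥ := by
    have hker : ∀ i, i + 1 < n → ∀ u ∈ LinearMap.ker Ψ, spechtE μ n i u ∈ LinearMap.ker Ψ := by
      intro i hi u hu
      rw [LinearMap.mem_ker] at hu ⊢
      rw [hΨE i hi, hu, map_zero]
    refine eq_bot_of_cupProj hn hμ hker fun u hu => ?_
    have h1 : Ψ (cupProj μ n (μ.colLen 1) u) = 0 :=
      cupProj_mem (S := LinearMap.ker Ψ) hbn hker hu le_rfl
    obtain ⟨c, hc⟩ := hf.eq_smul hn hμ hg (isCupped_cupProj u)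
    rw [hc, map_smul, hΨf] at h1
    rw [hc, (smul_eq_zero.1 h1).resolve_right (F.ne_zero _), zero_smul]
  have hsurj : LinearMap.range Ψ = ⊤ := by
    rw [eq_top_iff, ← F.span_eq, Submodule.span_le]
    rintro _ ⟨y, rfl⟩
    obtain ⟨h, hh, e⟩ := hpath y
    exact ⟨_, (hΨ h hh).trans e⟩
  let Φ := LinearEquiv.ofBijective Ψ ⟨LinearMap.ker_eq_bot.1 hinj, LinearMap.range_eq_top.1 hsurj⟩
  refine ⟨cellElt hbn, F.map Φ.symm, fun i hi y => Φ.injective ?_⟩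
  have hΦ : ∀ z, Φ (F.map Φ.symm z) = F z := fun z => by simp
  have h1 : Φ (spechtE μ n i (F.map Φ.symm y)) = E i (Φ (F.map Φ.symm y)) := hΨE i hi _
  rw [h1, map_sum, hΦ, hE i hi]
  exact Finset.sum_congr rfl fun z _ => by rw [map_smul, hΦ]

theorem exists_isKLLeftCellBasis (hn : μ.card = n) (hμ : μ.rowLen 0 ≤ 2) :
    ∃ (ι : Type) (_ : Fintype ι) (B : Module.Basis ι ℝ (specht μ n)), IsKLLeftCellBasis B := by
  classical
  obtain ⟨b, hb⟩ := exists_isKLBasis n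
  obtain ⟨x, G, hG⟩ := exists_isCellAction hn hμ hb
  refine ⟨leftCell b x, inferInstance,
    LinearMap.BilinForm.dualBasis (spechtForm μ n) spechtForm_nondegenerate G,
    b, hb, x, Equiv.refl _, fun s hs => ?_⟩
  set B := LinearMap.BilinForm.dualBasis (spechtForm μ n) spechtForm_nondegenerate G
  have hrepr : ∀ u i, B.repr u i = spechtForm μ n u (G i) := fun u i =>
    LinearMap.BilinForm.dualBasis_repr_apply spechtForm_nondegenerate G u i
  have hBG : ∀ i j, spechtForm μ n (B i) (G j) = if j = i then 1 else 0 :=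
    LinearMap.BilinForm.apply_dualBasis_left spechtForm_nondegenerate G
  refine ⟨fun y z => cellCoeff b s y z - if y = z then 1 else 0,
    (hb.isCellMatrix_iff hs).2 fun y z => rfl, fun j => B.ext_elem fun i => ?_⟩
  obtain ⟨k, hk, rfl⟩ := isSimple_iff.1 hs
  have h1 : spechtAct μ (adj n k) (B j) = spechtE μ n k (B j) - B j := by
    rw [spechtE_apply, add_sub_cancel_left]
  have h2 : spechtForm μ n (spechtAct μ (adj n k) (B j)) (G i) =
      cellCoeff b (adj n k) i j - if i = j then 1 else 0 := by
    rw [h1, map_sub, LinearMap.sub_apply, spechtForm_spechtE, hG k hk, hBG, map_sum]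
    simp only [map_smul, hBG]
    simp
  rw [hrepr, h2]
  simp only [map_sum, map_smul, Finsupp.coe_finsetSum, Finset.sum_apply, Finsupp.smul_apply,
    Module.Basis.repr_self, smul_eq_mul, Equiv.refl_apply]
  rw [Finset.sum_eq_single i (fun l _ hl => by rw [Finsupp.single_eq_of_ne hl.symm, mul_zero])
    (fun h => absurd (Finset.mem_univ _) h), Finsupp.single_eq_same, mul_one]
  congr

end Existence

end KLCone

end

theorem mainTheorem4 (n : ℕ) (μ : YoungDiagram) (hn : μ.card = n) (hμ : μ.rowLen 0 ≤ 2) :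
    (∃ (ι : Type) (_ : Fintype ι) (B : Module.Basis ι ℝ (KLCone.specht μ n)),
      KLCone.IsKLLeftCellBasis B) ∧
    ∀ (ι : Type) [Fintype ι] (B : Module.Basis ι ℝ (KLCone.specht μ n)),
      KLCone.IsKLLeftCellBasis B →
        KLCone.IsMaximalInvariantCone (PointedCone.hull ℝ (Set.range B)) :=
  ⟨KLCone.exists_isKLLeftCellBasis hn hμ,
    fun _ _ _ hB => hB.isMaximalInvariantCone hn hμ⟩
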